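/- **Setting.** Signals are real functions of time. White Gaussian noise of intensity $N_0/2$ is the centred generalized Gaussian process $\{W(g)\}_{g\in L^2(\mathbb R)}$ of linear functionals $W(g)=\int W(t)g(t)\,dt$ with $\mathbb E[W(g)W(h)]=\frac{N_0}{2}\int g(t)h(t)\,dt$; if a signal $x$ is sent, a receiver observes all functionals $g\mapsto\int x(t)g(t)\,dt+W(g)$, $g\in L^2(\mathbb R)$. A *code of duration $T$* consists of integers $M,K\ge1$, finite-energy codewords $x_{ms}$ ($1\le m\le M$, $1\le s\le K$) that vanish outside $[0,T]$, and a decoder $\Gamma$ producing $\widehat M\in\{0,1,\dots,M\}$ from the shared key $s$ and Bob's observation. The key $S$ is uniform on $\{1,\dots,K\}$. If the transmitter is silent ($\Lambda=0$), the zero signal is sent and the message is $0$; if it is active ($\Lambda=1$), the message is uniform on $\{1,\dots,M\}$. Bob's noise has intensity $N_b/2$ and the warden's noise has intensity $N_w/2$. Put $$P_{\rm err}=\max_{s}\mathbb P(\widehat M\ne M\mid S=s,\Lambda=1)+\mathbb P(\widehat M\ne0\mid\Lambda=0).$$ For a (measurable) test $\Phi$ of the warden's observation, $P_{\rm FA}(\Phi)$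 and $P_{\rm MD}(\Phi)$ are its probabilities of false alarm and of missed detection between $\Lambda=0$ and $\Lambda=1$; the warden does not know the key. The energy spectral density of the code is $\widehat E(f)=\frac1{MK}\sum_{m,s}|\widehat{x_{ms}}(f)|^2$, where $\widehat x(f)=\int x(t)e^{-2\pi \mathrm{j} ft}\,dt$. A *spectral mask* $\mathcal S_W$ is given by a bandwidth $W>0$ and non-decreasing real sequences $U_i,\alpha_i,\eta_i$, $1\le i\le l$, $l\ge1$; put $V_i=10^{-U_i/10}$. The code *fits* $\mathcal S_W$ if for every $i$: $\widehat E(f)<V_i\max\widehat E$ for all $f\ge\alpha_iW$, and $\int_{-\alpha_iW}^{\alpha_iW}\widehat E\,df\ge\eta_i\int_{-\infty}^\infty\widehat E\,df$. We assume $\alpha_i>0$ and $\eta_i<1$ for all $i$, and that $U_i>0$ or $\eta_i>0$ for some $i$. For $T_0>0$ and $\beta\in[0,1]$ the root raised cosine (RRC) pulse is $$\phi_{T_0,\beta}(t)=\begin{cases}\sqrt{\frac{1+\beta}{T_0}},&|t|\le\frac{1-\beta}{1+\beta}\frac{T_0}2,\\[2pt] \sqrt{\frac{1+\beta}{2T_0}\Big(1+\cos\Big[\frac{\pi(1+\beta)}{T_0\beta}\Big(|t|-\frac{1-\beta}{1+\beta}\frac{T_0}{2}\Big)\Big]\Big)},&\frac{1-\beta}{1+\beta}\frac{T_0}2<|t|\le\frac{T_0}2,\\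 0,&|t|>\frac{T_0}2.\end{cases}$$ Let $T_0^*(\mathcal S_W,\beta)$ be the infimum of all $T_0>0$ such that for every $i$: $|\widehat\phi_{T_0,\beta}(f)|^2<V_i|\widehat\phi_{T_0,\beta}(0)|^2$ for all $f\ge\alpha_iW$, and $\int_{-\alpha_iW}^{\alpha_iW}|\widehat\phi_{T_0,\beta}(f)|^2df\ge\eta_i$. Put $c(\beta)=W_0\,T_0^*(\mathcal S_{W_0},\beta)$, where $\mathcal S_{W_0}$ has the same $U_i,\alpha_i,\eta_i$ and the bandwidth $W_0>0$ may be chosen arbitrarily. Let $Q(\lambda)=\frac1{\sqrt{2\pi}}\int_\lambda^\infty e^{-u^2/2}du$. **Theorem.** For every such spectral mask $\mathcal S_W$, all $N_w,N_b>0$ and every $\delta\in(0,1)$, the throughput pair $$r=\frac{N_w}{N_b}\sqrt{\frac{2W}{\inf_{\beta\in[0,1]}c(\beta)}}\;Q^{-1}\Big(\frac{1-\delta}2\Big),\qquad r_K=\Big(1-\frac{N_w}{N_b}\Big)^{+}\sqrt{\frac{2W}{\inf_{\beta\in[0,1]}c(\beta)}}\;Q^{-1}\Big(\frac{1-\delta}2\Big)$$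 is achievable: there are codes $\mathcal C_T$ of duration $T$ such that, as $T\to\infty$, $$\liminf\frac{\log M}{\sqrt T}\ge r,\quad \limsup\frac{\log K}{\sqrt T}\le r_K,\quad P_{\rm err}\to0,\quad \lim\,\min_\Phi\{P_{\rm FA}(\Phi)+P_{\rm MD}(\Phi)\}\ \text{exists and is}\ \ge1-\delta,$$ and $\mathcal C_T$ fits $\mathcal S_W$ for all sufficiently large $T$. Moreover, the codes can be taken such that $\log M=O(\sqrt{WT})$ and such that, for all sufficiently large $T$, $\mathcal C_T$ uses pulse amplitude modulation with BPSK and RRC pulses: there are $a>0$, $T_0>0$ and $\beta\in[0,1]$, depending on $T$ only, such that every codeword has the form $\sum_{i=1}^{\lfloor T/T_0\rfloor}x_i\,\phi_{T_0,\beta}\big(t-(i-\tfrac12)T_0\big)$ with all $x_i\in\{-a,a\}$. -/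

import Mathlib

open MeasureTheory ProbabilityTheory Filter Topology
open scoped RealInnerProductSpace FourierTransform

noncomputable section
namespace CovertAWGN

/-! ### White Gaussian noise -/

/-- Square-integrable real functions of time, modulo equality almost everywhere. -/
abbrev FiniteEnergy : Type := Lp ℝ 2 (volume : Measure ℝ)

/-- White Gaussian noise of intensity `N₀ / 2` is a generalized process: what is random are its
linear functionals `w g = ∫ W(t) g(t) dt`, one for every square-integrable `g`.  A measure `μ` on
`FiniteEnergy → ℝ` (with the product σ-algebra) is the law of white Gaussian noise if these
functionals are jointly Gaussian and centred, with `E (w g * w h) = N₀ / 2 * ∫ g h`. Such a law is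
unique, since all its finite-dimensional marginals are prescribed. -/
structure IsWhiteNoise (N₀ : ℝ) (μ : Measure (FiniteEnergy → ℝ)) : Prop where
  gaussian : IsGaussianProcess (fun (g : FiniteEnergy) (w : FiniteEnergy → ℝ) => w g) μ
  mean_zero : ∀ g : FiniteEnergy, ∫ w, w g ∂μ = 0
  covariance : ∀ g h : FiniteEnergy, ∫ w, w g * w h ∂μ = N₀ / 2 * ∫ t, g t * h t


/-- The characteristic functional of a square-integrable random variable, at frequency one. -/
def charFunctional {Ω : Type} [MeasurableSpace Ω] (P : Measure Ω) (v : Lp ℝ 2 P) : ℂ := ∫ ω, Complex.exp ((v ω : ℝ) * Complex.I) ∂P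

lemma continuous_charFunctional {Ω : Type} [MeasurableSpace Ω] {P : Measure Ω} [IsProbabilityMeasure P] :
     Continuous (charFunctional P) := by
  have key : ∀ v w : Lp ℝ 2 P, dist (charFunctional P v) (charFunctional P w) ≤ dist v w := by
    intro v w
    have hint : ∀ u : Lp ℝ 2 P,
        Integrable (fun ω => Complex.exp ((u ω : ℝ) * Complex.I)) P := by
      intro u
      refine Integrable.of_bound (C := 1) ?_ ?_
      · have := (Lp.aestronglyMeasurable u).aemeasurable
        exact (Complex.measurable_exp.comp_aemeasurable
          ((Complex.measurable_ofReal.comp_aemeasurable this).mul_const _)).aestronglyMeasurable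
      · exact ae_of_all _ fun ω => by simp [Complex.norm_exp_ofReal_mul_I]
    have h1 : Integrable (fun ω => |(v - w : Lp ℝ 2 P) ω|) P :=
      ((Lp.memLp (v - w)).integrable (by norm_num)).abs
    rw [dist_eq_norm, charFunctional, charFunctional, ← integral_sub (hint v) (hint w)]
    calc ‖∫ ω, (Complex.exp ((v ω : ℝ) * Complex.I) - Complex.exp ((w ω : ℝ) * Complex.I)) ∂P‖
        ≤ ∫ ω, |(v - w : Lp ℝ 2 P) ω| ∂P := by
          refine norm_integral_le_of_norm_le h1 ?_
          filter_upwards [Lp.coeFn_sub v w] with ω hω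
          rw [hω, Pi.sub_apply]
          have : Complex.exp ((v ω : ℝ) * Complex.I) - Complex.exp ((w ω : ℝ) * Complex.I)
              = Complex.exp ((w ω : ℝ) * Complex.I) *
                (Complex.exp (Complex.I * ((v ω - w ω : ℝ) : ℂ)) - 1) := by
            rw [mul_sub, ← Complex.exp_add]; push_cast; ring_nf
          rw [this, norm_mul, Complex.norm_exp_ofReal_mul_I, one_mul]
          exact Real.norm_exp_I_mul_ofReal_sub_one_le
      _ ≤ dist v w := by
          rw [dist_eq_norm, Lp.norm_def]
          have h2 : ∫ ω, |(v - w : Lp ℝ 2 P) ω| ∂P = (eLpNorm (v - w : Lp ℝ 2 P) 1 P).toReal := by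
            rw [eLpNorm_one_eq_lintegral_enorm,
              ← integral_norm_eq_lintegral_enorm (Lp.aestronglyMeasurable _)]
            rfl
          rw [h2]
          exact ENNReal.toReal_mono (Lp.eLpNorm_ne_top _)
            (eLpNorm_le_eLpNorm_of_exponent_le (by norm_num) (Lp.aestronglyMeasurable _))
  exact (LipschitzWith.mk_one key).continuous

lemma charFunctional_of_gaussian {Ω : Type} [MeasurableSpace Ω] {P : Measure Ω}
    (v : Lp ℝ 2 P) (hv : HasGaussianLaw v P) (h0 : ∫ ω, v ω ∂P = 0) :
    charFunctional P v = Complex.exp (-(‖v‖ ^ 2 : ℝ) / 2) := by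
  have h := hv.charFun_map_eq (1 : ℝ)
  have hvar : Var[fun ω => ⟪(1 : ℝ), v ω⟫; P] = ‖v‖ ^ 2 := by
    simp only [RCLike.inner_apply, conj_trivial, mul_one]
    rw [variance_eq_integral (Lp.aestronglyMeasurable v).aemeasurable, h0,
      ← real_inner_self_eq_norm_sq, L2.inner_def]
    refine integral_congr_ae (ae_of_all _ fun ω => ?_)
    simp [pow_two]
  rw [hvar] at h
  rw [charFun_apply, integral_map hv.aemeasurable (by fun_prop)] at h
  simp only [RCLike.inner_apply, conj_trivial, mul_one, one_mul] at h
  rw [charFunctional]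
  convert h using 2
  rw [h0]; simp; ring

/-- An isometry of `L²` into a space of centred Gaussian variables. -/
lemma exists_gaussian_isometry (H : Type) [NormedAddCommGroup H] [InnerProductSpace ℝ H]
    [CompleteSpace H] : ∃ (Ω : Type) (_ : MeasurableSpace Ω) (P : Measure Ω)
      (_ : IsProbabilityMeasure P) (J : H →ₗᵢ[ℝ] Lp ℝ 2 P),
      ∀ g, charFunctional P (J g) = Complex.exp (-(‖g‖ ^ 2 : ℝ) / 2) ∧ ∫ ω, J g ω ∂P = 0 := by
  obtain ⟨w, b, -⟩ := exists_hilbertBasis ℝ H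
  let P : Measure (w → ℝ) := Measure.infinitePi (fun _ => gaussianReal 0 1)
  have hP : IsProbabilityMeasure P := by infer_instance
  have hlaw : ∀ i : w, P.map (fun ω => ω i) = gaussianReal 0 1 := fun i =>
    Measure.infinitePi_map_eval (fun _ : w => gaussianReal 0 1) i
  have hgl : ∀ i : w, HasGaussianLaw (fun ω : w → ℝ => ω i) P := fun i =>
    ⟨by rw [hlaw i]; infer_instance⟩
  have hind : iIndepFun (fun (i : w) (ω : w → ℝ) => ω i) P :=
    iIndepFun_infinitePi (X := fun _ x => x) (fun _ => measurable_id)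
  have hmem : ∀ i : w, MemLp (fun ω : w → ℝ => ω i) 2 P := fun i => (hgl i).memLp_two
  let ξ : w → Lp ℝ 2 P := fun i => (hmem i).toLp
  have hξ : ∀ i, ξ i =ᵐ[P] fun ω => ω i := fun i => (hmem i).coeFn_toLp
  have hmean : ∀ i : w, ∫ ω, ω i ∂P = 0 := fun i => by
    have := integral_map (μ := P) (φ := fun ω : w → ℝ => ω i) (f := fun x : ℝ => x)
      (measurable_pi_apply i).aemeasurable (by fun_prop)
    rw [← this, hlaw i, integral_id_gaussianReal]
  have hinner : ∀ i j : w, ⟪ξ i, ξ j⟫ = ∫ ω, ω i * ω j ∂P := fun i j => by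
    rw [L2.inner_def]
    refine integral_congr_ae ?_
    filter_upwards [hξ i, hξ j] with ω h1 h2
    rw [h1, h2]; simp [mul_comm]
  have horth : Orthonormal ℝ ξ := by
    classical
    rw [orthonormal_iff_ite]
    intro i j
    rw [hinner]
    split_ifs with hij
    · subst hij
      have hv : Var[fun ω : w → ℝ => ω i; P] = 1 := by
        have := variance_map (μ := P) (Y := fun ω : w → ℝ => ω i) (X := fun x : ℝ => x)
          (by fun_prop) (measurable_pi_apply i).aemeasurable
        rw [hlaw i, variance_fun_id_gaussianReal] at this
        rw [Function.comp_def] at this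
        simpa using this.symm
      rw [variance_eq_integral (measurable_pi_apply i).aemeasurable, hmean] at hv
      simpa [pow_two] using hv
    · have h := (hind.indepFun hij).integral_mul_eq_mul_integral
        (hmem i).aestronglyMeasurable (hmem j).aestronglyMeasurable
      simpa [hmean, Pi.mul_apply] using h
  let J : H →ₗᵢ[ℝ] Lp ℝ 2 P :=
    horth.orthogonalFamily.linearIsometry.comp b.repr.toLinearIsometry
  have hsum : ∀ g, HasSum (fun i => b.repr g i • ξ i) (J g) := fun g => by
    simpa [J] using horth.orthogonalFamily.hasSum_linearIsometry (b.repr g)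
  have hfin : ∀ (c : w → ℝ) (s : Finset w),
      ∀ᵐ ω ∂P, (∑ i ∈ s, c i • ξ i : Lp ℝ 2 P) ω = ∑ i ∈ s, c i * ω i := fun c s => by
    have h1 : ∀ᵐ ω ∂P, ∀ i ∈ s, ((c i • ξ i : Lp ℝ 2 P)) ω = c i * ω i := by
      refine (ae_ball_iff s.countable_toSet).2 fun i _ => ?_
      filter_upwards [Lp.coeFn_smul (c i) (ξ i), hξ i] with ω h2 h3
      rw [h2, Pi.smul_apply, h3, smul_eq_mul]
    filter_upwards [h1, Lp.coeFn_finsetSum s (fun i => c i • ξ i)] with ω h2 h3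
    rw [h3, Finset.sum_apply]
    exact Finset.sum_congr rfl h2
  have hgauss : ∀ (c : w → ℝ) (s : Finset w),
      HasGaussianLaw (∑ i ∈ s, c i • ξ i : Lp ℝ 2 P) P := fun c s => by
    have h1 : HasGaussianLaw (fun (ω : w → ℝ) (i : s) => ω i) P :=
      iIndepFun.hasGaussianLaw (X := fun (i : s) (ω : w → ℝ) => ω i) (fun i => hgl i)
        (hind.precomp Subtype.val_injective)
    have h2 := h1.map_fun (∑ i : s, c i • ContinuousLinearMap.proj (R := ℝ) (φ := fun _ : s => ℝ) i)
    refine h2.congr ?_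
    filter_upwards [hfin c s] with ω h
    rw [h, ← Finset.sum_coe_sort s (fun i => c i * ω i)]
    simp
  have hmean' : ∀ (c : w → ℝ) (s : Finset w),
      ∫ ω, (∑ i ∈ s, c i • ξ i : Lp ℝ 2 P) ω ∂P = 0 := fun c s => by
    rw [integral_congr_ae (hfin c s),
      integral_finsetSum _ fun i _ => ((hgl i).integrable.const_mul _)]
    simp [integral_const_mul, hmean]
  refine ⟨w → ℝ, inferInstance, P, hP, J, fun g => ⟨?_, ?_⟩⟩
  · have h1 : Tendsto (fun s : Finset w => charFunctional P (∑ i ∈ s, b.repr g i • ξ i)) atTop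
        (𝓝 (charFunctional P (J g))) := (continuous_charFunctional.tendsto _).comp (hsum g)
    have h2 : Tendsto (fun s : Finset w => charFunctional P (∑ i ∈ s, b.repr g i • ξ i)) atTop
        (𝓝 (Complex.exp (-(‖J g‖ ^ 2 : ℝ) / 2))) := by
      simp_rw [fun s => charFunctional_of_gaussian _ (hgauss (b.repr g) s) (hmean' (b.repr g) s)]
      have : Continuous fun v : Lp ℝ 2 P => Complex.exp (-(‖v‖ ^ 2 : ℝ) / 2) := by fun_prop
      exact (this.tendsto _).comp (hsum g)
    rw [tendsto_nhds_unique h1 h2, J.norm_map]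
  · have h1 : Tendsto (fun s : Finset w => ∫ ω, (∑ i ∈ s, b.repr g i • ξ i : Lp ℝ 2 P) ω ∂P) atTop
        (𝓝 (∫ ω, J g ω ∂P)) := by
      have hc : ∀ v : Lp ℝ 2 P, ∫ ω, v ω ∂P = ⟪indicatorConstLp 2 MeasurableSet.univ
          (measure_ne_top P _) (1 : ℝ), v⟫ := fun v => by
        rw [L2.inner_indicatorConstLp_one]; simp
      simp_rw [hc]
      have : Continuous fun v : Lp ℝ 2 P => ⟪indicatorConstLp 2 MeasurableSet.univ
          (measure_ne_top P _) (1 : ℝ), v⟫ := by fun_prop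
      exact (this.tendsto _).comp (hsum g)
    simp_rw [hmean'] at h1
    exact tendsto_nhds_unique h1 tendsto_const_nhds

/-- White Gaussian noise of every intensity exists. -/
theorem exists_isWhiteNoise (N₀ : ℝ) (hN : 0 ≤ N₀) :
    ∃ μ : Measure (FiniteEnergy → ℝ), IsWhiteNoise N₀ μ := by
  obtain ⟨Ω, _, P, _, J, hJ⟩ := exists_gaussian_isometry FiniteEnergy
  set σ : ℝ := √(N₀ / 2) with hσ
  have hσ2 : σ * σ = N₀ / 2 := Real.mul_self_sqrt (by positivity)
  let X : FiniteEnergy → Ω → ℝ := fun g ω => σ * J g ω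
  have hXm : ∀ g, AEMeasurable (X g) P := fun g =>
    (Lp.aestronglyMeasurable (J g)).aemeasurable.const_mul _
  -- measurable versions
  let Y : FiniteEnergy → Ω → ℝ := fun g => (hXm g).mk (X g)
  have hYm : ∀ g, Measurable (Y g) := fun g => (hXm g).measurable_mk
  have hYX : ∀ g, Y g =ᵐ[P] X g := fun g => (hXm g).ae_eq_mk.symm
  have hmeas : Measurable (fun ω g => Y g ω) := measurable_pi_lambda _ hYm
  have hone : ∀ g, P.map (J g) = gaussianReal 0 (‖g‖₊ ^ 2) := fun g => by
    have hm := (Lp.aestronglyMeasurable (J g)).aemeasurable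
    have := Measure.isProbabilityMeasure_map (μ := P) hm
    refine Measure.ext_of_charFun (funext fun t => ?_)
    rw [charFun_apply, integral_map hm (by fun_prop), charFun_gaussianReal]
    have h := (hJ (t • g)).1
    rw [charFunctional, map_smul, norm_smul] at h
    have h2 : ∫ ω, Complex.exp ((((t • J g : Lp ℝ 2 P) ω : ℝ) : ℂ) * Complex.I) ∂P
        = ∫ ω, Complex.exp (((⟪J g ω, t⟫ : ℝ) : ℂ) * Complex.I) ∂P := by
      refine integral_congr_ae ?_
      filter_upwards [Lp.coeFn_smul t (J g)] with ω hω
      rw [hω]; simp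
    rw [← h2, h]
    congr 1
    simp [mul_pow]; try ring
  have hgauss : IsGaussianProcess Y P := by
    refine IsGaussianProcess.congr (X := X) ⟨fun I => ⟨?_⟩⟩ (fun g => (hYX g).symm)
    classical
    refine isGaussian_of_map_eq_gaussianReal fun L => ?_
    have hrm : AEMeasurable (fun ω => I.restrict (X · ω)) P :=
      aemeasurable_pi_lambda _ fun i => hXm i
    rw [AEMeasurable.map_map_of_aemeasurable (by fun_prop) hrm]
    let c : I → ℝ := fun i => L (Pi.single i 1)
    have hL : (L ∘ fun ω => I.restrict (X · ω)) =ᵐ[P] J (∑ i : I, (σ * c i) • (i : FiniteEnergy)) := by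
      have h1 : ∀ᵐ ω ∂P, ∀ i : I,
          (((σ * c i) • J (i : FiniteEnergy) : Lp ℝ 2 P)) ω = σ * c i * J i ω := by
        refine ae_all_iff.2 fun i => ?_
        filter_upwards [Lp.coeFn_smul (σ * c i) (J i)] with ω h2
        rw [h2, Pi.smul_apply, smul_eq_mul]
      rw [map_sum]
      simp_rw [map_smul]
      filter_upwards [h1, Lp.coeFn_finsetSum Finset.univ
        (fun i : I => (σ * c i) • J (i : FiniteEnergy))] with ω h2 h3
      rw [h3, Finset.sum_apply, Finset.sum_congr rfl fun i _ => h2 i, Function.comp_apply]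
      have h4 := L.toLinearMap.pi_apply_eq_sum_univ (I.restrict (X · ω))
      rw [ContinuousLinearMap.coe_coe] at h4
      rw [h4]
      refine Finset.sum_congr rfl fun i _ => ?_
      have h5 : (fun j : I => if i = j then (1 : ℝ) else 0) = Pi.single i 1 := by
        ext j; simp [Pi.single_apply, eq_comm]
      rw [h5]
      simp only [Finset.restrict, smul_eq_mul, X, c]
      ring
    rw [Measure.map_congr hL, hone]
    exact ⟨_, _, rfl⟩
  refine ⟨P.map (fun ω g => Y g ω), ⟨⟨fun I => ⟨?_⟩⟩, fun g => ?_, fun g h => ?_⟩⟩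
  · rw [Measure.map_map (by fun_prop) hmeas]
    exact (hgauss.hasGaussianLaw I).isGaussian_map
  · rw [integral_map hmeas.aemeasurable (measurable_pi_apply g).aestronglyMeasurable,
      integral_congr_ae (hYX g),
      integral_const_mul, (hJ g).2, mul_zero]
  · rw [integral_map hmeas.aemeasurable
      (f := fun w : FiniteEnergy → ℝ => w g * w h)
      ((measurable_pi_apply g).mul (measurable_pi_apply h)).aestronglyMeasurable]
    have h1 : ∫ ω, Y g ω * Y h ω ∂P = N₀ / 2 * ∫ ω, J h ω * J g ω ∂P := by
      rw [← integral_const_mul]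
      refine integral_congr_ae ?_
      filter_upwards [hYX g, hYX h] with ω h1 h2
      rw [h1, h2, ← hσ2]; simp only [X]; ring
    have h2 := J.inner_map_map g h
    rw [L2.inner_def, L2.inner_def] at h2
    simp only [RCLike.inner_apply, conj_trivial] at h2
    rw [h1, h2]
    congr 1
    exact integral_congr_ae (ae_of_all _ fun t => mul_comm _ _)

/-- The law of white Gaussian noise of intensity `N₀ / 2`, for `0 ≤ N₀`. -/
def whiteNoise (N₀ : ℝ) : Measure (FiniteEnergy → ℝ) :=
  Classical.epsilon (IsWhiteNoise N₀)

theorem isWhiteNoise_whiteNoise {N₀ : ℝ} (hN : 0 ≤ N₀) : IsWhiteNoise N₀ (whiteNoise N₀) :=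
  Classical.epsilon_spec (exists_isWhiteNoise N₀ hN)

/-- What a receiver observes when the signal `x` is sent and the noise realization is `w`: all
linear functionals `g ↦ ∫ (x(t) + W(t)) g(t) dt`, over the whole time line. -/
def observe (x : ℝ → ℝ) (w : FiniteEnergy → ℝ) : FiniteEnergy → ℝ :=
  fun g => (∫ t, x t * g t) + w g

/-! ### Codes -/

/-- A code of duration `T`: `M` messages, `K` keys, a finite-energy codeword supported in `[0, T]`
for every message-key pair, and a decoder which sees the key and the observation.
The decoder's output `0` means that nothing was sent, and `m.succ` stands for the message `m`.
When the transmitter is silent, the signal is zero. -/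
structure Code (T : ℝ) where
  M : ℕ
  K : ℕ
  M_pos : 0 < M
  K_pos : 0 < K
  codeword : Fin M → Fin K → ℝ → ℝ
  memLp_codeword : ∀ m s, MemLp (codeword m s) 2 volume
  support_codeword : ∀ m s t, t ∉ Set.Icc 0 T → codeword m s t = 0
  decode : Fin K → (FiniteEnergy → ℝ) → Fin (M + 1)
  measurable_decode : ∀ s, Measurable (decode s)

namespace Code

variable {T : ℝ} (C : Code T)

/-- The max-average probability of error over noise of intensity `N_b / 2`: the error probability
of a uniform message, maximized over the key, plus the probability (over the uniform key and the
noise) that the decoder reports a message although the transmitter is silent. -/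
def errorProb (Nb : ℝ) : ℝ :=
  (⨆ s : Fin C.K, (∑ m : Fin C.M,
      (whiteNoise Nb).real {w | C.decode s (observe (C.codeword m s) w) ≠ m.succ}) / C.M)
    + (∑ s : Fin C.K, (whiteNoise Nb).real {w | C.decode s (observe 0 w) ≠ 0}) / C.K

/-- The probability of false alarm of the test `Φ`. -/
def falseAlarm (Nw : ℝ) (Φ : (FiniteEnergy → ℝ) → Bool) : ℝ :=
  (whiteNoise Nw).real {w | Φ (observe 0 w) = true}

/-- The probability of missed detection of the test `Φ`, for a uniform message-key pair. -/
def missedDetection (Nw : ℝ) (Φ : (FiniteEnergy → ℝ) → Bool) : ℝ :=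
  (∑ m : Fin C.M, ∑ s : Fin C.K,
    (whiteNoise Nw).real {w | Φ (observe (C.codeword m s) w) = false}) / (C.M * C.K)

/-- The least sum of the two error probabilities over all (measurable) tests of the warden. -/
def minDetectionError (Nw : ℝ) : ℝ :=
  ⨅ Φ : {Φ : (FiniteEnergy → ℝ) → Bool // Measurable Φ},
    (falseAlarm Nw Φ.1 + C.missedDetection Nw Φ.1)

/-- The energy spectral density of the code: the average of `|x̂(f)|²` over its codewords. -/
def esd (f : ℝ) : ℝ :=
  (∑ m : Fin C.M, ∑ s : Fin C.K, ‖𝓕 (fun t => (C.codeword m s t : ℂ)) f‖ ^ 2) / (C.M * C.K)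

end Code

/-! ### Spectral masks -/

/-- The parameters of a spectral mask, apart from its bandwidth. -/
structure SpectralMask where
  l : ℕ
  l_pos : 0 < l
  U : Fin l → ℝ
  α : Fin l → ℝ
  η : Fin l → ℝ
  monotone_U : Monotone U
  monotone_α : Monotone α
  monotone_η : Monotone η

namespace SpectralMask

variable (S : SpectralMask)

/-- The attenuation `V_i = 10 ^ (-U_i / 10)`. -/
def V (i : Fin S.l) : ℝ := (10 : ℝ) ^ (-(S.U i) / 10)

/-- The code fits into the mask `S` with bandwidth `W`. -/
def Fits (W : ℝ) {T : ℝ} (C : Code T) : Prop :=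
  ∀ i : Fin S.l,
    (∀ f : ℝ, S.α i * W ≤ f → C.esd f < S.V i * ⨆ f' : ℝ, C.esd f') ∧
    S.η i * ∫ f : ℝ, C.esd f ≤ ∫ f in (-(S.α i * W))..(S.α i * W), C.esd f

end SpectralMask

/-! ### Root raised cosine pulses -/

/-- The root raised cosine pulse of duration `T₀` and roll-off factor `β`, in the time domain. -/
def rrc (T₀ β t : ℝ) : ℝ :=
  if |t| ≤ (1 - β) / (1 + β) * (T₀ / 2) then √((1 + β) / T₀)
  else if |t| ≤ T₀ / 2 then
    √((1 + Real.cos (Real.pi * (1 + β) / (T₀ * β) * (|t| - (1 - β) / (1 + β) * (T₀ / 2))))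
      / (2 * T₀ / (1 + β)))
  else 0

/-- The spectrum of the root raised cosine pulse. -/
def rrcSpectrum (T₀ β f : ℝ) : ℂ := 𝓕 (fun t => (rrc T₀ β t : ℂ)) f

/-- The code is a PAM code with BPSK over root raised cosine pulses: for some amplitude `a`, pulse
duration `T₀` and roll-off factor `β`, every codeword is `∑ x_i φ(t - (i - 1/2) T₀)`, over
`i = 1, …, ⌊T / T₀⌋`, with all `x_i ∈ {-a, a}`. -/
def Code.IsBPSKwithRRC {T : ℝ} (C : Code T) : Prop :=
  ∃ a T₀ β : ℝ, 0 < a ∧ 0 < T₀ ∧ β ∈ Set.Icc (0 : ℝ) 1 ∧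
    ∀ (m : Fin C.M) (s : Fin C.K), ∃ x : Fin ⌊T / T₀⌋₊ → ℝ,
      (∀ i, x i = a ∨ x i = -a) ∧
      ∀ t, C.codeword m s t = ∑ i, x i * rrc T₀ β (t - ((i : ℝ) + 1 / 2) * T₀)

namespace SpectralMask

variable (S : SpectralMask)

/-- The pulse duration `T₀` is feasible for the mask `S` with bandwidth `W` and the roll-off
factor `β`. -/
def PulseFeasible (W β T₀ : ℝ) : Prop :=
  0 < T₀ ∧ ∀ i : Fin S.l,
    (∀ f : ℝ, S.α i * W ≤ f → ‖rrcSpectrum T₀ β f‖ ^ 2 < S.V i * ‖rrcSpectrum T₀ β 0‖ ^ 2) ∧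
    S.η i ≤ ∫ f in (-(S.α i * W))..(S.α i * W), ‖rrcSpectrum T₀ β f‖ ^ 2

/-- The least feasible pulse duration for a given roll-off factor. As the constraints on the peak
are strict inequalities, it is an infimum. -/
def optimalPulse (W β : ℝ) : ℝ := sInf {T₀ : ℝ | S.PulseFeasible W β T₀}

/-- The constant `c(β)`, computed from the bandwidth `W₀`. -/
def c (W₀ β : ℝ) : ℝ := W₀ * S.optimalPulse W₀ β

/-- The least value of `c(β)` over `β ∈ [0, 1]`. -/
def minC (W₀ : ℝ) : ℝ := ⨅ β : Set.Icc (0 : ℝ) 1, S.c W₀ β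

end SpectralMask

/-! ### Throughput -/

/-- The tail function `Q` of the standard normal distribution. -/
def gaussianTail (x : ℝ) : ℝ := 1 / √(2 * Real.pi) * ∫ u in Set.Ioi x, Real.exp (-u ^ 2 / 2)

/-- The inverse of `Q`, used on `(0, 1)` only, where `Q` is bijective from `ℝ`. -/
def gaussianTailInv (p : ℝ) : ℝ := Function.invFun gaussianTail p

/-- The family of codes, of all durations `T`, achieves the throughput pair `(r, rK)` as `T → ∞`,
over the mask `S` with bandwidth `W`. -/
structure Achieves (S : SpectralMask) (W Nw Nb δ r rK : ℝ) (C : ∀ T : ℝ, Code T) : Prop where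
  message_rate : (r : EReal) ≤ liminf (fun T : ℝ => ((Real.log (C T).M / √T : ℝ) : EReal)) atTop
  key_rate : limsup (fun T : ℝ => ((Real.log (C T).K / √T : ℝ) : EReal)) atTop ≤ (rK : EReal)
  reliable : Tendsto (fun T : ℝ => (C T).errorProb Nb) atTop (𝓝 0)
  covert : ∃ L : ℝ, 1 - δ ≤ L ∧ Tendsto (fun T : ℝ => (C T).minDetectionError Nw) atTop (𝓝 L)
  fits : ∀ᶠ T : ℝ in atTop, S.Fits W (C T)

end CovertAWGN

end

open scoped NNReal BigOperators

namespace CovertAWGN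

/-! ### Plancherel's theorem for integrable, square-integrable functions -/

/-! Take a feasible pulse whose time-bandwidth product is close to `minC` and send `n = ⌊T / T₀⌋`
BPSK symbols. Disjoint shifts of the pulse are orthonormal, so the coordinates of the observation
form a Gaussian vector, and the rest of the noise is independent of them and does not depend on the
signal. Both receivers thus face an `n`-dimensional Gaussian problem (`map_observe_pulses`,
`measureReal_observe`), and the warden's optimum is `∫ min 1 L`, with `L` the likelihood ratio of
the code (`Code.minDetectionError_eq`).

With total energy `A = n * a ^ 2 = κ * vw * √n`, the likelihood ratio of independent uniform symbols
is a product of hyperbolic cosines. Expanding `log cosh` to fourth order, the central limit theorem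
for the squares and the law of large numbers for the fourth powers show that its logarithm tends to
a normal law with mean `-κ² / 4` and variance `κ² / 2`. The optimal error therefore tends to `2 Q(κ
/ (2√2))` (`tendsto_integral_min_uniformLikelihood`), and `κ = 2√2 q` with `Q(q) = (1 - δ) / 2`
gives exactly `1 - δ`.

The code must imitate uniform symbols and still be decodable. For random code books `x` and key
signs `y`, the products `x m * y s` are pairwise independent and uniform, so a truncated second
moment bounds the `L¹` distance to the uniform likelihood ratio as soon as `log (M * K)` slightly
exceeds `A / (2 * vw)` (`expect_integral_abs_sub_le`). The legitimate receiver undoes the key, which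
leaves the noise invariant, and a threshold decoder succeeds if `log M` stays slightly below `A / (2
* vb)` (`expect_codebookError_le`). Hence `log M` is about `(Nw / Nb) * √2 * q * √n`, the key
supplies the positive part of the difference, and `√n ≈ √(W * T / minC)` gives the rates.

The mask has to hold for the actual code, not only on average over random codes. Multiplying the
keys by about `n` Walsh sign patterns makes distinct symbols exactly uncorrelated over the keys, so
the spectral density of the code is a multiple of that of the pulse (`sum_walsh_mul_walsh`,
`sum_norm_sq_fourier_pam`, `exists_codebook`). This costs `O(log n)` nats of key, which is
negligible against `√T`. A diagonal choice finally lets all margins tend to zero. -/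

lemma continuous_fourier_of_integrable {f : ℝ → ℂ} (h1 : Integrable f) : Continuous (𝓕 f) :=
  VectorFourier.fourierIntegral_continuous Real.continuous_fourierChar
    (by exact (innerSL ℝ).continuous₂) h1

/-- Both sides have the same integral against every smooth compactly supported function: the
transform can be moved to the test function, for the `L²` transform through tempered distributions
and for the integral by Fubini. -/
lemma fourier_toLp_ae_eq {f : ℝ → ℂ} (h1 : Integrable f) (h2 : MemLp f 2 volume) :
    (𝓕 (h2.toLp f) : Lp ℂ 2 (volume : Measure ℝ)) =ᵐ[volume] 𝓕 f := by
  refine ae_eq_of_integral_contDiff_smul_eq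
    ((Lp.memLp _).locallyIntegrable (by norm_num))
    (continuous_fourier_of_integrable h1).locallyIntegrable ?_
  intro g g_smooth g_cpt
  have hg₁ : HasCompactSupport (Complex.ofRealCLM ∘ g) := g_cpt.comp_left rfl
  have hg₂ : ContDiff ℝ ((⊤ : ℕ∞) : WithTop ℕ∞) (Complex.ofRealCLM ∘ g) :=
    Complex.ofRealCLM.contDiff.comp g_smooth
  let s : SchwartzMap ℝ ℂ := hg₁.toSchwartzMap hg₂
  have hs : ∀ x, s x = (g x : ℂ) := fun x => rfl
  have e1 : ∫ x, g x • (𝓕 (h2.toLp f) : Lp ℂ 2 (volume : Measure ℝ)) x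
      = ((𝓕 (h2.toLp f) : Lp ℂ 2 (volume : Measure ℝ)) : TemperedDistribution ℝ ℂ) s := by
    rw [Lp.toTemperedDistribution_apply]; rfl
  rw [e1, ← Lp.fourier_toTemperedDistribution_eq, TemperedDistribution.fourier_apply,
    Lp.toTemperedDistribution_apply]
  have e2 : ∫ x, (𝓕 s) x • (h2.toLp f) x = ∫ x, (𝓕 s) x • f x := by
    refine integral_congr_ae ?_
    filter_upwards [h2.coeFn_toLp] with x hx
    rw [hx]
  have e3 : ∫ x, (𝓕 (s : ℝ → ℂ)) x • f x = ∫ x, s x • 𝓕 f x := by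
    simpa using! VectorFourier.integral_fourierIntegral_smul_eq_flip (L := innerₗ ℝ)
      Real.continuous_fourierChar continuous_inner s.integrable (μ := volume) (ν := volume) h1
  rw [e2]
  rw [SchwartzMap.fourier_coe, e3]; rfl

lemma integral_norm_sq_eq_Lp {g : Lp ℂ 2 (volume : Measure ℝ)} :
    ∫ x, ‖g x‖ ^ 2 = ‖g‖ ^ 2 := by
  have h := congrArg Complex.re (L2.inner_def (𝕜 := ℂ) g g)
  rw [inner_self_eq_norm_sq_to_K] at h
  have h3 : ∀ x, (inner ℂ (g x) (g x) : ℂ) = ((‖g x‖ ^ 2 : ℝ) : ℂ) := fun x => by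
    rw [inner_self_eq_norm_sq_to_K]; simp
  simp_rw [h3] at h
  rw [integral_complex_ofReal] at h
  rw [Complex.ofReal_re] at h
  rw [← h]
  norm_cast

lemma integral_norm_sq_fourier {f : ℝ → ℂ} (h1 : Integrable f) (h2 : MemLp f 2 volume) :
    ∫ x, ‖𝓕 f x‖ ^ 2 = ∫ x, ‖f x‖ ^ 2 := by
  have e1 : ∫ x, ‖𝓕 f x‖ ^ 2 = ∫ x, ‖(𝓕 (h2.toLp f) : Lp ℂ 2 (volume : Measure ℝ)) x‖ ^ 2 := by
    refine integral_congr_ae ?_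
    filter_upwards [fourier_toLp_ae_eq h1 h2] with x hx
    rw [hx]
  have e2 : ∫ x, ‖f x‖ ^ 2 = ∫ x, ‖(h2.toLp f) x‖ ^ 2 := by
    refine integral_congr_ae ?_
    filter_upwards [h2.coeFn_toLp] with x hx
    rw [hx]
  rw [e1, e2, integral_norm_sq_eq_Lp, integral_norm_sq_eq_Lp, Lp.norm_fourier_eq]

/-! ### The root raised cosine pulse -/

lemma rolloff_ratio_mem {β : ℝ} (hβ : β ∈ Set.Icc (0 : ℝ) 1) :
    0 ≤ (1 - β) / (1 + β) ∧ (1 - β) / (1 + β) ≤ 1 := by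
  obtain ⟨h0, h1⟩ := hβ
  refine ⟨div_nonneg (by linarith) (by linarith), ?_⟩
  rw [div_le_one (by linarith)]; linarith

lemma rrc_nonneg (T₀ β t : ℝ) : 0 ≤ rrc T₀ β t := by
  unfold rrc; split_ifs <;> positivity

lemma rrc_eq_zero {T₀ β t : ℝ} (hT : 0 < T₀) (hβ : β ∈ Set.Icc (0 : ℝ) 1) (ht : T₀ / 2 < |t|) :
    rrc T₀ β t = 0 := by
  have h := rolloff_ratio_mem hβ
  have : (1 - β) / (1 + β) * (T₀ / 2) ≤ T₀ / 2 := by nlinarith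
  unfold rrc
  rw [if_neg (by linarith), if_neg (by linarith)]

lemma measurable_rrc (T₀ β : ℝ) : Measurable (rrc T₀ β) := by
  unfold rrc
  refine Measurable.ite (measurableSet_le (by fun_prop) (by fun_prop)) (by fun_prop) ?_
  refine Measurable.ite (measurableSet_le (by fun_prop) (by fun_prop)) (by fun_prop) (by fun_prop)

lemma rrc_le {T₀ β : ℝ} (hT : 0 < T₀) (hβ : β ∈ Set.Icc (0 : ℝ) 1) (t : ℝ) :
    rrc T₀ β t ≤ √((1 + β) / T₀) := by
  have h0 := hβ.1
  unfold rrc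
  split_ifs
  · exact le_rfl
  · refine Real.sqrt_le_sqrt ?_
    have h1 : (1 + β) / T₀ = 2 / (2 * T₀ / (1 + β)) := by field_simp
    rw [h1]
    gcongr
    linarith [Real.cos_le_one (Real.pi * (1 + β) / (T₀ * β) * (|t| - (1 - β) / (1 + β) * (T₀ / 2)))]
  · positivity

lemma rrc_eq_indicator {T₀ β : ℝ} (hT : 0 < T₀) (hβ : β ∈ Set.Icc (0 : ℝ) 1) :
    rrc T₀ β = (Set.Icc (-(T₀ / 2)) (T₀ / 2)).indicator (rrc T₀ β) := by
  ext t
  by_cases h : t ∈ Set.Icc (-(T₀ / 2)) (T₀ / 2)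
  · rw [Set.indicator_of_mem h]
  · rw [Set.indicator_of_notMem h, rrc_eq_zero hT hβ]
    by_contra hh
    exact h (abs_le.1 (not_lt.1 hh))

lemma memLp_rrc {T₀ β : ℝ} (hT : 0 < T₀) (hβ : β ∈ Set.Icc (0 : ℝ) 1) (p : ENNReal) :
    MemLp (rrc T₀ β) p volume := by
  rw [rrc_eq_indicator hT hβ, memLp_indicator_iff_restrict measurableSet_Icc]
  refine MemLp.of_bound (measurable_rrc _ _).aestronglyMeasurable (√((1 + β) / T₀))
    (ae_of_all _ fun t => ?_)
  rw [Real.norm_of_nonneg (rrc_nonneg _ _ _)]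
  exact rrc_le hT hβ t

lemma integrable_rrc {T₀ β : ℝ} (hT : 0 < T₀) (hβ : β ∈ Set.Icc (0 : ℝ) 1) :
    Integrable (rrc T₀ β) := memLp_one_iff_integrable.1 (memLp_rrc hT hβ 1)

/-- The cosine runs over half a period on each flank and integrates to zero, so a flank carries half
the energy of a plateau of the same width. -/
lemma integral_rrc_sq {T₀ β : ℝ} (hT : 0 < T₀) (hβ : β ∈ Set.Icc (0 : ℝ) 1) :
    ∫ t, rrc T₀ β t ^ 2 = 1 := by
  have hr := rolloff_ratio_mem hβ
  have hβ0 := hβ.1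
  set t₁ : ℝ := (1 - β) / (1 + β) * (T₀ / 2) with ht₁
  have h10 : 0 ≤ t₁ := mul_nonneg hr.1 (by linarith)
  have h1T : t₁ ≤ T₀ / 2 := by nlinarith [hr.2]
  have hsq : Integrable (fun t => rrc T₀ β t ^ 2) := (memLp_rrc hT hβ 2).integrable_sq
  have e0 : ∫ t, rrc T₀ β t ^ 2 = ∫ t, (fun s => rrc T₀ β s ^ 2) |t| := by
    refine integral_congr_ae (ae_of_all _ fun t => ?_)
    simp only [rrc, abs_abs]
  rw [e0, integral_comp_abs (f := fun s => rrc T₀ β s ^ 2)]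
  have e1 : ∫ t in Set.Ioi (0:ℝ), rrc T₀ β t ^ 2 = ∫ t in (0:ℝ)..(T₀ / 2), rrc T₀ β t ^ 2 := by
    rw [intervalIntegral.integral_of_le (by linarith)]
    refine setIntegral_eq_of_subset_of_ae_sdiff_eq_zero measurableSet_Ioi.nullMeasurableSet
      (fun t ht => ht.1) (ae_of_all _ fun t ht => ?_)
    rw [rrc_eq_zero hT hβ, zero_pow two_ne_zero]
    have h1 : 0 < t := ht.1
    have h2 : ¬ (0 < t ∧ t ≤ T₀ / 2) := ht.2
    rw [abs_of_pos h1]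
    by_contra h3
    exact h2 ⟨h1, not_lt.1 h3⟩
  rw [e1, ← intervalIntegral.integral_add_adjacent_intervals (b := t₁)
    hsq.intervalIntegrable hsq.intervalIntegrable]
  have e2 : ∫ t in (0:ℝ)..t₁, rrc T₀ β t ^ 2 = t₁ * ((1 + β) / T₀) := by
    have : ∫ t in (0:ℝ)..t₁, rrc T₀ β t ^ 2 = ∫ t in (0:ℝ)..t₁, ((1 + β) / T₀) := by
      refine intervalIntegral.integral_congr fun t ht => ?_
      rw [Set.uIcc_of_le h10] at ht
      simp only [rrc]
      rw [abs_of_nonneg ht.1, if_pos ht.2, Real.sq_sqrt (by positivity)]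
    rw [this, intervalIntegral.integral_const]; simp
  set k : ℝ := Real.pi * (1 + β) / (T₀ * β) with hk
  have e3 : ∫ t in t₁..(T₀ / 2), rrc T₀ β t ^ 2
      = ∫ t in t₁..(T₀ / 2), (1 + Real.cos (k * (t - t₁))) / (2 * T₀ / (1 + β)) := by
    refine intervalIntegral.integral_congr_ae (ae_of_all _ fun t ht => ?_)
    rw [Set.uIoc_of_le h1T] at ht
    simp only [rrc]
    rw [abs_of_nonneg (h10.trans ht.1.le), if_neg (by rw [← ht₁]; exact not_le.2 ht.1),
      if_pos ht.2, Real.sq_sqrt]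
    refine div_nonneg ?_ (by positivity)
    linarith [Real.neg_one_le_cos (Real.pi * (1 + β) / (T₀ * β) * (t - (1 - β) / (1 + β) * (T₀ / 2)))]
  rw [e2, e3, intervalIntegral.integral_div]
  -- For `β = 0` there is no flank, and `k` has a zero denominator; this case is separate.
  rcases hβ0.eq_or_lt with h | h
  · subst h
    have : t₁ = T₀ / 2 := by rw [ht₁]; norm_num
    rw [this]; simp; field_simp
  · have hk0 : k ≠ 0 := by
      have := Real.pi_pos
      rw [hk]; positivity
    rw [intervalIntegral.integral_add (by simp) (Continuous.intervalIntegrable (by fun_prop) _ _)]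
    have e4 : ∫ t in t₁..(T₀ / 2), Real.cos (k * (t - t₁)) = 0 := by
      have h5 : ∀ t, k * (t - t₁) = k * t - k * t₁ := fun t => by ring
      simp_rw [h5]
      rw [intervalIntegral.integral_comp_mul_sub _ hk0, integral_cos]
      have h6 : k * (T₀ / 2) - k * t₁ = Real.pi := by
        rw [hk, ht₁]; field_simp; ring
      rw [h6]; simp
    rw [e4]
    simp only [intervalIntegral.integral_const, smul_eq_mul, mul_one, add_zero]
    rw [ht₁]; field_simp; ring

lemma rrc_scale {T₀ β c : ℝ} (hc : 0 < c) (t : ℝ) :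
    rrc (c * T₀) β (c * t) = rrc T₀ β t / √c := by
  have h1 : |c * t| = c * |t| := by rw [abs_mul, abs_of_pos hc]
  have h2 : (1 - β) / (1 + β) * (c * T₀ / 2) = c * ((1 - β) / (1 + β) * (T₀ / 2)) := by ring
  have h3 : c * T₀ / 2 = c * (T₀ / 2) := by ring
  have h4 : ∀ X, Real.pi * (1 + β) / (c * T₀ * β) * (c * X) = Real.pi * (1 + β) / (T₀ * β) * X := by
    intro X
    rw [mul_assoc c, div_mul_eq_mul_div, div_mul_eq_mul_div,
      ← mul_div_mul_left (Real.pi * (1 + β) * X) (T₀ * β) hc.ne']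
    ring
  unfold rrc
  rw [h1, h2, h3, ← mul_sub, h4]
  simp only [mul_le_mul_iff_right₀ hc]
  split_ifs
  · rw [← Real.sqrt_div' _ hc.le, div_div, mul_comm T₀]
  · rw [← Real.sqrt_div' _ hc.le, div_div]
    congr 2; ring
  · simp

lemma rrcSpectrum_scale {T₀ β c : ℝ} (hc : 0 < c) (f : ℝ) :
    rrcSpectrum (c * T₀) β f = √c * rrcSpectrum T₀ β (c * f) := by
  unfold rrcSpectrum
  rw [Real.fourier_real_eq, Real.fourier_real_eq]
  have h := Measure.integral_comp_mul_left
    (fun v : ℝ => Real.fourierChar (-(v * f)) • (rrc (c * T₀) β v : ℂ)) c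
  simp only [abs_of_pos (inv_pos.2 hc)] at h
  rw [eq_inv_smul_iff₀ hc.ne'] at h
  rw [← h]
  have h2 : ∀ v : ℝ, Real.fourierChar (-(c * v * f)) • (rrc (c * T₀) β (c * v) : ℂ)
      = ((√c)⁻¹ : ℂ) * (Real.fourierChar (-(v * (c * f))) • (rrc T₀ β v : ℂ)) := by
    intro v
    rw [rrc_scale hc]
    have : c * v * f = v * (c * f) := by ring
    rw [this, Circle.smul_def, Circle.smul_def]
    push_cast
    simp only [smul_eq_mul]
    ring
  simp_rw [h2]
  rw [integral_const_mul, Complex.real_smul, ← mul_assoc]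
  congr 1
  have h3 : (√c : ℂ) ≠ 0 := by
    have : √c ≠ 0 := (Real.sqrt_pos.2 hc).ne'
    exact_mod_cast this
  have h4 : (c : ℂ) = √c * √c := by
    rw [← Complex.ofReal_mul, Real.mul_self_sqrt hc.le]
  rw [h4, mul_assoc, mul_inv_cancel₀ h3, mul_one]

lemma rrcSpectrum_zero (T₀ β : ℝ) : rrcSpectrum T₀ β 0 = ((∫ t, rrc T₀ β t : ℝ) : ℂ) := by
  unfold rrcSpectrum
  rw [Real.fourier_real_eq, ← integral_complex_ofReal]
  simp

lemma integral_rrc_nonneg (T₀ β : ℝ) : 0 ≤ ∫ t, rrc T₀ β t :=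
  integral_nonneg fun t => rrc_nonneg T₀ β t

lemma norm_rrcSpectrum_zero (T₀ β : ℝ) : ‖rrcSpectrum T₀ β 0‖ = ∫ t, rrc T₀ β t := by
  rw [rrcSpectrum_zero, Complex.norm_real, Real.norm_of_nonneg (integral_rrc_nonneg _ _)]

/-- The pulse is nonnegative. This locates the maximum in the mask condition at frequency zero. -/
lemma norm_rrcSpectrum_le (T₀ β f : ℝ) : ‖rrcSpectrum T₀ β f‖ ≤ ‖rrcSpectrum T₀ β 0‖ := by
  rw [norm_rrcSpectrum_zero]
  unfold rrcSpectrum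
  rw [Real.fourier_real_eq]
  refine (norm_integral_le_integral_norm _).trans (le_of_eq ?_)
  refine integral_congr_ae (ae_of_all _ fun t => ?_)
  simp [Circle.norm_smul, abs_of_nonneg (rrc_nonneg T₀ β t)]

lemma integrable_rrc_complex {T₀ β : ℝ} (hT : 0 < T₀) (hβ : β ∈ Set.Icc (0 : ℝ) 1) :
    Integrable (fun t => (rrc T₀ β t : ℂ)) := (integrable_rrc hT hβ).ofReal

lemma memLp_rrc_complex {T₀ β : ℝ} (hT : 0 < T₀) (hβ : β ∈ Set.Icc (0 : ℝ) 1) :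
    MemLp (fun t => (rrc T₀ β t : ℂ)) 2 volume := (memLp_rrc hT hβ 2).ofReal

lemma integral_rrcSpectrum_sq {T₀ β : ℝ} (hT : 0 < T₀) (hβ : β ∈ Set.Icc (0 : ℝ) 1) :
    ∫ f, ‖rrcSpectrum T₀ β f‖ ^ 2 = 1 := by
  have h := integral_norm_sq_fourier (integrable_rrc_complex hT hβ) (memLp_rrc_complex hT hβ)
  have h2 : ∀ x, ‖(rrc T₀ β x : ℂ)‖ ^ 2 = rrc T₀ β x ^ 2 := fun x => by
    rw [Complex.norm_real, Real.norm_eq_abs, sq_abs]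
  simp_rw [h2, integral_rrc_sq hT hβ] at h
  exact h

lemma integrable_rrcSpectrum_sq {T₀ β : ℝ} (hT : 0 < T₀) (hβ : β ∈ Set.Icc (0 : ℝ) 1) :
    Integrable fun f => ‖rrcSpectrum T₀ β f‖ ^ 2 := by
  -- The integral of a non-integrable function is `0` by convention, while Plancherel gives `1`.
  by_contra h
  have := integral_rrcSpectrum_sq hT hβ
  rw [integral_undef h] at this
  exact zero_ne_one this

lemma integral_rrc_pos {T₀ β : ℝ} (hT : 0 < T₀) (hβ : β ∈ Set.Icc (0 : ℝ) 1) :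
    0 < ∫ t, rrc T₀ β t := by
  refine lt_of_le_of_ne (integral_rrc_nonneg _ _) fun h => ?_
  have h1 := (integral_eq_zero_iff_of_nonneg (rrc_nonneg T₀ β) (integrable_rrc hT hβ)).1 h.symm
  have h2 : ∫ t, rrc T₀ β t ^ 2 = 0 := by
    rw [← integral_zero ℝ ℝ]
    refine integral_congr_ae ?_
    filter_upwards [h1] with t ht
    simp [ht]
  rw [integral_rrc_sq hT hβ] at h2
  exact one_ne_zero h2

/-- Cauchy–Schwarz on a support of length `T₀`, with unit energy. It is obtained by integrating `2 *
φ * c ≤ φ ^ 2 + c ^ 2` with `c = m / T₀`. -/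
lemma integral_rrc_sq_le {T₀ β : ℝ} (hT : 0 < T₀) (hβ : β ∈ Set.Icc (0 : ℝ) 1) :
    (∫ t, rrc T₀ β t) ^ 2 ≤ T₀ := by
  set m := ∫ t, rrc T₀ β t with hm
  have h1 : ∀ t, 2 * rrc T₀ β t * (m / T₀) ≤
      rrc T₀ β t ^ 2 * 1 + (Set.Icc (-(T₀ / 2)) (T₀ / 2)).indicator (fun _ => (m / T₀) ^ 2) t := by
    intro t
    by_cases h : t ∈ Set.Icc (-(T₀ / 2)) (T₀ / 2)
    · rw [Set.indicator_of_mem h]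
      nlinarith [sq_nonneg (rrc T₀ β t - m / T₀)]
    · rw [rrc_eq_indicator hT hβ, Set.indicator_of_notMem h, Set.indicator_of_notMem h]
      simp
  have h2 := integral_mono (((integrable_rrc hT hβ).const_mul 2).mul_const (m / T₀))
    (((memLp_rrc hT hβ 2).integrable_sq.mul_const 1).add
      ((integrable_indicator_iff measurableSet_Icc).2 (by simp))) h1
  simp only [Pi.add_apply] at h2
  rw [integral_add ((memLp_rrc hT hβ 2).integrable_sq.mul_const 1)
    ((integrable_indicator_iff measurableSet_Icc).2 (by simp)),
    integral_mul_const, integral_const_mul, integral_mul_const, integral_rrc_sq hT hβ,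
    integral_indicator measurableSet_Icc, setIntegral_const, ← hm] at h2
  simp only [Real.volume_real_Icc, sub_neg_eq_add, add_halves, max_eq_left hT.le, smul_eq_mul] at h2
  have h3 : T₀ * (m / T₀) ^ 2 = m ^ 2 / T₀ := by field_simp
  have h4 : 2 * m * (m / T₀) = 2 * (m ^ 2 / T₀) := by ring
  rw [h3, h4] at h2
  have h5 : m ^ 2 / T₀ ≤ 1 := by linarith
  rwa [div_le_one hT] at h5

/-- On the support `|t| ≤ T₀ / 2` the phase is at most `2π f |t| ≤ π f T₀`. So a short pulse cannot
have a spectrum that decays within the band. -/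
lemma norm_rrcSpectrum_sub_le {T₀ β : ℝ} (hT : 0 < T₀) (hβ : β ∈ Set.Icc (0 : ℝ) 1) {f : ℝ}
    (hf : 0 ≤ f) :
    ‖rrcSpectrum T₀ β f - rrcSpectrum T₀ β 0‖ ≤ Real.pi * f * T₀ * ‖rrcSpectrum T₀ β 0‖ := by
  have hi : ∀ f : ℝ, Integrable fun t : ℝ => Complex.exp (↑(-2 * Real.pi * t * f) * Complex.I) •
      (rrc T₀ β t : ℂ) := fun f => by
    have h := (Real.fourierIntegral_convergent_iff f).2 (integrable_rrc_complex hT hβ)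
    refine h.congr (ae_of_all _ fun t => ?_)
    simp only [Circle.smul_def, Real.fourierChar_apply]
    congr 3
    simp; ring
  rw [norm_rrcSpectrum_zero, ← integral_const_mul]
  unfold rrcSpectrum
  rw [Real.fourier_real_eq_integral_exp_smul, Real.fourier_real_eq_integral_exp_smul,
    ← integral_sub (hi f) (hi 0)]
  refine norm_integral_le_of_norm_le ((integrable_rrc hT hβ).const_mul _) (ae_of_all _ fun t => ?_)
  rw [← sub_smul, norm_smul, Complex.norm_real, Real.norm_of_nonneg (rrc_nonneg _ _ _)]
  by_cases h : T₀ / 2 < |t|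
  · rw [rrc_eq_zero hT hβ h]; simp
  refine mul_le_mul_of_nonneg_right ?_ (rrc_nonneg _ _ _)
  have h1 : Complex.exp (↑(-2 * Real.pi * t * f) * Complex.I) -
      Complex.exp (↑(-2 * Real.pi * t * 0) * Complex.I)
      = Complex.exp (Complex.I * (-2 * Real.pi * t * f : ℝ)) - 1 := by
    rw [mul_comm Complex.I]; simp
  rw [h1]
  refine Real.norm_exp_I_mul_ofReal_sub_one_le.trans ?_
  rw [Real.norm_eq_abs, abs_mul, abs_mul, abs_mul, abs_of_nonneg hf, abs_of_pos Real.pi_pos]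
  have h2 := not_lt.1 h
  have h3 : |(-2 : ℝ)| = 2 := by norm_num
  rw [h3]
  have : 0 ≤ Real.pi * f := mul_nonneg Real.pi_pos.le hf
  nlinarith

/-! ### Feasible pulses and their time-bandwidth product -/

namespace SpectralMask

variable (S : SpectralMask)

lemma V_pos (i : Fin S.l) : 0 < S.V i := by unfold V; positivity

/-- Dilation in time contracts the spectrum and preserves both its ratio to the peak and the
fraction of energy in the scaled band. Feasibility thus depends on `W * T₀` only, which is why `W₀`
is arbitrary in `minC`. -/
lemma PulseFeasible.rescale {W W' β T₀ : ℝ} (hW : 0 < W) (hW' : 0 < W')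
    (h : S.PulseFeasible W β T₀) : S.PulseFeasible W' β (W / W' * T₀) := by
  have hc : 0 < W / W' := div_pos hW hW'
  have hn : ∀ f, ‖rrcSpectrum (W / W' * T₀) β f‖ ^ 2
      = W / W' * ‖rrcSpectrum T₀ β (W / W' * f)‖ ^ 2 := fun f => by
    rw [rrcSpectrum_scale hc, norm_mul, mul_pow, Complex.norm_real,
      Real.norm_of_nonneg (Real.sqrt_nonneg _), Real.sq_sqrt hc.le]
  refine ⟨mul_pos hc h.1, fun i => ⟨fun f hf => ?_, ?_⟩⟩
  · rw [hn, hn, mul_zero, mul_left_comm]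
    refine mul_lt_mul_of_pos_left ((h.2 i).1 _ ?_) hc
    calc S.α i * W = W / W' * (S.α i * W') := by field_simp
      _ ≤ _ := by gcongr
  · simp_rw [hn]
    rw [intervalIntegral.integral_const_mul,
      intervalIntegral.mul_integral_comp_mul_left (f := fun f => ‖rrcSpectrum T₀ β f‖ ^ 2)]
    have e : W / W' * (S.α i * W') = S.α i * W := by field_simp
    rw [mul_neg, e]
    exact (h.2 i).2

/-- For a fixed pulse, a wide enough band works: the peak conditions follow from the
Riemann–Lebesgue lemma, the energy conditions from Plancherel and `η i < 1`. -/
lemma exists_pulseFeasible (hα : ∀ i, 0 < S.α i) (hη : ∀ i, S.η i < 1) {β : ℝ}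
    (hβ : β ∈ Set.Icc (0 : ℝ) 1) : ∃ W : ℝ, 0 < W ∧ S.PulseFeasible W β 1 := by
  have h0 : 0 < ‖rrcSpectrum 1 β 0‖ := by
    rw [norm_rrcSpectrum_zero]; exact integral_rrc_pos one_pos hβ
  have key : ∀ i, ∀ᶠ W : ℝ in atTop,
      (∀ f : ℝ, S.α i * W ≤ f → ‖rrcSpectrum 1 β f‖ ^ 2 < S.V i * ‖rrcSpectrum 1 β 0‖ ^ 2) ∧
      S.η i ≤ ∫ f in (-(S.α i * W))..(S.α i * W), ‖rrcSpectrum 1 β f‖ ^ 2 := by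
    intro i
    have ht : Tendsto (fun W : ℝ => S.α i * W) atTop atTop :=
      tendsto_id.const_mul_atTop (hα i)
    suffices ∀ᶠ x : ℝ in atTop,
        (∀ f : ℝ, x ≤ f → ‖rrcSpectrum 1 β f‖ ^ 2 < S.V i * ‖rrcSpectrum 1 β 0‖ ^ 2) ∧
        S.η i ≤ ∫ f in (-x)..x, ‖rrcSpectrum 1 β f‖ ^ 2 from ht.eventually this
    refine Eventually.and ?_ ?_
    · have h1 : Tendsto (fun f => ‖rrcSpectrum 1 β f‖ ^ 2) atTop (𝓝 0) := by
        have := ((Real.zero_at_infty_fourier (fun t => (rrc 1 β t : ℂ))).mono_left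
          atTop_le_cocompact).norm.pow 2
        rw [norm_zero, zero_pow two_ne_zero] at this
        exact this
      exact eventually_forall_ge_atTop.2 (h1.eventually_lt_const (mul_pos (S.V_pos i) (pow_pos h0 2)))
    · have h1 := intervalIntegral_tendsto_integral (integrable_rrcSpectrum_sq one_pos hβ)
        tendsto_neg_atTop_atBot tendsto_id
      rw [integral_rrcSpectrum_sq one_pos hβ] at h1
      exact (h1.eventually_const_lt (hη i)).mono fun _ h => h.le
  obtain ⟨W, h1, h2⟩ := ((eventually_all.2 key).and (eventually_gt_atTop 0)).exists
  exact ⟨W, h2, one_pos, h1⟩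

/-- A nontrivial constraint excludes short pulses, whose spectrum is nearly flat (if `U i > 0`) and
low (if `η i > 0`) across the band. The bound is uniform in `β`, so `minC` is positive and the rates
are finite. -/
lemma exists_pos_le_of_pulseFeasible (hα : ∀ i, 0 < S.α i) (hS : ∃ i, 0 < S.U i ∨ 0 < S.η i) :
    ∃ b : ℝ, 0 < b ∧ ∀ W T₀ β : ℝ, 0 < W → β ∈ Set.Icc (0 : ℝ) 1 → S.PulseFeasible W β T₀ →
      b ≤ W * T₀ := by
  obtain ⟨i, hi | hi⟩ := hS
  · have hV : S.V i < 1 := by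
      unfold V
      exact Real.rpow_lt_one_of_one_lt_of_neg (by norm_num) (by linarith)
    -- With `p = π * α i * W * T₀`, a violation means `2 * p < 1 - V i`, hence `(1 - p) ^ 2 ≥ 1 - 2
    -- * p > V i`, against the attenuation at `f = α i * W`.
    refine ⟨(1 - S.V i) / (2 * Real.pi * S.α i), ?_, ?_⟩
    · have := Real.pi_pos
      have := hα i
      exact div_pos (by linarith) (by positivity)
    intro W T₀ β hW hβ h
    have hT := h.1
    have h0 : 0 < ‖rrcSpectrum T₀ β 0‖ := by
      rw [norm_rrcSpectrum_zero]; exact integral_rrc_pos hT hβ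
    have h1 := (h.2 i).1 _ le_rfl
    have hf : 0 < S.α i * W := mul_pos (hα i) hW
    have h2 := norm_rrcSpectrum_sub_le hT hβ hf.le
    have h3 := norm_sub_norm_le (rrcSpectrum T₀ β 0) (rrcSpectrum T₀ β (S.α i * W))
    rw [norm_sub_rev] at h3
    have hpi := Real.pi_pos
    rw [div_le_iff₀ (by have := hα i; positivity)]
    set m := ‖rrcSpectrum T₀ β 0‖
    set p := Real.pi * (S.α i * W) * T₀ with hp
    have hp0 : 0 < p := by positivity
    have e : W * T₀ * (2 * Real.pi * S.α i) = 2 * p := by rw [hp]; ring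
    rw [e]
    by_contra hc
    push Not at hc
    have hV0 := S.V_pos i
    have h4 : (1 - p) * m ≤ ‖rrcSpectrum T₀ β (S.α i * W)‖ := by linarith
    have h5 : ((1 - p) * m) ^ 2 ≤ ‖rrcSpectrum T₀ β (S.α i * W)‖ ^ 2 :=
      pow_le_pow_left₀ (mul_nonneg (by linarith) h0.le) h4 2
    have h6 : (1 - p) ^ 2 * m ^ 2 < S.V i * m ^ 2 := by rw [← mul_pow]; exact h5.trans_lt h1
    have h7 := lt_of_mul_lt_mul_right h6 (by positivity)
    nlinarith
  -- The density is at most `T₀` on a band of width `2 * α i * W`, which must hold energy `η i`.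
  · refine ⟨S.η i / (2 * S.α i), div_pos hi (by have := hα i; positivity), ?_⟩
    intro W T₀ β hW hβ h
    have hf : 0 < S.α i * W := mul_pos (hα i) hW
    have h1 := (h.2 i).2
    have h2 : ∫ f in (-(S.α i * W))..(S.α i * W), ‖rrcSpectrum T₀ β f‖ ^ 2
        ≤ ∫ f in (-(S.α i * W))..(S.α i * W), T₀ := by
      refine intervalIntegral.integral_mono_on (by linarith)
        (integrable_rrcSpectrum_sq h.1 hβ).intervalIntegrable (by simp) fun f _ => ?_
      calc ‖rrcSpectrum T₀ β f‖ ^ 2 ≤ ‖rrcSpectrum T₀ β 0‖ ^ 2 :=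
            pow_le_pow_left₀ (norm_nonneg _) (norm_rrcSpectrum_le _ _ _) 2
        _ ≤ T₀ := by rw [norm_rrcSpectrum_zero]; exact integral_rrc_sq_le h.1 hβ
    rw [intervalIntegral.integral_const, smul_eq_mul] at h2
    rw [div_le_iff₀ (by have := hα i; positivity)]
    linarith

lemma le_optimalPulse {W β b : ℝ} (hW : 0 < W) (hne : ∃ T₀, S.PulseFeasible W β T₀)
    (hb : ∀ T₀, S.PulseFeasible W β T₀ → b ≤ W * T₀) : b ≤ S.c W β := by
  unfold c optimalPulse
  rw [← div_le_iff₀' hW]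
  refine le_csInf hne fun T₀ h => ?_
  rw [div_le_iff₀' hW]
  exact hb T₀ h

lemma exists_pulseFeasible_of_pos (hα : ∀ i, 0 < S.α i) (hη : ∀ i, S.η i < 1) {W β : ℝ}
    (hW : 0 < W) (hβ : β ∈ Set.Icc (0 : ℝ) 1) : ∃ T₀, S.PulseFeasible W β T₀ := by
  obtain ⟨W', hW', h⟩ := S.exists_pulseFeasible hα hη hβ
  exact ⟨_, PulseFeasible.rescale S hW' hW h⟩

lemma minC_pos (hα : ∀ i, 0 < S.α i) (hη : ∀ i, S.η i < 1) (hS : ∃ i, 0 < S.U i ∨ 0 < S.η i)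
    {W : ℝ} (hW : 0 < W) : 0 < S.minC W := by
  obtain ⟨b, hb, h⟩ := S.exists_pos_le_of_pulseFeasible hα hS
  refine hb.trans_le ?_
  have : Nonempty (Set.Icc (0 : ℝ) 1) := ⟨⟨0, by simp⟩⟩
  exact le_ciInf fun β => S.le_optimalPulse hW (S.exists_pulseFeasible_of_pos hα hη hW β.2)
    fun T₀ hT => h W T₀ β hW β.2 hT

/-- Feasible pulses for the bandwidth `W` whose time-bandwidth product is nearly optimal; the
optimal product may be computed from any other bandwidth `W₀`. -/
lemma exists_nearly_optimal_pulse (hα : ∀ i, 0 < S.α i) (hη : ∀ i, S.η i < 1)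
    (hS : ∃ i, 0 < S.U i ∨ 0 < S.η i) {W W₀ ε : ℝ} (hW : 0 < W) (hW₀ : 0 < W₀) (hε : 0 < ε) :
    ∃ β ∈ Set.Icc (0 : ℝ) 1, ∃ T₀, S.PulseFeasible W β T₀ ∧ S.minC W₀ ≤ W * T₀ ∧
      W * T₀ < S.minC W₀ + ε := by
  obtain ⟨b, hb, h⟩ := S.exists_pos_le_of_pulseFeasible hα hS
  have : Nonempty (Set.Icc (0 : ℝ) 1) := ⟨⟨0, by simp⟩⟩
  obtain ⟨β, hβ⟩ := exists_lt_of_ciInf_lt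
    (show ⨅ β : Set.Icc (0 : ℝ) 1, S.c W₀ β < S.minC W₀ + ε by unfold minC; linarith)
  have hne := S.exists_pulseFeasible_of_pos hα hη hW₀ β.2
  have h1 : sInf {T₀ : ℝ | S.PulseFeasible W₀ β T₀} < (S.minC W₀ + ε) / W₀ := by
    rw [lt_div_iff₀' hW₀]; exact hβ
  obtain ⟨T₀, hT, hT2⟩ := exists_lt_of_csInf_lt hne h1
  rw [lt_div_iff₀' hW₀] at hT2
  have e : W * (W₀ / W * T₀) = W₀ * T₀ := by field_simp
  refine ⟨β, β.2, W₀ / W * T₀, PulseFeasible.rescale S hW₀ hW hT, ?_, by rw [e]; exact hT2⟩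
  rw [e]
  have h2 : S.c W₀ β ≤ W₀ * T₀ := by
    unfold c optimalPulse
    exact mul_le_mul_of_nonneg_left (csInf_le ⟨0, fun x hx => hx.1.le⟩ hT) hW₀.le
  refine le_trans (ciInf_le ⟨0, ?_⟩ β) h2
  rintro _ ⟨β', rfl⟩
  exact hb.le.trans (S.le_optimalPulse hW₀ (S.exists_pulseFeasible_of_pos hα hη hW₀ β'.2)
    fun T₀ hT => h W₀ T₀ β' hW₀ β'.2 hT)

/-- The mask conditions are homogeneous in the density, so the factor `k` cancels; the total energy
is `k` by Plancherel. -/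
lemma fits_of_esd_eq {W β T₀ k T : ℝ} (hβ : β ∈ Set.Icc (0 : ℝ) 1) (h : S.PulseFeasible W β T₀)
    (hk : 0 < k) (C : Code T) (hC : ∀ f, C.esd f = k * ‖rrcSpectrum T₀ β f‖ ^ 2) :
    S.Fits W C := by
  have hmax : ⨆ f, C.esd f = k * ‖rrcSpectrum T₀ β 0‖ ^ 2 := by
    have hle : ∀ f, C.esd f ≤ k * ‖rrcSpectrum T₀ β 0‖ ^ 2 := fun f => by
      rw [hC]
      have := norm_rrcSpectrum_le T₀ β f
      gcongr
    refine le_antisymm (ciSup_le hle) ?_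
    rw [← hC]
    exact le_ciSup ⟨_, by rintro _ ⟨f, rfl⟩; exact hle f⟩ 0
  intro i
  rw [hmax]
  simp_rw [hC]
  refine ⟨fun f hf => ?_, ?_⟩
  · rw [mul_left_comm]
    exact mul_lt_mul_of_pos_left ((h.2 i).1 f hf) hk
  · rw [intervalIntegral.integral_const_mul, integral_const_mul, integral_rrcSpectrum_sq h.1 hβ,
      mul_one, mul_comm]
    exact mul_le_mul_of_nonneg_left (h.2 i).2 hk.le

end SpectralMask

/-! ### Gaussian vectors with independent coordinates -/

/-- The law of a Gaussian vector with mean `x` and independent coordinates of variance `v`. -/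
noncomputable def gaussianVec {n : ℕ} (v : ℝ≥0) (x : Fin n → ℝ) : Measure (Fin n → ℝ) :=
  Measure.pi fun i => gaussianReal (x i) v

/-- The density of `gaussianVec v x` with respect to `gaussianVec v 0`. -/
noncomputable def likelihood {n : ℕ} (v : ℝ≥0) (x z : Fin n → ℝ) : ℝ :=
  Real.exp ((∑ i, x i * z i - (∑ i, x i ^ 2) / 2) / v)

instance {n : ℕ} (v : ℝ≥0) (x : Fin n → ℝ) : IsProbabilityMeasure (gaussianVec v x) := by
  unfold gaussianVec; infer_instance

lemma gaussianReal_eq_withDensity {v : ℝ≥0} (hv : v ≠ 0) (x : ℝ) :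
    gaussianReal x v = (gaussianReal 0 v).withDensity
      fun z => ENNReal.ofReal (Real.exp ((x * z - x ^ 2 / 2) / v)) := by
  rw [gaussianReal_of_var_ne_zero _ hv, gaussianReal_of_var_ne_zero _ hv,
    ← withDensity_mul _ (measurable_gaussianPDF _ _) (by fun_prop)]
  congr 1
  ext z
  rw [Pi.mul_apply, gaussianPDF, gaussianPDF, ← ENNReal.ofReal_mul (gaussianPDFReal_nonneg _ _ _)]
  congr 1
  have hv' : (v : ℝ) ≠ 0 := by exact_mod_cast hv
  rw [gaussianPDFReal, gaussianPDFReal, mul_assoc _ (Real.exp _), ← Real.exp_add]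
  congr 2
  field_simp
  ring

lemma integral_exp_mul_gaussianReal {v : ℝ≥0} (x t : ℝ) :
    ∫ z, Real.exp (t * z) ∂(gaussianReal x v) = Real.exp (x * t + v * t ^ 2 / 2) := by
  have := congrFun (mgf_fun_id_gaussianReal (μ := x) (v := v)) t
  rw [mgf] at this
  exact this

lemma integrable_exp_gaussianVec {n : ℕ} (v : ℝ≥0) (x c : Fin n → ℝ) :
    Integrable (fun z => Real.exp (∑ i, c i * z i)) (gaussianVec v x) := by
  simp_rw [Real.exp_sum]
  exact Integrable.fintype_prod (f := fun i z => Real.exp (c i * z))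
    fun i => integrable_exp_mul_gaussianReal _

lemma integral_exp_gaussianVec {n : ℕ} (v : ℝ≥0) (x c : Fin n → ℝ) :
    ∫ z, Real.exp (∑ i, c i * z i) ∂(gaussianVec v x)
      = Real.exp (∑ i, c i * x i + v * (∑ i, c i ^ 2) / 2) := by
  simp_rw [Real.exp_sum]
  rw [gaussianVec, integral_fintype_prod_eq_prod (fun i z => Real.exp (c i * z))]
  simp_rw [integral_exp_mul_gaussianReal]
  rw [← Real.exp_sum]
  congr 1
  rw [Finset.sum_add_distrib, Finset.mul_sum, Finset.sum_div]
  congr 1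
  exact Finset.sum_congr rfl fun i _ => mul_comm _ _

lemma measurable_likelihood {n : ℕ} (v : ℝ≥0) (x : Fin n → ℝ) : Measurable (likelihood v x) := by
  unfold likelihood; fun_prop

lemma likelihood_pos {n : ℕ} (v : ℝ≥0) (x z : Fin n → ℝ) : 0 < likelihood v x z := Real.exp_pos _

lemma likelihood_eq_prod {n : ℕ} (v : ℝ≥0) (x z : Fin n → ℝ) :
    likelihood v x z = ∏ i, Real.exp ((x i * z i - x i ^ 2 / 2) / v) := by
  rw [likelihood, ← Real.exp_sum, ← Finset.sum_div, Finset.sum_sub_distrib, Finset.sum_div]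

lemma integrable_likelihood_factor {v : ℝ≥0} (x y : ℝ) :
    Integrable (fun z => Real.exp ((x * z - x ^ 2 / 2) / v)) (gaussianReal y v) := by
  have : ∀ z : ℝ, Real.exp ((x * z - x ^ 2 / 2) / v)
      = Real.exp (-(x ^ 2 / 2) / v) * Real.exp ((x / v) * z) := fun z => by
    rw [← Real.exp_add]; congr 1; ring
  simp_rw [this]
  exact (integrable_exp_mul_gaussianReal _).const_mul _

lemma integrable_likelihood {n : ℕ} (v : ℝ≥0) (x y : Fin n → ℝ) :
    Integrable (likelihood v x) (gaussianVec v y) := by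
  have : likelihood v x = fun z => ∏ i, Real.exp ((x i * z i - x i ^ 2 / 2) / v) :=
    funext fun z => likelihood_eq_prod v x z
  rw [this]
  exact Integrable.fintype_prod (f := fun i z => Real.exp ((x i * z - x i ^ 2 / 2) / v))
    fun i => integrable_likelihood_factor _ _

lemma gaussianVec_eq_withDensity {n : ℕ} {v : ℝ≥0} (hv : v ≠ 0) (x : Fin n → ℝ) :
    gaussianVec v x = (gaussianVec v 0).withDensity fun z => ENNReal.ofReal (likelihood v x z) := by
  refine Measure.pi_eq fun s hs => ?_
  rw [withDensity_apply _ (MeasurableSet.univ_pi hs),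
    ← ofReal_integral_eq_lintegral_ofReal (integrable_likelihood v x 0).integrableOn
      (ae_of_all _ fun z => (likelihood_pos v x z).le),
    ← integral_indicator (MeasurableSet.univ_pi hs)]
  have h1 : ∀ z, (Set.univ.pi s).indicator (likelihood v x) z
      = ∏ i, (s i).indicator (fun z => Real.exp ((x i * z - x i ^ 2 / 2) / v)) (z i) := by
    intro z
    by_cases hz : z ∈ Set.univ.pi s
    · rw [Set.indicator_of_mem hz, likelihood_eq_prod]
      refine Finset.prod_congr rfl fun i _ => ?_
      rw [Set.indicator_of_mem (hz i trivial)]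
    · rw [Set.indicator_of_notMem hz]
      simp only [Set.mem_pi, Set.mem_univ, true_imp_iff, not_forall] at hz
      obtain ⟨i, hi⟩ := hz
      symm
      exact Finset.prod_eq_zero (Finset.mem_univ i) (Set.indicator_of_notMem hi _)
  simp_rw [h1]
  rw [gaussianVec, integral_fintype_prod_eq_prod
    (fun i => (s i).indicator (fun z => Real.exp ((x i * z - x i ^ 2 / 2) / v))),
    ENNReal.ofReal_prod_of_nonneg fun i _ => integral_nonneg fun z =>
      Set.indicator_nonneg (fun _ _ => (Real.exp_pos _).le) _]
  refine Finset.prod_congr rfl fun i _ => ?_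
  rw [integral_indicator (hs i), gaussianReal_eq_withDensity hv (x i), withDensity_apply _ (hs i),
    ofReal_integral_eq_lintegral_ofReal (integrable_likelihood_factor _ _).integrableOn
      (ae_of_all _ fun z => (Real.exp_pos _).le)]
  rfl

lemma gaussianVec_real_eq {n : ℕ} {v : ℝ≥0} (hv : v ≠ 0) (x : Fin n → ℝ) {A : Set (Fin n → ℝ)}
    (hA : MeasurableSet A) :
    (gaussianVec v x).real A = ∫ z in A, likelihood v x z ∂(gaussianVec v 0) := by
  rw [measureReal_def, gaussianVec_eq_withDensity hv, withDensity_apply _ hA,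
    ← ofReal_integral_eq_lintegral_ofReal (integrable_likelihood v x 0).integrableOn
      (ae_of_all _ fun z => (likelihood_pos v x z).le), ENNReal.toReal_ofReal]
  exact integral_nonneg fun z => (likelihood_pos v x z).le

lemma integral_likelihood {n : ℕ} {v : ℝ≥0} (hv : v ≠ 0) (x : Fin n → ℝ) :
    ∫ z, likelihood v x z ∂(gaussianVec v 0) = 1 := by
  have := gaussianVec_real_eq hv x MeasurableSet.univ
  rw [setIntegral_univ] at this
  rw [← this]; simp

lemma gaussianVec_map_add {n : ℕ} (v : ℝ≥0) (x y : Fin n → ℝ) :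
    (gaussianVec v x).map (fun z => z + y) = gaussianVec v (x + y) := by
  have : (fun z : Fin n → ℝ => z + y) = fun z i => (fun (i : Fin n) (t : ℝ) => t + y i) i (z i) :=
    rfl
  rw [gaussianVec, this, Measure.pi_map_pi (f := fun (i : Fin n) (t : ℝ) => t + y i) (by fun_prop)]
  simp_rw [gaussianReal_map_add_const]
  rfl

/-! ### Reduction of the observation to finitely many coordinates -/

lemma IsWhiteNoise.isProbabilityMeasure {N₀ : ℝ} {μ : Measure (FiniteEnergy → ℝ)}
    (h : IsWhiteNoise N₀ μ) : IsProbabilityMeasure μ := h.gaussian.isProbabilityMeasure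

lemma IsWhiteNoise.memLp {N₀ : ℝ} {μ : Measure (FiniteEnergy → ℝ)}
    (h : IsWhiteNoise N₀ μ) (g : FiniteEnergy) :
    MemLp (fun w : FiniteEnergy → ℝ => w g) 2 μ := (h.gaussian.hasGaussianLaw_eval g).memLp_two

lemma IsWhiteNoise.cov {N₀ : ℝ} {μ : Measure (FiniteEnergy → ℝ)}
    (h : IsWhiteNoise N₀ μ) (g g' : FiniteEnergy) :
    cov[fun w : FiniteEnergy → ℝ => w g, fun w => w g'; μ] = N₀ / 2 * ∫ t, g t * g' t := by
  have := h.isProbabilityMeasure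
  rw [covariance_eq_sub (h.memLp g) (h.memLp g'), h.mean_zero, h.mean_zero, mul_zero, sub_zero,
    ← h.covariance]
  rfl

/-- The pulses `φ` are orthonormal. -/
def IsOrthonormal {n : ℕ} (φ : Fin n → FiniteEnergy) : Prop :=
  ∀ i j, ∫ t, φ i t * φ j t = if i = j then 1 else 0

/-- The signal `x` has coordinates `c` with respect to `φ`. -/
def HasCoords {n : ℕ} (φ : Fin n → FiniteEnergy) (x : ℝ → ℝ) (c : Fin n → ℝ) : Prop :=
  ∀ g : FiniteEnergy, ∫ t, x t * g t = ∑ i, c i * ∫ t, φ i t * g t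

lemma hasCoords_zero {n : ℕ} (φ : Fin n → FiniteEnergy) : HasCoords φ 0 0 := fun g => by simp

/-- The part of the noise which is orthogonal to `φ`. -/
noncomputable def residual {n : ℕ} (φ : Fin n → FiniteEnergy) (w : FiniteEnergy → ℝ) :
    FiniteEnergy → ℝ := fun g => w g - ∑ i, (∫ t, φ i t * g t) * w (φ i)

/-- The observation with coordinates `z` and residual `r`. -/
noncomputable def synthesize {n : ℕ} (φ : Fin n → FiniteEnergy) (z : Fin n → ℝ)
    (r : FiniteEnergy → ℝ) : FiniteEnergy → ℝ := fun g => r g + ∑ i, (∫ t, φ i t * g t) * z i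

lemma measurable_residual {n : ℕ} (φ : Fin n → FiniteEnergy) : Measurable (residual φ) := by
  unfold residual
  exact measurable_pi_lambda _ fun g => by fun_prop

lemma measurable_synthesize {n : ℕ} (φ : Fin n → FiniteEnergy) :
    Measurable fun p : (Fin n → ℝ) × (FiniteEnergy → ℝ) => synthesize φ p.1 p.2 := by
  unfold synthesize
  exact measurable_pi_lambda _ fun g => by fun_prop

lemma measurable_observe (x : ℝ → ℝ) : Measurable (observe x) := by
  unfold observe
  exact measurable_pi_lambda _ fun g => by fun_prop

lemma observe_eq_synthesize {n : ℕ} {φ : Fin n → FiniteEnergy} {x : ℝ → ℝ} {c : Fin n → ℝ}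
    (hx : HasCoords φ x c) (w : FiniteEnergy → ℝ) :
    observe x w = synthesize φ ((fun i => w (φ i)) + c) (residual φ w) := by
  ext g
  simp only [observe, synthesize, residual, hx g, Pi.add_apply, mul_add, Finset.sum_add_distrib]
  simp_rw [mul_comm (c _)]
  ring

lemma observe_apply_pulse {n : ℕ} {φ : Fin n → FiniteEnergy} (hφ : IsOrthonormal φ) {x : ℝ → ℝ}
    {c : Fin n → ℝ} (hx : HasCoords φ x c) (w : FiniteEnergy → ℝ) (i : Fin n) :
    observe x w (φ i) = w (φ i) + c i := by
  simp [observe, hx (φ i), hφ _ i, add_comm]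

/-! ### Independence of the coordinates and the residual noise -/

section

variable {N₀ : ℝ} {μ : Measure (FiniteEnergy → ℝ)}

lemma IsWhiteNoise.gaussian_of_linear {S : Type*} {Y : S → (FiniteEnergy → ℝ) → ℝ}
    (h : IsWhiteNoise N₀ μ) (hY : ∀ s, ∃ (I : Finset FiniteEnergy) (L : (I → ℝ) →L[ℝ] ℝ),
      ∀ w, Y s w = L (I.restrict w)) : IsGaussianProcess Y μ where
  hasGaussianLaw I := by
    classical
    choose J L hL using hY
    have hJ : ∀ i : I, J i ⊆ I.biUnion J := fun i => Finset.subset_biUnion_of_mem J i.2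
    refine ((h.gaussian.hasGaussianLaw (I.biUnion J)).map (ContinuousLinearMap.pi fun i : I =>
      (L i).comp (ContinuousLinearMap.pi fun j : J i =>
        ContinuousLinearMap.proj (R := ℝ) (φ := fun _ : ↥(I.biUnion J) => ℝ)
          ⟨j, hJ i j.2⟩))).congr (ae_of_all _ fun w => ?_)
    ext i
    exact (hL i w).symm

/-- Coordinates and residual are linear in the noise, hence jointly Gaussian, and orthonormality
makes them uncorrelated. -/
lemma indepFun_residual {n : ℕ} {φ : Fin n → FiniteEnergy} (h : IsWhiteNoise N₀ μ)
    (hφ : IsOrthonormal φ) :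
    IndepFun (fun (w : FiniteEnergy → ℝ) (i : Fin n) => w (φ i)) (residual φ) μ := by
  classical
  have hP := h.isProbabilityMeasure
  refine IsGaussianProcess.indepFun_of_covariance_eq_zero
    (X := fun (i : Fin n) (w : FiniteEnergy → ℝ) => w (φ i))
    (Y := fun (g : FiniteEnergy) (w : FiniteEnergy → ℝ) => residual φ w g) ?_
    (fun i => (measurable_pi_apply _).aemeasurable)
    (fun g => ((measurable_pi_apply g).comp (measurable_residual φ)).aemeasurable) ?_
  · refine h.gaussian_of_linear fun s => ?_
    rcases s with i | g
    · exact ⟨{φ i}, ContinuousLinearMap.proj ⟨φ i, by simp⟩, fun w => rfl⟩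
    · refine ⟨insert g (Finset.univ.image φ),
        ContinuousLinearMap.proj (R := ℝ) (φ := fun _ : ↥(insert g (Finset.univ.image φ)) => ℝ)
          ⟨g, by simp⟩ - ∑ i, (∫ t, φ i t * g t) •
          ContinuousLinearMap.proj (R := ℝ) (φ := fun _ : ↥(insert g (Finset.univ.image φ)) => ℝ)
          ⟨φ i, by simp⟩, fun w => ?_⟩
      simp [residual]
  · intro i g
    have e : (fun w : FiniteEnergy → ℝ => residual φ w g)
        = (fun w => w g) - ∑ j, fun w => (∫ t, φ j t * g t) * w (φ j) := by
      ext w; simp [residual]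
    have hm : ∀ j, MemLp (fun w : FiniteEnergy → ℝ => (∫ t, φ j t * g t) * w (φ j)) 2 μ :=
      fun j => (h.memLp (φ j)).const_mul _
    rw [e, covariance_sub_right (h.memLp _) (h.memLp _) (memLp_finsetSum' _ fun j _ => hm j),
      covariance_sum_right' (fun j _ => hm j) (h.memLp _)]
    simp_rw [covariance_const_mul_right, h.cov, hφ i]
    simp [mul_comm]

lemma map_pulses {n : ℕ} {φ : Fin n → FiniteEnergy} (h : IsWhiteNoise N₀ μ)
    (hφ : IsOrthonormal φ) :
    μ.map (fun (w : FiniteEnergy → ℝ) (i : Fin n) => w (φ i))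
      = gaussianVec (N₀ / 2).toNNReal 0 := by
  have hP := h.isProbabilityMeasure
  have hi : iIndepFun (fun (i : Fin n) (w : FiniteEnergy → ℝ) => w (φ i)) μ := by
    refine HasGaussianLaw.iIndepFun_of_covariance_eq_zero ?_ fun i j hij => ?_
    · have h1 := h.gaussian.comp_right φ
      classical
      have h2 := h1.hasGaussianLaw Finset.univ
      have h3 := h2.map (ContinuousLinearMap.pi fun i : Fin n =>
        ContinuousLinearMap.proj (R := ℝ) (φ := fun _ : ↥(Finset.univ : Finset (Fin n)) => ℝ)
          ⟨i, Finset.mem_univ i⟩)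
      exact h3
    · rw [h.cov, hφ, if_neg hij, mul_zero]
  rw [(iIndepFun_iff_map_fun_eq_pi_map fun i => (measurable_pi_apply _).aemeasurable).1 hi,
    gaussianVec]
  congr 1
  ext1 i
  rw [(h.gaussian.hasGaussianLaw_eval (φ i)).map_eq_gaussianReal, h.mean_zero,
    ← covariance_self (measurable_pi_apply _).aemeasurable, h.cov, hφ, if_pos rfl, mul_one]
  rfl

lemma map_observe_pulses {n : ℕ} {φ : Fin n → FiniteEnergy} (h : IsWhiteNoise N₀ μ)
    (hφ : IsOrthonormal φ) {x : ℝ → ℝ} {c : Fin n → ℝ} (hx : HasCoords φ x c)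
    {B : Set (Fin n → ℝ)} (hB : MeasurableSet B) :
    μ.real {w | (fun i => observe x w (φ i)) ∈ B} = (gaussianVec (N₀ / 2).toNNReal c).real B := by
  have e : (fun w i => observe x w (φ i)) = (fun z => z + c) ∘ fun w i => w (φ i) := by
    ext w i
    exact observe_apply_pulse hφ hx w i
  have h1 : gaussianVec (N₀ / 2).toNNReal c = μ.map (fun w i => observe x w (φ i)) := by
    rw [e, ← Measure.map_map (by fun_prop) (by fun_prop), map_pulses h hφ, gaussianVec_map_add,
      zero_add]
  rw [h1, map_measureReal_apply _ hB]
  · rfl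
  · exact measurable_pi_lambda _ fun i => (measurable_pi_apply _).comp (measurable_observe x)

/-- The coordinates are a sufficient statistic: the residual has the same law for every signal with
coordinates, so it only serves as independent randomization of a test on `Fin n → ℝ`. -/
lemma measureReal_observe {n : ℕ} {φ : Fin n → FiniteEnergy} (h : IsWhiteNoise N₀ μ)
    (hφ : IsOrthonormal φ) {x : ℝ → ℝ} {c : Fin n → ℝ} (hx : HasCoords φ x c)
    {A : Set (FiniteEnergy → ℝ)} (hA : MeasurableSet A) :
    μ.real {w | observe x w ∈ A} = ∫ r, (gaussianVec (N₀ / 2).toNNReal c).real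
      {z | synthesize φ z r ∈ A} ∂(μ.map (residual φ)) := by
  have hP := h.isProbabilityMeasure
  have hP' := Measure.isProbabilityMeasure_map (μ := μ) (measurable_residual φ).aemeasurable
  have hZ : Measurable fun (w : FiniteEnergy → ℝ) (i : Fin n) => w (φ i) := by fun_prop
  have h1 := (indepFun_iff_map_prod_eq_prod_map_map
    ((hZ.add_const c).aemeasurable) (measurable_residual φ).aemeasurable).1
    ((indepFun_residual h hφ).comp (φ := fun z => z + c) (ψ := id) (by fun_prop) measurable_id)
  have h2 : μ.map ((fun z => z + c) ∘ fun (w : FiniteEnergy → ℝ) (i : Fin n) => w (φ i))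
      = gaussianVec (N₀ / 2).toNNReal c := by
    rw [← Measure.map_map (by fun_prop) hZ, map_pulses h hφ, gaussianVec_map_add, zero_add]
  have hS := measurable_synthesize φ
  have h3 : {w | observe x w ∈ A} = (fun w => ((fun i => w (φ i)) + c, residual φ w)) ⁻¹'
      ((fun p => synthesize φ p.1 p.2) ⁻¹' A) := by
    ext w
    simp only [Set.mem_ofPred_eq, Set.mem_preimage]
    rw [observe_eq_synthesize hx]
  have h4 : μ.map (fun w => ((fun i => w (φ i)) + c, residual φ w))
      = (gaussianVec (N₀ / 2).toNNReal c).prod (μ.map (residual φ)) := by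
    rw [← h2]; exact h1
  rw [h3, ← map_measureReal_apply ((hZ.add_const c).prodMk (measurable_residual φ)) (hS hA), h4,
    measureReal_def, Measure.prod_apply_symm (hS hA)]
  rw [integral_eq_lintegral_of_nonneg_ae (ae_of_all _ fun r => measureReal_nonneg)]
  · congr 1
    refine lintegral_congr fun r => ?_
    rw [ofReal_measureReal]; rfl
  · exact ((measurable_measure_prodMk_right (hS hA)).ennreal_toReal).aestronglyMeasurable

end

/-! ### The optimal test of the warden -/

/-- Neyman–Pearson: a test that accuses on `A` has error `∫ 1_A + 1_{Aᶜ} * L`, which is least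
pointwise when `A` is where `L` exceeds `1`. -/
lemma Code.minDetectionError_eq {T : ℝ} (C : Code T) {n : ℕ} {φ : Fin n → FiniteEnergy}
    (hφ : IsOrthonormal φ) {c : Fin C.M → Fin C.K → Fin n → ℝ}
    (hc : ∀ m s, HasCoords φ (C.codeword m s) (c m s)) {Nw : ℝ} (hN : 0 < Nw) :
    C.minDetectionError Nw = ∫ z, min 1 ((∑ m, ∑ s, likelihood (Nw / 2).toNNReal (c m s) z)
      / (C.M * C.K)) ∂(gaussianVec (Nw / 2).toNNReal 0) := by
  set v := (Nw / 2).toNNReal with hv_def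
  have hv : v ≠ 0 := (Real.toNNReal_pos.2 (by linarith)).ne'
  have hμ := isWhiteNoise_whiteNoise hN.le
  have hP := hμ.isProbabilityMeasure
  have hP' := Measure.isProbabilityMeasure_map (μ := whiteNoise Nw)
    (measurable_residual φ).aemeasurable
  set L : (Fin n → ℝ) → ℝ := fun z => (∑ m, ∑ s, likelihood v (c m s) z) / (C.M * C.K) with hL
  have hLm : Measurable L := by
    refine Measurable.div_const (Finset.measurable_sum _ fun m _ =>
      Finset.measurable_sum _ fun s _ => measurable_likelihood _ _) _
  have hLi : Integrable L (gaussianVec v 0) := by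
    refine Integrable.div_const (integrable_finsetSum _ fun m _ =>
      integrable_finsetSum _ fun s _ => integrable_likelihood _ _ _) _
  have hmi : Integrable (fun z => min 1 (L z)) (gaussianVec v 0) :=
    (integrable_const 1).inf hLi
  have hset : ∀ B : Set (Fin n → ℝ), MeasurableSet B →
      (∑ m, ∑ s, (gaussianVec v (c m s)).real B) / (C.M * C.K) = ∫ z in B, L z ∂(gaussianVec v 0) := by
    intro B hB
    rw [hL, integral_div, integral_finsetSum _ fun m _ =>
      (integrable_finsetSum _ fun s _ => (integrable_likelihood _ _ _).integrableOn)]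
    simp_rw [integral_finsetSum _ fun s _ => (integrable_likelihood _ _ _).integrableOn,
      gaussianVec_real_eq hv _ hB]
  have hsplit : ∀ A : Set (Fin n → ℝ), MeasurableSet A →
      (gaussianVec v 0).real A + ∫ z in Aᶜ, L z ∂(gaussianVec v 0)
        = ∫ z, A.indicator (fun _ => 1) z + Aᶜ.indicator L z ∂(gaussianVec v 0) := by
    intro A hA
    rw [integral_add ((integrable_indicator_iff hA).2 (by simp))
      ((integrable_indicator_iff hA.compl).2 hLi.integrableOn), integral_indicator hA,
      integral_indicator hA.compl]
    simp
  have hsi : ∀ A : Set (Fin n → ℝ), MeasurableSet A →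
      Integrable (fun z => A.indicator (fun _ => (1 : ℝ)) z + Aᶜ.indicator L z) (gaussianVec v 0) :=
    fun A hA => ((integrable_indicator_iff hA).2 (by simp)).add
      ((integrable_indicator_iff hA.compl).2 hLi.integrableOn)
  refine le_antisymm ?_ ?_
  · let A : Set (Fin n → ℝ) := {z | 1 < L z}
    have hA : MeasurableSet A := measurableSet_lt measurable_const hLm
    have hpm : Measurable fun (y : FiniteEnergy → ℝ) (i : Fin n) => y (φ i) := by fun_prop
    classical
    let Φ : (FiniteEnergy → ℝ) → Bool := fun y => if (fun i => y (φ i)) ∈ A then true else false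
    have hΦ : Measurable Φ := Measurable.ite (hpm hA) measurable_const measurable_const
    refine (ciInf_le ⟨0, ?_⟩ (⟨Φ, hΦ⟩ : {Φ : (FiniteEnergy → ℝ) → Bool // Measurable Φ})).trans
      (le_of_eq ?_)
    · rintro _ ⟨Ψ, rfl⟩
      unfold falseAlarm missedDetection
      positivity
    · have e1 : falseAlarm Nw Φ = (gaussianVec v 0).real A := by
        rw [falseAlarm, ← map_observe_pulses hμ hφ (hasCoords_zero φ) hA]
        simp [Φ]
      have e2 : C.missedDetection Nw Φ = ∫ z in Aᶜ, L z ∂(gaussianVec v 0) := by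
        rw [← hset _ hA.compl, missedDetection]
        congr 1
        refine Finset.sum_congr rfl fun m _ => Finset.sum_congr rfl fun s _ => ?_
        rw [← map_observe_pulses hμ hφ (hc m s) hA.compl]
        simp [Φ]
      simp only
      rw [e1, e2, hsplit A hA]
      refine integral_congr_ae (ae_of_all _ fun z => ?_)
      change A.indicator (fun _ => 1) z + Aᶜ.indicator L z = min 1 (L z)
      by_cases hz : z ∈ A
      · have hz' : 1 < L z := hz
        rw [min_eq_left hz'.le]
        simp [hz]
      · have hz' : L z ≤ 1 := not_lt.1 hz
        rw [min_eq_right hz']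
        simp [hz]
  · have : Nonempty {Φ : (FiniteEnergy → ℝ) → Bool // Measurable Φ} :=
      ⟨⟨fun _ => true, measurable_const⟩⟩
    refine le_ciInf fun ⟨Φ, hΦ⟩ => ?_
    simp only
    have hAt : MeasurableSet {y | Φ y = true} := hΦ (measurableSet_singleton true)
    have hAf : MeasurableSet {y | Φ y = false} := hΦ (measurableSet_singleton false)
    have hsy : ∀ r, Measurable fun z => synthesize φ z r := fun r =>
      (measurable_synthesize φ).comp (measurable_id.prodMk measurable_const)
    have hint : ∀ (x : Fin n → ℝ) (A : Set (FiniteEnergy → ℝ)), MeasurableSet A →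
        Integrable (fun r => (gaussianVec v x).real {z | synthesize φ z r ∈ A})
          ((whiteNoise Nw).map (residual φ)) := by
      intro x A hA
      refine Integrable.of_bound (C := 1) ?_ (ae_of_all _ fun r => ?_)
      · exact ((measurable_measure_prodMk_right
          (measurable_synthesize φ hA)).ennreal_toReal).aestronglyMeasurable
      · rw [Real.norm_of_nonneg measureReal_nonneg]; exact measureReal_le_one
    have hint' : ∀ (x : Fin n → ℝ) (b : Bool),
        Integrable (fun r => (gaussianVec v x).real {z | Φ (synthesize φ z r) = b})
          ((whiteNoise Nw).map (residual φ)) := fun x b =>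
      hint x {y | Φ y = b} (hΦ (measurableSet_singleton b))
    have e1 : falseAlarm Nw Φ = ∫ r, (gaussianVec v 0).real {z | Φ (synthesize φ z r) = true}
        ∂((whiteNoise Nw).map (residual φ)) := measureReal_observe hμ hφ (hasCoords_zero φ) hAt
    have e2 : C.missedDetection Nw Φ = ∫ r, (∑ m, ∑ s, (gaussianVec v (c m s)).real
        {z | Φ (synthesize φ z r) = false}) / (C.M * C.K) ∂((whiteNoise Nw).map (residual φ)) := by
      rw [integral_div, integral_finsetSum _ fun m _ => integrable_finsetSum _ fun s _ =>
        hint' _ _]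
      simp_rw [integral_finsetSum _ fun s _ => hint' _ _]
      rw [missedDetection]
      congr 1
      exact Finset.sum_congr rfl fun m _ => Finset.sum_congr rfl fun s _ =>
        measureReal_observe hμ hφ (hc m s) hAf
    -- Writing the bound as an average over the residual reduces the claim to each fixed residual,
    -- where the test becomes a set of coordinates.
    have e3 := integral_const (μ := (whiteNoise Nw).map (residual φ))
      (∫ z, min 1 (L z) ∂(gaussianVec v 0))
    rw [probReal_univ, one_smul] at e3
    rw [e1, e2, ← e3, ← integral_add (hint' _ _)
      ((integrable_finsetSum _ fun m _ => integrable_finsetSum _ fun s _ =>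
        hint' _ _).div_const _)]
    refine integral_mono (integrable_const _) ((hint' _ _).add
      ((integrable_finsetSum _ fun m _ => integrable_finsetSum _ fun s _ =>
        hint' _ _).div_const _)) fun r => ?_
    have hA1 : MeasurableSet {z | Φ (synthesize φ z r) = true} := hsy r hAt
    have hA2 : {z | Φ (synthesize φ z r) = false} = {z | Φ (synthesize φ z r) = true}ᶜ := by
      ext z; simp
    simp only
    rw [hA2, hset _ hA1.compl, hsplit _ hA1]
    refine integral_mono hmi (hsi _ hA1) fun z => ?_
    by_cases hz : z ∈ {z | Φ (synthesize φ z r) = true}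
    · simp only [Set.indicator_of_mem hz, Set.indicator_of_notMem (Set.notMem_compl_iff.2 hz),
        add_zero]
      exact min_le_left _ _
    · simp only [Set.indicator_of_notMem hz, Set.indicator_of_mem (Set.mem_compl hz), zero_add]
      exact min_le_right _ _

/-! ### Pulse amplitude modulation -/

/-- The signal with the symbols `x`, over the pulses of duration `T₀` and roll-off `β`. -/
noncomputable def pam {n : ℕ} (T₀ β : ℝ) (x : Fin n → ℝ) (t : ℝ) : ℝ :=
  ∑ i, x i * rrc T₀ β (t - ((i : ℝ) + 1 / 2) * T₀)

section

variable {T₀ β : ℝ} (hT : 0 < T₀) (hβ : β ∈ Set.Icc (0 : ℝ) 1)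

include hT hβ

lemma memLp_shifted_rrc (b : ℝ) : MemLp (fun t => rrc T₀ β (t - b)) 2 volume :=
  (memLp_rrc hT hβ 2).comp_measurePreserving (measurePreserving_sub_right volume b)

lemma memLp_pam {n : ℕ} (x : Fin n → ℝ) : MemLp (pam T₀ β x) 2 volume :=
  memLp_finsetSum _ fun _ _ => (memLp_shifted_rrc hT hβ _).const_mul _

lemma pam_eq_zero {n : ℕ} (x : Fin n → ℝ) {T t : ℝ} (hn : n * T₀ ≤ T) (ht : t ∉ Set.Icc 0 T) :
    pam T₀ β x t = 0 := by
  refine Finset.sum_eq_zero fun i _ => ?_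
  rw [rrc_eq_zero hT hβ, mul_zero]
  have hi : ((i : ℕ) : ℝ) + 1 ≤ n := by exact_mod_cast i.2
  have hi0 : (0 : ℝ) ≤ (i : ℕ) := Nat.cast_nonneg _
  rw [lt_abs]
  rcases lt_or_ge t 0 with h | h
  · right; nlinarith
  · left
    have : T < t := by
      by_contra h2
      exact ht ⟨h, not_lt.1 h2⟩
    nlinarith

/-- The shifted root raised cosine pulses. -/
noncomputable def pulse {n : ℕ} (i : Fin n) : FiniteEnergy :=
  (memLp_shifted_rrc hT hβ (((i : ℝ) + 1 / 2) * T₀)).toLp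

lemma coeFn_pulse {n : ℕ} (i : Fin n) :
    (pulse hT hβ i : ℝ → ℝ) =ᵐ[volume] fun t => rrc T₀ β (t - ((i : ℝ) + 1 / 2) * T₀) :=
  (memLp_shifted_rrc hT hβ _).coeFn_toLp

/-- The supports are `[i * T₀, (i + 1) * T₀]` and `[j * T₀, (j + 1) * T₀]`; they can meet only at `j
* T₀`, which has measure zero. -/
lemma rrc_mul_rrc_shifted {i j : ℕ} (hij : i < j) {t : ℝ} (ht : t ≠ j * T₀) :
    rrc T₀ β (t - ((i : ℝ) + 1 / 2) * T₀) * rrc T₀ β (t - ((j : ℝ) + 1 / 2) * T₀) = 0 := by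
  have hij' : (i : ℝ) + 1 ≤ j := by exact_mod_cast hij
  rcases lt_or_gt_of_ne ht with h | h
  · rw [rrc_eq_zero hT hβ (t := t - ((j : ℝ) + 1 / 2) * T₀), mul_zero]
    rw [lt_abs]; right; linarith
  · rw [rrc_eq_zero hT hβ (t := t - ((i : ℝ) + 1 / 2) * T₀), zero_mul]
    rw [lt_abs]; left; nlinarith

lemma isOrthonormal_pulse {n : ℕ} : IsOrthonormal (fun i : Fin n => pulse hT hβ i) := by
  intro i j
  have h1 : ∫ t, pulse hT hβ i t * pulse hT hβ j t
      = ∫ t, rrc T₀ β (t - ((i : ℝ) + 1 / 2) * T₀) * rrc T₀ β (t - ((j : ℝ) + 1 / 2) * T₀) := by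
    refine integral_congr_ae ?_
    filter_upwards [coeFn_pulse hT hβ i, coeFn_pulse hT hβ j] with t h1 h2
    rw [h1, h2]
  rw [h1]
  split_ifs with hij
  · subst hij
    simp_rw [← pow_two]
    rw [integral_sub_right_eq_self (fun t => rrc T₀ β t ^ 2), integral_rrc_sq hT hβ]
  · rw [← integral_zero ℝ ℝ]
    rcases lt_or_gt_of_ne hij with h | h
    · refine integral_congr_ae ?_
      filter_upwards [Measure.ae_ne volume ((j : ℝ) * T₀)] with t ht
      exact rrc_mul_rrc_shifted hT hβ h ht
    · refine integral_congr_ae ?_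
      filter_upwards [Measure.ae_ne volume ((i : ℝ) * T₀)] with t ht
      rw [mul_comm]
      exact rrc_mul_rrc_shifted hT hβ h ht

lemma hasCoords_pam {n : ℕ} (x : Fin n → ℝ) :
    HasCoords (fun i : Fin n => pulse hT hβ i) (pam T₀ β x) x := by
  intro g
  have h1 : ∫ t, pam T₀ β x t * g t = ∫ t, ∑ i, x i * (pulse hT hβ i t * g t) := by
    refine integral_congr_ae ?_
    have h2 : ∀ᵐ t, ∀ i : Fin n, pulse hT hβ i t = rrc T₀ β (t - ((i : ℝ) + 1 / 2) * T₀) :=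
      ae_all_iff.2 fun i => coeFn_pulse hT hβ i
    filter_upwards [h2] with t h3
    simp_rw [h3, pam, Finset.sum_mul, mul_assoc]
  have hi : ∀ i : Fin n, Integrable fun t => pulse hT hβ i t * g t := fun i =>
    (Lp.memLp (pulse hT hβ i)).integrable_mul (Lp.memLp g)
  rw [h1, integral_finsetSum _ fun i _ => (hi i).const_mul _]
  simp_rw [integral_const_mul]

lemma fourier_pam {n : ℕ} (x : Fin n → ℝ) (f : ℝ) :
    𝓕 (fun t => (pam T₀ β x t : ℂ)) f
      = (∑ i, (x i : ℂ) * (Real.fourierChar (-(((i : ℝ) + 1 / 2) * T₀ * f)) : ℂ))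
        * rrcSpectrum T₀ β f := by
  have hshift : ∀ b : ℝ, Integrable (fun t => ((rrc T₀ β (t - b) : ℝ) : ℂ)) := fun b =>
    ((integrable_rrc hT hβ).comp_sub_right b).ofReal
  rw [Real.fourier_real_eq]
  have h1 : ∀ t : ℝ, Real.fourierChar (-(t * f)) • (pam T₀ β x t : ℂ)
      = ∑ i, (x i : ℂ) * (Real.fourierChar (-(t * f)) •
        ((rrc T₀ β (t - ((i : ℝ) + 1 / 2) * T₀) : ℝ) : ℂ)) := by
    intro t
    simp only [pam, Circle.smul_def, smul_eq_mul]
    push_cast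
    rw [Finset.mul_sum]
    exact Finset.sum_congr rfl fun i _ => by ring
  have hi : ∀ b : ℝ, Integrable fun t : ℝ => (Real.fourierChar (-(t * f)) •
        ((rrc T₀ β (t - b) : ℝ) : ℂ)) := fun b => by
    have := (Real.fourierIntegral_convergent_iff f).2 (hshift b)
    refine this.congr (ae_of_all _ fun t => ?_)
    simp [mul_comm]
  simp_rw [h1]
  rw [integral_finsetSum _ fun i _ => (hi _).const_mul _, Finset.sum_mul]
  refine Finset.sum_congr rfl fun i _ => ?_
  rw [integral_const_mul, mul_assoc]
  congr 1
  set b := ((i : ℝ) + 1 / 2) * T₀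
  rw [← integral_add_right_eq_self _ b]
  unfold rrcSpectrum
  rw [Real.fourier_real_eq, ← integral_const_mul]
  refine integral_congr_ae (ae_of_all _ fun t => ?_)
  simp only [add_sub_cancel_right, Circle.smul_def, smul_eq_mul]
  rw [← mul_assoc, ← Circle.coe_mul, ← AddChar.map_add_eq_mul]
  congr 4
  ring

/-- A shift in time is a phase of modulus one in frequency. Uncorrelated symbols remove all cross
terms, so the sum keeps the exact shape of the pulse spectrum. -/
lemma sum_norm_sq_fourier_pam {n : ℕ} {ι : Type*} [Fintype ι] {a : ℝ} (x : ι → Fin n → ℝ)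
    (hx : ∀ i j, ∑ k, x k i * x k j = if i = j then Fintype.card ι * a ^ 2 else 0) (f : ℝ) :
    ∑ k, ‖𝓕 (fun t => (pam T₀ β (x k) t : ℂ)) f‖ ^ 2
      = Fintype.card ι * (n * a ^ 2 * ‖rrcSpectrum T₀ β f‖ ^ 2) := by
  simp_rw [fourier_pam hT hβ, norm_mul, mul_pow]
  rw [← Finset.sum_mul]
  suffices h : ∑ k, ‖∑ i : Fin n, (x k i : ℂ) *
      (Real.fourierChar (-(((i : ℝ) + 1 / 2) * T₀ * f)) : ℂ)‖ ^ 2 = Fintype.card ι * (n * a ^ 2) by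
    rw [h]; ring
  set e : Fin n → ℂ := fun i => (Real.fourierChar (-(((i : ℝ) + 1 / 2) * T₀ * f)) : ℂ) with he
  have hen : ∀ i, e i * (starRingEnd ℂ) (e i) = 1 := fun i => by
    rw [Complex.mul_conj, Complex.normSq_eq_norm_sq, show ‖e i‖ = 1 from Circle.norm_coe _]; simp
  have h1 : ∀ k, ((‖∑ i : Fin n, (x k i : ℂ) * e i‖ ^ 2 : ℝ) : ℂ)
      = ∑ i, ∑ j, ((x k i * x k j : ℝ) : ℂ) * (e i * (starRingEnd ℂ) (e j)) := by
    intro k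
    rw [← Complex.normSq_eq_norm_sq, ← Complex.mul_conj, map_sum, Finset.sum_mul_sum]
    refine Finset.sum_congr rfl fun i _ => Finset.sum_congr rfl fun j _ => ?_
    rw [map_mul, Complex.conj_ofReal]; push_cast; ring
  have h2 : ((∑ k, ‖∑ i : Fin n, (x k i : ℂ) * e i‖ ^ 2 : ℝ) : ℂ)
      = ((Fintype.card ι * (n * a ^ 2) : ℝ) : ℂ) := by
    rw [Complex.ofReal_sum]
    simp_rw [h1]
    rw [Finset.sum_comm]
    have h3 : ∀ i : Fin n, ∑ k, ∑ j, ((x k i * x k j : ℝ) : ℂ) * (e i * (starRingEnd ℂ) (e j))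
        = Fintype.card ι * a ^ 2 := by
      intro i
      rw [Finset.sum_comm]
      simp_rw [← Finset.sum_mul, ← Complex.ofReal_sum, hx]
      rw [Finset.sum_eq_single i]
      · simp [hen]
      · intro j _ hj; simp [hj.symm]
      · simp
    simp_rw [h3]
    simp; ring
  exact_mod_cast h2

/-- The code whose codewords have the symbols `c m s`, and whose decoder uses the samples of the
observation along the pulses. -/
noncomputable def pamCode {T : ℝ} {n : ℕ} (hn : n * T₀ ≤ T) {M K : ℕ} (hM : 0 < M) (hK : 0 < K)
    (c : Fin M → Fin K → Fin n → ℝ) (D : Fin K → (Fin n → ℝ) → Fin (M + 1))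
    (hD : ∀ s, Measurable (D s)) : Code T where
  M := M
  K := K
  M_pos := hM
  K_pos := hK
  codeword m s := pam T₀ β (c m s)
  memLp_codeword m s := memLp_pam hT hβ _
  support_codeword m s t ht := pam_eq_zero hT hβ _ hn ht
  decode s y := D s fun i => y (pulse hT hβ i)
  measurable_decode s := (hD s).comp (by fun_prop)

end

/-! ### Finite averages -/

lemma integrable_expect {α ι : Type*} [MeasurableSpace α] [Fintype ι] {μ : Measure α}
    {f : ι → α → ℝ} (hf : ∀ i, Integrable (f i) μ) : Integrable (fun a => 𝔼 i, f i a) μ := by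
  simp_rw [Fintype.expect_eq_sum_div_card]
  exact (integrable_finsetSum _ fun i _ => hf i).div_const _

lemma integral_expect {α ι : Type*} [MeasurableSpace α] [Fintype ι] {μ : Measure α}
    {f : ι → α → ℝ} (hf : ∀ i, Integrable (f i) μ) :
    ∫ a, 𝔼 i, f i a ∂μ = 𝔼 i, ∫ a, f i a ∂μ := by
  simp_rw [Fintype.expect_eq_sum_div_card]
  rw [integral_div, integral_finsetSum _ fun i _ => hf i]

lemma expect_mul_left {G : Type*} [Group G] [Fintype G] (t : G) (f : G → ℝ) :
    𝔼 g, f (t * g) = 𝔼 g, f g :=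
  Fintype.expect_equiv (Equiv.mulLeft t) _ _ fun _ => rfl

lemma expect_mul_right {G : Type*} [Group G] [Fintype G] (t : G) (f : G → ℝ) :
    𝔼 g, f (g * t) = 𝔼 g, f g :=
  Fintype.expect_equiv (Equiv.mulRight t) _ _ fun _ => rfl

lemma expect_inv_le_card {ι : Type*} [Fintype ι] [DecidableEq ι] (c : ι → ι → ℝ) (b : ℝ)
    (hd : ∀ j, c j j ≤ b) (ho : ∀ j j', j ≠ j' → c j j' = 0) :
    𝔼 j, 𝔼 j', c j j' ≤ 𝔼 _j : ι, b / Fintype.card ι := by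
  refine Finset.expect_le_expect fun j _ => ?_
  rw [Fintype.expect_eq_sum_div_card, Finset.sum_eq_single j (fun j' _ h => ho j j' h.symm)
    (by simp)]
  gcongr
  exact hd j

/-- Second moment bound for the average of a function over pairwise independent, uniform elements
of a finite group. Uniformity and pairwise independence are expressed by translations. -/
lemma expect_sq_sub_le {H G ι : Type*} [Group H] [Fintype H] [Group G] [Fintype G] [Fintype ι]
    [Nonempty ι] (w : H → ι → G)
    (hw : ∀ j, ∃ τ : G → H, ∀ g h, w (τ g * h) j = g * w h j)
    (hpair : ∀ j j', j ≠ j' → ∃ τ : G → H, ∀ g h, w (τ g * h) j = g * w h j ∧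
      w (τ g * h) j' = w h j') (f : G → ℝ) :
    𝔼 h, (𝔼 j, f (w h j) - 𝔼 g, f g) ^ 2 ≤ (𝔼 g, f g ^ 2) / Fintype.card ι := by
  classical
  set m := 𝔼 g, f g with hm
  have h0 : 𝔼 g, (f g - m) = 0 := by
    rw [Finset.expect_sub_distrib, Fintype.expect_const, ← hm, sub_self]
  have h1 : ∀ h, (𝔼 j, f (w h j) - m) ^ 2 = 𝔼 j, 𝔼 j', (f (w h j) - m) * (f (w h j') - m) := by
    intro h
    rw [← Finset.expect_mul_expect, ← pow_two, Finset.expect_sub_distrib, Fintype.expect_const]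
  simp_rw [h1]
  rw [Finset.expect_comm]
  simp_rw [Finset.expect_comm (Finset.univ : Finset H)]
  refine (expect_inv_le_card _ (𝔼 g, f g ^ 2) ?_ ?_).trans (by rw [Fintype.expect_const])
  · intro j
    obtain ⟨τ, hτ⟩ := hw j
    -- Averaging over the translates `τ g * h` changes nothing on the left and turns `w h j` into a
    -- uniform element of `G`.
    have e : 𝔼 h, (f (w h j) - m) * (f (w h j) - m) = 𝔼 g, (f g - m) ^ 2 := by
      calc 𝔼 h, (f (w h j) - m) * (f (w h j) - m)
          = 𝔼 g, 𝔼 h, (f (w (τ g * h) j) - m) ^ 2 := by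
            rw [← Fintype.expect_const (ι := G) (𝔼 h, (f (w h j) - m) * (f (w h j) - m))]
            refine Finset.expect_congr rfl fun g _ => ?_
            rw [expect_mul_left (τ g) fun h => (f (w h j) - m) ^ 2]
            simp_rw [pow_two]
        _ = 𝔼 h, 𝔼 g, (f (g * w h j) - m) ^ 2 := by
            rw [Finset.expect_comm]; simp_rw [hτ]
        _ = 𝔼 g, (f g - m) ^ 2 := by
            simp_rw [expect_mul_right (w _ j) fun g => (f g - m) ^ 2]
            rw [Fintype.expect_const]
    rw [e]
    have e2 : 𝔼 g, (f g - m) ^ 2 = 𝔼 g, f g ^ 2 - m ^ 2 := by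
      have : ∀ g, (f g - m) ^ 2 = f g ^ 2 - (2 * m * f g - m ^ 2) := fun g => by ring
      simp_rw [this]
      rw [Finset.expect_sub_distrib, Finset.expect_sub_distrib, ← Finset.mul_expect,
        Fintype.expect_const, ← hm]
      ring
    rw [e2]
    nlinarith [sq_nonneg m]
  · intro j j' hjj
    obtain ⟨τ, hτ⟩ := hpair j j' hjj
    -- Here the translation moves the `j`-th element alone, so the centred factor averages to zero
    -- with the other one held fixed.
    calc 𝔼 h, (f (w h j) - m) * (f (w h j') - m)
        = 𝔼 g, 𝔼 h, (f (w (τ g * h) j) - m) * (f (w (τ g * h) j') - m) := by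
          rw [← Fintype.expect_const (ι := G) (𝔼 h, (f (w h j) - m) * (f (w h j') - m))]
          refine Finset.expect_congr rfl fun g _ => ?_
          rw [expect_mul_left (τ g) fun h => (f (w h j) - m) * (f (w h j') - m)]
      _ = 𝔼 h, 𝔼 g, (f (g * w h j) - m) * (f (w h j') - m) := by
          rw [Finset.expect_comm]
          simp_rw [fun g h => (hτ g h).1, fun g h => (hτ g h).2]
      _ = 0 := by
          simp_rw [← Finset.expect_mul, expect_mul_right (w _ j) fun g => f g - m, h0, zero_mul]
          simp

/-- Concentration of the average of a nonnegative function over pairwise independent elements,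
after truncation at level `τ`. -/
lemma expect_abs_sub_le {H G ι : Type*} [Group H] [Fintype H] [Group G] [Fintype G] [Fintype ι]
    [Nonempty ι] (w : H → ι → G)
    (hw : ∀ j, ∃ τ : G → H, ∀ g h, w (τ g * h) j = g * w h j)
    (hpair : ∀ j j', j ≠ j' → ∃ τ : G → H, ∀ g h, w (τ g * h) j = g * w h j ∧
      w (τ g * h) j' = w h j') (ℓ : G → ℝ) (hℓ : ∀ g, 0 ≤ ℓ g) {τ d : ℝ} (hd : 0 < d)
    (hτ : τ ≤ d ^ 2 * Fintype.card ι) :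
    𝔼 h, |𝔼 j, ℓ (w h j) - 𝔼 g, ℓ g|
      ≤ d / 2 * (1 + 𝔼 g, ℓ g) + 2 * 𝔼 g, (if τ < ℓ g then ℓ g else 0) := by
  have hN : (0 : ℝ) < Fintype.card ι := by exact_mod_cast Fintype.card_pos
  set r : G → ℝ := fun g => if τ < ℓ g then ℓ g else 0 with hr
  set f : G → ℝ := fun g => if τ < ℓ g then 0 else ℓ g with hf
  have hsum : ∀ g, ℓ g = f g + r g := fun g => by simp only [hf, hr]; split_ifs <;> simp
  have hr0 : ∀ g, 0 ≤ r g := fun g => by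
    simp only [hr]; split_ifs
    · exact hℓ g
    · exact le_rfl
  -- The truncated part satisfies `f ^ 2 ≤ τ * ℓ`; only the first moment of `ℓ` remains, although
  -- its second moment may be huge.
  have hf2 : 𝔼 g, f g ^ 2 ≤ d ^ 2 * Fintype.card ι * 𝔼 g, ℓ g := by
    rw [Finset.mul_expect]
    refine Finset.expect_le_expect fun g _ => ?_
    simp only [hf]
    split_ifs with h
    · rw [zero_pow two_ne_zero]
      exact mul_nonneg (by positivity) (hℓ g)
    · rw [pow_two]
      exact mul_le_mul_of_nonneg_right ((not_lt.1 h).trans hτ) (hℓ g)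
  have hmean : 𝔼 h, 𝔼 j, r (w h j) = 𝔼 g, r g := by
    rw [Finset.expect_comm]
    rw [← Fintype.expect_const (ι := ι) (𝔼 g, r g)]
    refine Finset.expect_congr rfl fun j _ => ?_
    obtain ⟨t, ht⟩ := hw j
    calc 𝔼 h, r (w h j) = 𝔼 g, 𝔼 h, r (w (t g * h) j) := by
          rw [← Fintype.expect_const (ι := G) (𝔼 h, r (w h j))]
          refine Finset.expect_congr rfl fun g _ => ?_
          rw [expect_mul_left (t g) fun h => r (w h j)]
      _ = 𝔼 h, 𝔼 g, r (g * w h j) := by rw [Finset.expect_comm]; simp_rw [ht]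
      _ = 𝔼 g, r g := by
          simp_rw [expect_mul_right (w _ j) r]
          rw [Fintype.expect_const]
  have hpt : ∀ h, |𝔼 j, ℓ (w h j) - 𝔼 g, ℓ g|
      ≤ (𝔼 j, f (w h j) - 𝔼 g, f g) ^ 2 / (2 * d) + (d / 2 + (𝔼 j, r (w h j) + 𝔼 g, r g)) := by
    intro h
    have e : 𝔼 j, ℓ (w h j) - 𝔼 g, ℓ g
        = (𝔼 j, f (w h j) - 𝔼 g, f g) + (𝔼 j, r (w h j) - 𝔼 g, r g) := by
      simp_rw [hsum, Finset.expect_add_distrib]; ring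
    rw [e]
    refine (abs_add_le _ _).trans ?_
    have h1 : |𝔼 j, r (w h j) - 𝔼 g, r g| ≤ 𝔼 j, r (w h j) + 𝔼 g, r g := by
      have a1 : 0 ≤ 𝔼 j, r (w h j) := Finset.expect_nonneg fun j _ => hr0 _
      have a2 : 0 ≤ 𝔼 g, r g := Finset.expect_nonneg fun j _ => hr0 _
      rw [abs_le]; constructor <;> linarith
    set X := 𝔼 j, f (w h j) - 𝔼 g, f g
    -- This replaces Cauchy–Schwarz: the resulting bound is linear in the mean of `ℓ` and can later
    -- be integrated over the observation.
    have h2 : |X| ≤ X ^ 2 / (2 * d) + d / 2 := by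
      have : X ^ 2 / (2 * d) + d / 2 = (X ^ 2 + d ^ 2) / (2 * d) := by field_simp
      rw [this, le_div_iff₀ (by positivity), ← sq_abs X]
      nlinarith [sq_nonneg (|X| - d)]
    linarith
  refine (Finset.expect_le_expect fun h _ => hpt h).trans ?_
  rw [Finset.expect_add_distrib, Finset.expect_add_distrib, Finset.expect_add_distrib,
    Fintype.expect_const, Fintype.expect_const, hmean, ← Finset.expect_div]
  have h3 := (expect_sq_sub_le w hw hpair f).trans (div_le_div_of_nonneg_right hf2 hN.le)
  have h4 : d ^ 2 * Fintype.card ι * (𝔼 g, ℓ g) / Fintype.card ι = d ^ 2 * 𝔼 g, ℓ g := by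
    field_simp
  rw [h4] at h3
  have h5 : (𝔼 h, (𝔼 j, f (w h j) - 𝔼 g, f g) ^ 2) / (2 * d) ≤ d / 2 * 𝔼 g, ℓ g := by
    rw [div_le_iff₀ (by positivity)]
    refine h3.trans (le_of_eq ?_); ring
  linarith

/-! ### Sign vectors -/

/-- The symbols of a BPSK codeword of amplitude `a`. -/
noncomputable def symbols {n : ℕ} (a : ℝ) (g : Fin n → ℤˣ) (i : Fin n) : ℝ := a * ((g i : ℤ) : ℝ)

lemma sign_sq (u : ℤˣ) : ((u : ℤ) : ℝ) ^ 2 = 1 := by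
  rcases Int.units_eq_one_or u with h | h <;> simp [h]

lemma symbols_sq {n : ℕ} (a : ℝ) (g : Fin n → ℤˣ) (i : Fin n) : symbols a g i ^ 2 = a ^ 2 := by
  rw [symbols, mul_pow, sign_sq, mul_one]

lemma sum_symbols_sq {n : ℕ} (a : ℝ) (g : Fin n → ℤˣ) : ∑ i, symbols a g i ^ 2 = n * a ^ 2 := by
  simp [symbols_sq]

/-- The correlation of the observation with a codeword. -/
noncomputable def score {n : ℕ} (a : ℝ) (g : Fin n → ℤˣ) (z : Fin n → ℝ) : ℝ :=
  ∑ i, symbols a g i * z i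

lemma measurable_score {n : ℕ} (a : ℝ) (g : Fin n → ℤˣ) : Measurable (score a g) := by
  unfold score; fun_prop

lemma integrable_exp_score {n : ℕ} (a t : ℝ) (g : Fin n → ℤˣ) (v : ℝ≥0) (x : Fin n → ℝ) :
    Integrable (fun z => Real.exp (t * score a g z)) (gaussianVec v x) := by
  have := integrable_exp_gaussianVec v x fun i => t * symbols a g i
  simpa only [score, Finset.mul_sum, mul_assoc] using this

lemma mgf_score {n : ℕ} (a t : ℝ) (g : Fin n → ℤˣ) (v : ℝ≥0) (x : Fin n → ℝ) :
    mgf (score a g) (gaussianVec v x) t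
      = Real.exp (t * score a g x + v * t ^ 2 * (n * a ^ 2) / 2) := by
  have h := integral_exp_gaussianVec v x fun i => t * symbols a g i
  simp_rw [mul_assoc, ← Finset.mul_sum, mul_pow, ← Finset.mul_sum, sum_symbols_sq] at h
  rw [mgf]
  refine h.trans ?_
  rw [score]; congr 1; ring

lemma score_symbols_self {n : ℕ} (a : ℝ) (g : Fin n → ℤˣ) :
    score a g (symbols a g) = n * a ^ 2 := by
  rw [score, ← sum_symbols_sq a g]
  simp_rw [pow_two]

/-! ### Chernoff bounds for the score of a codeword -/

section

variable {n : ℕ} {a ε : ℝ} {v : ℝ≥0}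

/-- Under its own codeword the score is normal with mean `n * a ^ 2` and variance `v * n * a ^ 2`;
the Chernoff exponent is optimal at `t = -ε / v`. -/
lemma measureReal_score_le (hv : v ≠ 0) (hε : 0 ≤ ε) (g : Fin n → ℤˣ) :
    (gaussianVec v (symbols a g)).real {z | score a g z ≤ (1 - ε) * (n * a ^ 2)}
      ≤ Real.exp (-(ε ^ 2 * (n * a ^ 2) / (2 * v))) := by
  have hv' : (0 : ℝ) < v := by exact_mod_cast pos_iff_ne_zero.2 hv
  have h := measure_le_le_exp_mul_mgf (μ := gaussianVec v (symbols a g)) (X := score a g)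
    ((1 - ε) * (n * a ^ 2)) (t := -(ε / v)) (by have := div_nonneg hε hv'.le; linarith)
    (integrable_exp_score _ _ _ _ _)
  rw [mgf_score, ← Real.exp_add, score_symbols_self] at h
  refine h.trans (le_of_eq ?_)
  congr 1; field_simp; ring

lemma measureReal_le_score (hv : v ≠ 0) (hε : 0 ≤ ε) (g : Fin n → ℤˣ) :
    (gaussianVec v (symbols a g)).real {z | (1 + ε) * (n * a ^ 2) ≤ score a g z}
      ≤ Real.exp (-(ε ^ 2 * (n * a ^ 2) / (2 * v))) := by
  have hv' : (0 : ℝ) < v := by exact_mod_cast pos_iff_ne_zero.2 hv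
  have h := measure_ge_le_exp_mul_mgf (μ := gaussianVec v (symbols a g)) (X := score a g)
    ((1 + ε) * (n * a ^ 2)) (t := ε / v) (div_nonneg hε hv'.le)
    (integrable_exp_score _ _ _ _ _)
  rw [mgf_score, ← Real.exp_add, score_symbols_self] at h
  refine h.trans (le_of_eq ?_)
  congr 1; field_simp; ring

/-- The parameter `(1 - ε) / v` is the optimal one for mean zero. The mean `x` enters as a separate
factor, which is `1` for the silent transmitter and can be averaged over random `g`. -/
lemma measureReal_le_score_of_mean (hv : v ≠ 0) (hε : ε ≤ 1) (g : Fin n → ℤˣ) (x : Fin n → ℝ) :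
    (gaussianVec v x).real {z | (1 - ε) * (n * a ^ 2) ≤ score a g z}
      ≤ Real.exp (-((1 - ε) ^ 2 * (n * a ^ 2) / (2 * v))) *
        Real.exp ((1 - ε) / v * score a g x) := by
  have hv' : (0 : ℝ) < v := by exact_mod_cast pos_iff_ne_zero.2 hv
  have h := measure_ge_le_exp_mul_mgf (μ := gaussianVec v x) (X := score a g)
    ((1 - ε) * (n * a ^ 2)) (t := (1 - ε) / v) (div_nonneg (by linarith) hv'.le)
    (integrable_exp_score _ _ _ _ _)
  rw [mgf_score, ← Real.exp_add] at h
  refine h.trans (le_of_eq ?_)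
  rw [← Real.exp_add]
  congr 1; field_simp; ring

lemma expect_prod_signs (F : Fin n → ℤˣ → ℝ) :
    𝔼 g : Fin n → ℤˣ, ∏ i, F i (g i) = ∏ i, 𝔼 u, F i u := by
  simp_rw [Fintype.expect_eq_sum_div_card]
  rw [Finset.prod_div_distrib, Finset.prod_univ_sum, Fintype.piFinset_univ]
  simp

lemma expect_signs (F : ℤˣ → ℝ) : 𝔼 u, F u = (F 1 + F (-1)) / 2 := by
  rw [Fintype.expect_eq_sum_div_card]
  have : (Finset.univ : Finset ℤˣ) = {1, -1} := rfl
  rw [this, Finset.sum_pair (by decide)]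
  simp

/-- The signs are independent, so the average is a product of hyperbolic cosines, and `cosh u ≤ exp
(u ^ 2 / 2)`. -/
lemma expect_exp_score_symbols_le (t : ℝ) (g : Fin n → ℤˣ) :
    𝔼 g', Real.exp (t * score a g' (symbols a g)) ≤ Real.exp (n * (t * a ^ 2) ^ 2 / 2) := by
  have h1 : ∀ g', Real.exp (t * score a g' (symbols a g))
      = ∏ i, Real.exp (t * a ^ 2 * ((g i : ℤ) : ℝ) * ((g' i : ℤ) : ℝ)) := by
    intro g'
    rw [← Real.exp_sum, score, Finset.mul_sum]
    congr 1
    refine Finset.sum_congr rfl fun i _ => ?_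
    simp only [symbols]; ring
  simp_rw [h1]
  rw [expect_prod_signs fun i u => Real.exp (t * a ^ 2 * ((g i : ℤ) : ℝ) * ((u : ℤ) : ℝ))]
  have h2 : ∀ i, 𝔼 u : ℤˣ, Real.exp (t * a ^ 2 * ((g i : ℤ) : ℝ) * ((u : ℤ) : ℝ))
      ≤ Real.exp ((t * a ^ 2) ^ 2 / 2) := by
    intro i
    rw [expect_signs]
    have := Real.cosh_le_exp_half_sq (t * a ^ 2 * ((g i : ℤ) : ℝ))
    rw [Real.cosh_eq, mul_pow _ ((g i : ℤ) : ℝ), sign_sq, mul_one] at this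
    simpa using this
  refine (Finset.prod_le_prod (fun i _ => Finset.expect_nonneg fun u _ => (Real.exp_pos _).le)
    fun i _ => h2 i).trans (le_of_eq ?_)
  rw [Finset.prod_const, ← Real.exp_nat_mul]
  simp; ring

/-- The probability that an independent random codeword is confused with the transmitted one. -/
lemma expect_measureReal_le_score (hv : v ≠ 0) (h0 : 0 ≤ ε) (hε : ε ≤ 1) (g : Fin n → ℤˣ) :
    𝔼 g', (gaussianVec v (symbols a g)).real {z | (1 - ε) * (n * a ^ 2) ≤ score a g' z}
      ≤ Real.exp (-((1 - ε) ^ 2 * (n * a ^ 2) / (2 * v))) *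
        Real.exp ((n * a ^ 2) ^ 2 / (2 * n * v ^ 2)) := by
  have hv' : (0 : ℝ) < v := by exact_mod_cast pos_iff_ne_zero.2 hv
  refine (Finset.expect_le_expect fun g' _ =>
    measureReal_le_score_of_mean hv hε g' (symbols a g)).trans ?_
  rw [← Finset.mul_expect]
  refine mul_le_mul_of_nonneg_left ?_ (Real.exp_pos _).le
  refine (expect_exp_score_symbols_le _ g).trans (Real.exp_le_exp.2 ?_)
  rcases Nat.eq_zero_or_pos n with hn | hn
  · subst hn; simp
  have hn' : (0 : ℝ) < n := by exact_mod_cast hn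
  -- This exponent stays bounded when the energy `n * a ^ 2` is of order `√n`: the random overlap of
  -- two codewords then costs a constant factor only.
  have h1 : (n * a ^ 2) ^ 2 / (2 * n * (v : ℝ) ^ 2) = n * (1 / v * a ^ 2) ^ 2 / 2 := by
    field_simp
  rw [h1]
  have h2 : ((1 - ε) / v * a ^ 2) ^ 2 ≤ (1 / v * a ^ 2) ^ 2 := by
    have : 0 ≤ 1 - ε := by linarith
    gcongr
    linarith
  gcongr

end

/-! ### The threshold decoder -/

open Classical in
/-- The decision for one of the messages whose score passes the threshold, if there are any. -/
noncomputable def decideMessage {M : ℕ} (s : Fin M → Prop) : Fin (M + 1) :=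
  if h : ∃ m, s m then h.choose.succ else 0

/-- The decoder for the code book `x` which compares the scores with the threshold `θ`. -/
noncomputable def thresholdDecoder {n M : ℕ} (a θ : ℝ) (x : Fin M → Fin n → ℤˣ) (z : Fin n → ℝ) :
    Fin (M + 1) := decideMessage fun m => θ ≤ score a (x m) z

lemma measurable_thresholdDecoder {n M : ℕ} (a θ : ℝ) (x : Fin M → Fin n → ℤˣ) :
    Measurable (thresholdDecoder a θ x) := by
  have h : Measurable fun (z : Fin n → ℝ) (m : Fin M) => θ ≤ score a (x m) z :=
    measurable_pi_lambda _ fun m => measurableSet_setOfPred.1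
      (measurableSet_le measurable_const (measurable_score a (x m)))
  -- The arbitrary choice among passing messages is harmless, since it acts on the discrete space
  -- `Fin M → Prop`.
  exact (Measurable.of_discrete (f := decideMessage (M := M))).comp h

lemma thresholdDecoder_ne_succ {n M : ℕ} {a θ : ℝ} {x : Fin M → Fin n → ℤˣ} {z : Fin n → ℝ}
    {m : Fin M} (h : thresholdDecoder a θ x z ≠ m.succ) :
    score a (x m) z ≤ θ ∨ ∃ m', m' ≠ m ∧ θ ≤ score a (x m') z := by
  by_contra hc
  push Not at hc
  apply h
  have hex : ∃ m, θ ≤ score a (x m) z := ⟨m, hc.1.le⟩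
  rw [thresholdDecoder, decideMessage, dif_pos hex]
  congr 1
  by_contra hne
  exact absurd hex.choose_spec (not_le.2 (hc.2 _ hne))

lemma thresholdDecoder_ne_zero {n M : ℕ} {a θ : ℝ} {x : Fin M → Fin n → ℤˣ} {z : Fin n → ℝ}
    (h : thresholdDecoder a θ x z ≠ 0) : ∃ m, θ ≤ score a (x m) z := by
  by_contra hc
  exact h (dif_neg hc)

/-- The error probability of the threshold decoder, for a given code book. -/
noncomputable def codebookError {n M : ℕ} (v : ℝ≥0) (a θ : ℝ) (x : Fin M → Fin n → ℤˣ) : ℝ :=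
  𝔼 m, (gaussianVec v (symbols a (x m))).real {z | thresholdDecoder a θ x z ≠ m.succ}
    + (gaussianVec v 0).real {z | thresholdDecoder a θ x z ≠ 0}

lemma codebookError_nonneg {n M : ℕ} (v : ℝ≥0) (a θ : ℝ) (x : Fin M → Fin n → ℤˣ) :
    0 ≤ codebookError v a θ x :=
  add_nonneg (Finset.expect_nonneg fun _ _ => measureReal_nonneg) measureReal_nonneg

/-- Translating the coordinate `m'` alone shows that `x m'` is uniform and independent of `x m`. -/
lemma expect_independent_pair {ι G : Type*} [Fintype ι] [DecidableEq ι] [Group G] [Fintype G]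
    {m m' : ι} (h : m' ≠ m) (q : G → G → ℝ) :
    𝔼 x : ι → G, q (x m) (x m') = 𝔼 x : ι → G, 𝔼 g, q (x m) g := by
  calc 𝔼 x : ι → G, q (x m) (x m')
      = 𝔼 g, 𝔼 x : ι → G, q (x m) (g * x m') := by
        rw [← Fintype.expect_const (ι := G) (𝔼 x : ι → G, q (x m) (x m'))]
        refine Finset.expect_congr rfl fun g _ => ?_
        rw [← expect_mul_left (Pi.mulSingle m' g) fun x : ι → G => q (x m) (x m')]
        simp [Pi.mulSingle_eq_of_ne h.symm]
    _ = 𝔼 x : ι → G, 𝔼 g, q (x m) g := by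
        rw [Finset.expect_comm]
        simp_rw [expect_mul_right _ (q _)]

/-- Union bound: the sent codeword misses the threshold, another one passes it, or some codeword
passes it on pure noise. The last two events each cost a factor `M`. -/
lemma expect_codebookError_le {n M : ℕ} (hM : 0 < M) {a ε : ℝ} {v : ℝ≥0} (hv : v ≠ 0) (h0 : 0 ≤ ε)
    (hε : ε ≤ 1) :
    𝔼 x : Fin M → Fin n → ℤˣ, codebookError v a ((1 - ε) * (n * a ^ 2)) x
      ≤ Real.exp (-(ε ^ 2 * (n * a ^ 2) / (2 * v)))
        + M * (Real.exp (-((1 - ε) ^ 2 * (n * a ^ 2) / (2 * v))) *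
          (Real.exp ((n * a ^ 2) ^ 2 / (2 * n * v ^ 2)) + 1)) := by
  have : Nonempty (Fin M) := ⟨⟨0, hM⟩⟩
  set θ := (1 - ε) * (n * a ^ 2) with hθ
  set E0 := Real.exp (-(ε ^ 2 * (n * a ^ 2) / (2 * v)))
  set E1 := Real.exp (-((1 - ε) ^ 2 * (n * a ^ 2) / (2 * v)))
  set E2 := Real.exp ((n * a ^ 2) ^ 2 / (2 * n * v ^ 2))
  set q : (Fin n → ℤˣ) → (Fin n → ℤˣ) → ℝ := fun g g' =>
    (gaussianVec v (symbols a g)).real {z | θ ≤ score a g' z} with hq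
  have hE : 0 ≤ E1 * E2 := by positivity
  have h1 : ∀ (x : Fin M → Fin n → ℤˣ) (m : Fin M),
      (gaussianVec v (symbols a (x m))).real {z | thresholdDecoder a θ x z ≠ m.succ}
        ≤ E0 + ∑ m' ∈ Finset.univ.erase m, q (x m) (x m') := by
    intro x m
    calc _ ≤ (gaussianVec v (symbols a (x m))).real ({z | score a (x m) z ≤ θ} ∪
          ⋃ m' ∈ Finset.univ.erase m, {z | θ ≤ score a (x m') z}) := by
          refine measureReal_mono (fun z hz => ?_) (measure_ne_top _ _)
          rcases thresholdDecoder_ne_succ hz with h | ⟨m', h, h'⟩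
          · exact Or.inl h
          · exact Or.inr (Set.mem_iUnion₂.2 ⟨m', by simp [h], h'⟩)
      _ ≤ _ := by
          refine (measureReal_union_le _ _).trans (add_le_add (measureReal_score_le hv h0 _) ?_)
          exact measureReal_biUnion_finset_le _ _
  have h2 : ∀ x : Fin M → Fin n → ℤˣ, (gaussianVec v 0).real {z | thresholdDecoder a θ x z ≠ 0}
      ≤ M * E1 := by
    intro x
    calc _ ≤ (gaussianVec v (0 : Fin n → ℝ)).real
          (⋃ m ∈ (Finset.univ : Finset (Fin M)), {z | θ ≤ score a (x m) z}) := by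
          refine measureReal_mono (fun z hz => ?_) (measure_ne_top _ _)
          obtain ⟨m, h⟩ := thresholdDecoder_ne_zero hz
          exact Set.mem_iUnion₂.2 ⟨m, by simp, h⟩
      _ ≤ ∑ m : Fin M, E1 := by
          refine (measureReal_biUnion_finset_le _ _).trans (Finset.sum_le_sum fun m _ => ?_)
          have := measureReal_le_score_of_mean (a := a) hv hε (x m) 0
          simpa [score] using this
      _ = M * E1 := by simp
  have h3 : ∀ m : Fin M, 𝔼 x : Fin M → Fin n → ℤˣ, (E0 + ∑ m' ∈ Finset.univ.erase m, q (x m) (x m'))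
      ≤ E0 + M * (E1 * E2) := by
    intro m
    rw [Finset.expect_add_distrib, Fintype.expect_const, Finset.expect_sum_comm]
    refine add_le_add le_rfl ?_
    calc ∑ m' ∈ Finset.univ.erase m, 𝔼 x : Fin M → Fin n → ℤˣ, q (x m) (x m')
        ≤ ∑ m' ∈ Finset.univ.erase m, E1 * E2 := by
          refine Finset.sum_le_sum fun m' hm' => ?_
          rw [expect_independent_pair (Finset.ne_of_mem_erase hm') q,
            ← Fintype.expect_const (ι := Fin M → Fin n → ℤˣ) (E1 * E2)]
          exact Finset.expect_le_expect fun x _ => expect_measureReal_le_score hv h0 hε _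
      _ ≤ ∑ m' : Fin M, E1 * E2 :=
          Finset.sum_le_sum_of_subset_of_nonneg (Finset.erase_subset _ _) fun _ _ _ => hE
      _ = M * (E1 * E2) := by simp
  unfold codebookError
  rw [Finset.expect_add_distrib, Finset.expect_comm]
  have h4 : 𝔼 m : Fin M, 𝔼 x : Fin M → Fin n → ℤˣ,
      (gaussianVec v (symbols a (x m))).real {z | thresholdDecoder a θ x z ≠ m.succ}
      ≤ E0 + M * (E1 * E2) := by
    rw [← Fintype.expect_const (ι := Fin M) (E0 + M * (E1 * E2))]
    exact Finset.expect_le_expect fun m _ =>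
      (Finset.expect_le_expect fun x _ => h1 x m).trans (h3 m)
  have h5 : 𝔼 x : Fin M → Fin n → ℤˣ, (gaussianVec v 0).real {z | thresholdDecoder a θ x z ≠ 0}
      ≤ M * E1 := by
    rw [← Fintype.expect_const (ι := Fin M → Fin n → ℤˣ) (M * E1)]
    exact Finset.expect_le_expect fun x _ => h2 x
  linarith

/-! ### Sign flips by the key -/

/-- Componentwise multiplication by a sign vector. -/
noncomputable def flipSigns {n : ℕ} (y : Fin n → ℤˣ) (z : Fin n → ℝ) (i : Fin n) : ℝ :=
  ((y i : ℤ) : ℝ) * z i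

lemma measurable_flipSigns {n : ℕ} (y : Fin n → ℤˣ) : Measurable (flipSigns y) := by
  unfold flipSigns
  exact measurable_pi_lambda _ fun i => by fun_prop

lemma gaussianVec_map_flipSigns {n : ℕ} (v : ℝ≥0) (y : Fin n → ℤˣ) (x : Fin n → ℝ) :
    (gaussianVec v x).map (flipSigns y) = gaussianVec v (flipSigns y x) := by
  have h : flipSigns y = fun z i => (fun (i : Fin n) (t : ℝ) => ((y i : ℤ) : ℝ) * t) i (z i) := rfl
  rw [gaussianVec, h, Measure.pi_map_pi (f := fun (i : Fin n) (t : ℝ) => ((y i : ℤ) : ℝ) * t)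
    (by fun_prop)]
  simp_rw [gaussianReal_map_const_mul]
  rw [gaussianVec]
  congr 1
  ext1 i
  congr 1
  ext
  simp [sign_sq]

/-- Signs are their own inverses, so flipping by the key removes it. The noise law is invariant
under flips, hence the decoding error is the same for every key. -/
lemma flipSigns_symbols {n : ℕ} (a : ℝ) (g y : Fin n → ℤˣ) :
    flipSigns y (symbols a (g * y)) = symbols a g := by
  ext i
  have := sign_sq (y i)
  simp only [flipSigns, symbols, Pi.mul_apply, Units.val_mul, Int.cast_mul]
  linear_combination a * ((g i : ℤ) : ℝ) * this

lemma measureReal_flipSigns {n : ℕ} (v : ℝ≥0) (y : Fin n → ℤˣ) (x : Fin n → ℝ)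
    {B : Set (Fin n → ℝ)} (hB : MeasurableSet B) :
    (gaussianVec v x).real {z | flipSigns y z ∈ B} = (gaussianVec v (flipSigns y x)).real B := by
  rw [← gaussianVec_map_flipSigns, map_measureReal_apply (measurable_flipSigns y) hB]
  rfl

/-! ### Orthogonal sign vectors -/

/-- The Walsh functions on `{-1, 1}^k` that are indexed by the subsets `I i`. -/
def walsh {n k : ℕ} (I : Fin n → Finset (Fin k)) (u : Fin k → ℤˣ) (i : Fin n) : ℤˣ :=
  ∏ e ∈ I i, u e

lemma walsh_mulSingle_mul {n k : ℕ} (I : Fin n → Finset (Fin k)) (u : Fin k → ℤˣ) (i : Fin n)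
    (e : Fin k) : walsh I (Pi.mulSingle e (-1) * u) i
      = (if e ∈ I i then -1 else 1) * walsh I u i := by
  simp only [walsh, Pi.mul_apply, Finset.prod_mul_distrib]
  rw [Finset.prod_pi_mulSingle']

lemma sum_mul_left {G : Type*} [Group G] [Fintype G] (t : G) (f : G → ℝ) :
    ∑ g, f (t * g) = ∑ g, f g :=
  Fintype.sum_equiv (Equiv.mulLeft t) _ _ fun _ => rfl

/-- Flipping a coordinate in exactly one of the two index sets negates each product and permutes the
summation range, so the sum equals its own negative. -/
lemma sum_walsh_mul_walsh {n k : ℕ} {I : Fin n → Finset (Fin k)} (hI : Function.Injective I)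
    {i j : Fin n} (hij : i ≠ j) :
    ∑ u, ((walsh I u i : ℤ) : ℝ) * ((walsh I u j : ℤ) : ℝ) = 0 := by
  have hne : I i ≠ I j := fun h => hij (hI h)
  obtain ⟨e, he⟩ : ∃ e, ¬ (e ∈ I i ↔ e ∈ I j) := by
    by_contra hc
    push Not at hc
    exact hne (Finset.ext hc)
  have h := sum_mul_left (Pi.mulSingle e (-1) : Fin k → ℤˣ)
    fun u => ((walsh I u i : ℤ) : ℝ) * ((walsh I u j : ℤ) : ℝ)
  have h2 : ∀ u, ((walsh I (Pi.mulSingle e (-1) * u) i : ℤ) : ℝ) *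
      ((walsh I (Pi.mulSingle e (-1) * u) j : ℤ) : ℝ)
      = -(((walsh I u i : ℤ) : ℝ) * ((walsh I u j : ℤ) : ℝ)) := by
    intro u
    rw [walsh_mulSingle_mul, walsh_mulSingle_mul]
    by_cases h1 : e ∈ I i
    · have h3 : e ∉ I j := fun h3 => he ⟨fun _ => h3, fun _ => h1⟩
      simp [h1, h3]
    · have h3 : e ∈ I j := by
        by_contra h3
        exact he ⟨fun h => absurd h h1, fun h => absurd h h3⟩
      simp [h1, h3]
  simp_rw [h2, Finset.sum_neg_distrib] at h
  linarith

/-! ### Resolvability -/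

/-- The likelihood ratio of independent uniform symbols. -/
noncomputable def uniformLikelihood {n : ℕ} (v : ℝ≥0) (a : ℝ) (z : Fin n → ℝ) : ℝ :=
  𝔼 g : Fin n → ℤˣ, likelihood v (symbols a g) z

lemma integrable_uniformLikelihood {n : ℕ} (v : ℝ≥0) (a : ℝ) (y : Fin n → ℝ) :
    Integrable (uniformLikelihood v a) (gaussianVec v y) :=
  integrable_expect fun _ => integrable_likelihood _ _ _

lemma likelihood_symbols {n : ℕ} (v : ℝ≥0) (a : ℝ) (g : Fin n → ℤˣ) (z : Fin n → ℝ) :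
    likelihood v (symbols a g) z = Real.exp ((score a g z - n * a ^ 2 / 2) / v) := by
  rw [likelihood, sum_symbols_sq, score]

/-- Soft covering: `expect_abs_sub_le` is applied at each `z` and integrated. The fixed factor `h₀`,
later a Walsh pattern, keeps the products uniform and pairwise independent. -/
lemma expect_integral_abs_sub_le {n M K : ℕ} (hM : 0 < M) (hK : 0 < K) {a ε d : ℝ} {v : ℝ≥0}
    (hv : v ≠ 0) (hε : 0 ≤ ε) (hd : 0 < d)
    (hMK : Real.exp ((1 + 2 * ε) * (n * a ^ 2) / (2 * v)) ≤ d ^ 2 * (M * K)) (h₀ : Fin n → ℤˣ) :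
    𝔼 p : (Fin M → Fin n → ℤˣ) × (Fin K → Fin n → ℤˣ),
      ∫ z, |𝔼 j : Fin M × Fin K, likelihood v (symbols a (p.1 j.1 * p.2 j.2 * h₀)) z
        - uniformLikelihood v a z| ∂(gaussianVec v 0)
      ≤ d + 2 * Real.exp (-(ε ^ 2 * (n * a ^ 2) / (2 * v))) := by
  have : Nonempty (Fin M) := ⟨⟨0, hM⟩⟩
  have : Nonempty (Fin K) := ⟨⟨0, hK⟩⟩
  have hv' : (0 : ℝ) < v := by exact_mod_cast pos_iff_ne_zero.2 hv
  set τ := Real.exp ((1 + 2 * ε) * (n * a ^ 2) / (2 * v)) with hτ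
  have hint : ∀ p : (Fin M → Fin n → ℤˣ) × (Fin K → Fin n → ℤˣ), Integrable (fun z =>
      |𝔼 j : Fin M × Fin K, likelihood v (symbols a (p.1 j.1 * p.2 j.2 * h₀)) z
        - uniformLikelihood v a z|) (gaussianVec v 0) := fun p =>
    ((integrable_expect fun _ => integrable_likelihood _ _ _).sub
      (integrable_uniformLikelihood _ _ _)).abs
  rw [← integral_expect hint]
  have hτm : ∀ g : Fin n → ℤˣ, MeasurableSet {z | τ < likelihood v (symbols a g) z} := fun g =>
    measurableSet_lt measurable_const (measurable_likelihood _ _)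
  have hri : ∀ g : Fin n → ℤˣ, Integrable (fun z => if τ < likelihood v (symbols a g) z then
      likelihood v (symbols a g) z else 0) (gaussianVec v 0) := fun g => by
    have := (integrable_likelihood v (symbols a g) 0).indicator (hτm g)
    refine this.congr (ae_of_all _ fun z => ?_)
    simp [Set.indicator_apply]
  have hpt : ∀ z, 𝔼 p : (Fin M → Fin n → ℤˣ) × (Fin K → Fin n → ℤˣ),
      |𝔼 j : Fin M × Fin K, likelihood v (symbols a (p.1 j.1 * p.2 j.2 * h₀)) z
        - uniformLikelihood v a z|
      ≤ d / 2 * (1 + uniformLikelihood v a z) + 2 * 𝔼 g : Fin n → ℤˣ,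
        (if τ < likelihood v (symbols a g) z then likelihood v (symbols a g) z else 0) := by
    intro z
    refine expect_abs_sub_le (H := (Fin M → Fin n → ℤˣ) × (Fin K → Fin n → ℤˣ))
      (ι := Fin M × Fin K) (fun p j => p.1 j.1 * p.2 j.2 * h₀) ?_ ?_
      (fun g => likelihood v (symbols a g) z) (fun g => (likelihood_pos _ _ _).le) hd ?_
    · rintro ⟨m, s⟩
      refine ⟨fun g => (Pi.mulSingle m g, 1), fun g h => ?_⟩
      simp [mul_assoc]
    · rintro ⟨m, s⟩ ⟨m', s'⟩ hne
      -- If the messages differ, translating `x m` moves the first product only; otherwise the keys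
      -- differ and translating `y s` does.
      by_cases hm : m = m'
      · subst hm
        have hs : s' ≠ s := fun h => hne (by rw [h])
        refine ⟨fun g => (1, Pi.mulSingle s g), fun g h => ⟨?_, ?_⟩⟩
        · simp only [Prod.fst_mul, Prod.snd_mul, Pi.mul_apply, Pi.mulSingle_eq_same]
          simp only [Pi.one_apply, one_mul]
          rw [mul_left_comm, mul_assoc g]
        · simp [Pi.mulSingle_eq_of_ne hs]
      · refine ⟨fun g => (Pi.mulSingle m g, 1), fun g h => ⟨by simp [mul_assoc], ?_⟩⟩
        simp [Pi.mulSingle_eq_of_ne (Ne.symm hm)]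
    · simpa [Fintype.card_prod] using hMK
  have hi0 : Integrable (fun z => d / 2 * (1 + uniformLikelihood v a z))
      (gaussianVec v (0 : Fin n → ℝ)) :=
    ((integrable_const 1).add (integrable_uniformLikelihood _ _ _)).const_mul _
  have hi1 : Integrable (fun z => 2 * 𝔼 g : Fin n → ℤˣ, (if τ < likelihood v (symbols a g) z then
      likelihood v (symbols a g) z else 0)) (gaussianVec v (0 : Fin n → ℝ)) :=
    (integrable_expect hri).const_mul 2
  refine (integral_mono (integrable_expect hint) (hi0.add hi1) hpt).trans ?_
  simp only [Pi.add_apply]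
  rw [integral_add hi0 hi1, integral_const_mul, integral_const_mul,
    integral_add (integrable_const 1) (integrable_uniformLikelihood _ _ _), integral_expect hri]
  have e1 : ∫ z, uniformLikelihood v a z ∂(gaussianVec v (0 : Fin n → ℝ)) = 1 := by
    unfold uniformLikelihood
    rw [integral_expect fun _ => integrable_likelihood _ _ _]
    simp_rw [integral_likelihood hv]
    rw [Fintype.expect_const]
  have e2 : ∀ g : Fin n → ℤˣ, ∫ z, (if τ < likelihood v (symbols a g) z then
      likelihood v (symbols a g) z else 0) ∂(gaussianVec v 0)
      ≤ Real.exp (-(ε ^ 2 * (n * a ^ 2) / (2 * v))) := by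
    intro g
    -- Change of measure: the truncated tail under noise is the probability, under the codeword
    -- itself, that its likelihood ratio exceeds `τ`. By the choice of `τ` this forces the score
    -- above `(1 + ε) * n * a ^ 2`.
    have h1 : ∫ z, (if τ < likelihood v (symbols a g) z then
      likelihood v (symbols a g) z else 0) ∂(gaussianVec v 0)
      = (gaussianVec v (symbols a g)).real {z | τ < likelihood v (symbols a g) z} := by
      rw [gaussianVec_real_eq hv _ (hτm g), ← integral_indicator (hτm g)]
      refine integral_congr_ae (ae_of_all _ fun z => ?_)
      simp [Set.indicator_apply]
    rw [h1]
    refine le_trans (measureReal_mono fun z hz => ?_) (measureReal_le_score hv hε g)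
    have hz' : τ < likelihood v (symbols a g) z := hz
    rw [likelihood_symbols, hτ, Real.exp_lt_exp, div_lt_div_iff₀ (by positivity) hv'] at hz'
    have h2 : ((1 + 2 * ε) * (n * a ^ 2)) * v < ((score a g z - n * a ^ 2 / 2) * 2) * v := by
      linarith
    have h3 := lt_of_mul_lt_mul_right h2 hv'.le
    change (1 + ε) * (n * a ^ 2) ≤ score a g z
    linarith
  have e3 : 𝔼 g : Fin n → ℤˣ, ∫ z, (if τ < likelihood v (symbols a g) z then
      likelihood v (symbols a g) z else 0) ∂(gaussianVec v 0)
      ≤ Real.exp (-(ε ^ 2 * (n * a ^ 2) / (2 * v))) := by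
    rw [← Fintype.expect_const (ι := Fin n → ℤˣ) (Real.exp (-(ε ^ 2 * (n * a ^ 2) / (2 * v))))]
    exact Finset.expect_le_expect fun g _ => e2 g
  rw [e1, integral_const]
  simp only [probReal_univ, smul_eq_mul, mul_one]
  linarith

/-- Existence of a code book `x` and of keys `y` which are reliable, resolvable, and white. -/
theorem exists_codebook {n M K k : ℕ} (hM : 0 < M) (hK : 0 < K) {I : Fin n → Finset (Fin k)}
    (hI : Function.Injective I) {a ε d : ℝ} {vb vw : ℝ≥0} (hvb : vb ≠ 0) (hvw : vw ≠ 0)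
    (h0 : 0 ≤ ε) (hε : ε ≤ 1) (hd : 0 < d)
    (hMK : Real.exp ((1 + 2 * ε) * (n * a ^ 2) / (2 * vw)) ≤ d ^ 2 * (M * K)) :
    ∃ (x : Fin M → Fin n → ℤˣ) (y : Fin K × (Fin k → ℤˣ) → Fin n → ℤˣ),
      (∀ i j, i ≠ j → ∑ s, ((y s i : ℤ) : ℝ) * ((y s j : ℤ) : ℝ) = 0) ∧
      codebookError vb a ((1 - ε) * (n * a ^ 2)) x +
      ∫ z, |𝔼 j : Fin M × Fin K × (Fin k → ℤˣ), likelihood vw (symbols a (x j.1 * y j.2)) z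
        - uniformLikelihood vw a z| ∂(gaussianVec vw 0)
      ≤ Real.exp (-(ε ^ 2 * (n * a ^ 2) / (2 * vb)))
        + M * (Real.exp (-((1 - ε) ^ 2 * (n * a ^ 2) / (2 * vb))) *
          (Real.exp ((n * a ^ 2) ^ 2 / (2 * n * vb ^ 2)) + 1))
        + (d + 2 * Real.exp (-(ε ^ 2 * (n * a ^ 2) / (2 * vw)))) := by
  have : Nonempty (Fin M) := ⟨⟨0, hM⟩⟩
  have : Nonempty (Fin K) := ⟨⟨0, hK⟩⟩
  -- Reliability and resolvability are added into one risk, so that a single draw below the mean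
  -- meets both. Only `x` and `y` are random; the Walsh patterns `u` are all used.
  let R : (Fin M → Fin n → ℤˣ) × (Fin K → Fin n → ℤˣ) → ℝ := fun p =>
    codebookError vb a ((1 - ε) * (n * a ^ 2)) p.1 + 𝔼 u : Fin k → ℤˣ,
      ∫ z, |𝔼 j : Fin M × Fin K, likelihood vw (symbols a (p.1 j.1 * p.2 j.2 * walsh I u)) z
        - uniformLikelihood vw a z| ∂(gaussianVec vw 0)
  have hR : 𝔼 p, R p ≤ Real.exp (-(ε ^ 2 * (n * a ^ 2) / (2 * vb)))
        + M * (Real.exp (-((1 - ε) ^ 2 * (n * a ^ 2) / (2 * vb))) *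
          (Real.exp ((n * a ^ 2) ^ 2 / (2 * n * vb ^ 2)) + 1))
        + (d + 2 * Real.exp (-(ε ^ 2 * (n * a ^ 2) / (2 * vw)))) := by
    simp only [R]
    rw [Finset.expect_add_distrib]
    refine add_le_add ?_ ?_
    · rw [← Finset.univ_product_univ, Finset.expect_product' Finset.univ Finset.univ
        (fun (x : Fin M → Fin n → ℤˣ) (_ : Fin K → Fin n → ℤˣ) =>
          codebookError vb a ((1 - ε) * (n * a ^ 2)) x)]
      simp_rw [Fintype.expect_const]
      exact expect_codebookError_le hM hvb h0 hε
    · rw [Finset.expect_comm, ← Fintype.expect_const (ι := Fin k → ℤˣ)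
        (d + 2 * Real.exp (-(ε ^ 2 * (n * a ^ 2) / (2 * vw))))]
      exact Finset.expect_le_expect fun u _ => expect_integral_abs_sub_le hM hK hvw h0 hd hMK _
  obtain ⟨⟨x, y⟩, -, hxy⟩ := Finset.exists_le_of_expect_le Finset.univ_nonempty hR
  refine ⟨x, fun s => y s.1 * walsh I s.2, fun i j hij => ?_, le_trans ?_ hxy⟩
  · rw [Fintype.sum_prod_type]
    refine Finset.sum_eq_zero fun s _ => ?_
    have h := sum_walsh_mul_walsh hI hij
    have h2 : ∀ u, (((y s * walsh I u) i : ℤ) : ℝ) * (((y s * walsh I u) j : ℤ) : ℝ)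
        = ((y s i : ℤ) : ℝ) * ((y s j : ℤ) : ℝ) *
          (((walsh I u i : ℤ) : ℝ) * ((walsh I u j : ℤ) : ℝ)) := fun u => by
      simp only [Pi.mul_apply, Units.val_mul, Int.cast_mul]; ring
    simp only [h2]
    rw [← Finset.mul_sum, h, mul_zero]
  · simp only [R]
    refine add_le_add le_rfl ?_
    have hi : ∀ u : Fin k → ℤˣ, Integrable (fun z => |𝔼 j : Fin M × Fin K,
        likelihood vw (symbols a (x j.1 * y j.2 * walsh I u)) z - uniformLikelihood vw a z|)
        (gaussianVec vw 0) := fun u =>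
      ((integrable_expect fun _ => integrable_likelihood _ _ _).sub
        (integrable_uniformLikelihood _ _ _)).abs
    rw [← integral_expect hi]
    refine integral_mono ((integrable_expect fun _ => integrable_likelihood _ _ _).sub
        (integrable_uniformLikelihood _ _ _)).abs (integrable_expect hi) fun z => ?_
    have e : 𝔼 j : Fin M × Fin K × (Fin k → ℤˣ),
        likelihood vw (symbols a (x j.1 * (y j.2.1 * walsh I j.2.2))) z
        = 𝔼 u : Fin k → ℤˣ, 𝔼 j : Fin M × Fin K,
          likelihood vw (symbols a (x j.1 * y j.2 * walsh I u)) z := by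
      simp_rw [← Finset.univ_product_univ, Finset.expect_product]
      rw [Finset.expect_comm]
      rw [Finset.expect_comm (Finset.univ : Finset (Fin k → ℤˣ))]
      simp_rw [mul_assoc]
      rw [Finset.expect_comm]
      refine Finset.expect_congr rfl fun m _ => ?_
      rw [Finset.expect_comm]
    simp only
    rw [e, ← Fintype.expect_const (ι := Fin k → ℤˣ) (uniformLikelihood vw a z),
      ← Finset.expect_sub_distrib]
    rw [Fintype.expect_const]
    -- Mixing over all `u` can only reduce the distance, by the triangle inequality.
    exact Finset.abs_expect_le _ _

/-! ### Taylor bounds for `log cosh` -/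

lemma nonneg_of_hasDerivAt {f f' : ℝ → ℝ} (hf : ∀ x, HasDerivAt f (f' x) x) (h0 : f 0 = 0)
    (h : ∀ x, 0 ≤ x → 0 ≤ f' x) {x : ℝ} (hx : 0 ≤ x) : 0 ≤ f x := by
  have hm : MonotoneOn f (Set.Ici 0) := by
    refine monotoneOn_of_deriv_nonneg (convex_Ici 0)
      (fun y _ => (hf y).continuousAt.continuousWithinAt)
      (fun y _ => (hf y).differentiableAt.differentiableWithinAt) fun y hy => ?_
    rw [interior_Ici] at hy
    rw [(hf y).deriv]
    exact h y (Set.mem_Ioi.1 hy).le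
  rw [← h0]
  exact hm Set.self_mem_Ici hx hx

lemma hasDerivAt_log_cosh (x : ℝ) :
    HasDerivAt (fun x => Real.log (Real.cosh x)) (Real.tanh x) x := by
  rw [Real.tanh_eq_sinh_div_cosh]
  exact (Real.hasDerivAt_cosh x).log (Real.cosh_pos x).ne'

lemma hasDerivAt_tanh (x : ℝ) : HasDerivAt Real.tanh (1 - Real.tanh x ^ 2) x := by
  have h : Real.tanh = fun x => Real.sinh x / Real.cosh x :=
    funext Real.tanh_eq_sinh_div_cosh
  have hc := (Real.cosh_pos x).ne'
  rw [h]
  refine ((Real.hasDerivAt_sinh x).div (Real.hasDerivAt_cosh x) hc).congr_deriv ?_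
  field_simp

/-- Bootstrapping with `tanh' = 1 - tanh ^ 2`: each bound on `tanh` gives the next one by
integration. -/
lemma tanh_bounds {x : ℝ} (hx : 0 ≤ x) : 0 ≤ Real.tanh x ∧ Real.tanh x ≤ x ∧
    x - x ^ 3 / 3 ≤ Real.tanh x ∧ Real.tanh x ≤ x - x ^ 3 / 3 + 2 * x ^ 5 / 15 := by
  have h0 : ∀ x : ℝ, 0 ≤ x → 0 ≤ Real.tanh x := fun x hx =>
    nonneg_of_hasDerivAt hasDerivAt_tanh Real.tanh_zero (fun y _ => by
      have h1 := Real.cosh_sq y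
      have h2 := Real.cosh_pos y
      rw [Real.tanh_eq_sinh_div_cosh, div_pow, sub_nonneg, div_le_one (by positivity)]
      linarith) hx
  have h1 : ∀ x : ℝ, 0 ≤ x → Real.tanh x ≤ x := fun x hx => by
    have := nonneg_of_hasDerivAt (f := fun x => x - Real.tanh x)
      (fun y => (hasDerivAt_id y).sub (hasDerivAt_tanh y)) (by simp)
      (fun y _ => by nlinarith [sq_nonneg (Real.tanh y)]) hx
    simpa using this
  have h2 : ∀ x : ℝ, 0 ≤ x → x - x ^ 3 / 3 ≤ Real.tanh x := fun x hx => by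
    have := nonneg_of_hasDerivAt (f := fun x => Real.tanh x - (x - x ^ 3 / 3))
      (fun y => (hasDerivAt_tanh y).sub ((hasDerivAt_id y).sub ((hasDerivAt_pow 3 y).div_const 3)))
      (by simp) (fun y hy => by
        have a := h0 y hy
        have b := h1 y hy
        norm_num
        nlinarith) hx
    simpa using this
  refine ⟨h0 x hx, h1 x hx, h2 x hx, ?_⟩
  have := nonneg_of_hasDerivAt (f := fun x => (x - x ^ 3 / 3 + 2 * x ^ 5 / 15) - Real.tanh x)
      (fun y => (((hasDerivAt_id y).sub ((hasDerivAt_pow 3 y).div_const 3)).add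
        (((hasDerivAt_pow 5 y).const_mul 2).div_const 15)).sub (hasDerivAt_tanh y))
      (by simp) (fun y hy => by
        have a := h0 y hy
        have b := h2 y hy
        -- The lower bound for `tanh` can be squared only where it is nonnegative; elsewhere the
        -- left side here is already nonpositive.
        have c : y ^ 2 - 2 * y ^ 4 / 3 ≤ Real.tanh y ^ 2 := by
          rcases le_total 0 (y - y ^ 3 / 3) with h | h
          · nlinarith [sq_nonneg (y ^ 3), mul_self_le_mul_self h b]
          · have h3 : y * (1 - y ^ 2 / 3) ≤ 0 := by linarith
            have h4 : y ^ 2 - 2 * y ^ 4 / 3 ≤ 0 := by nlinarith [sq_nonneg y, sq_nonneg (y ^ 2)]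
            exact h4.trans (sq_nonneg _)
        norm_num
        nlinarith) hx
  simpa using this

/-- Integration of the bounds on `tanh`, with `1 / 45 = (2 / 15) / 6`. A sixth-order remainder
suffices: over `n` terms of size `n ^ (-1/4)` it sums to order `n ^ (-1/2)`. -/
lemma abs_log_cosh_sub_le (x : ℝ) :
    |Real.log (Real.cosh x) - (x ^ 2 / 2 - x ^ 4 / 12)| ≤ x ^ 6 / 45 := by
  wlog hx : 0 ≤ x
  · have := this (-x) (by linarith)
    rw [Real.cosh_neg] at this
    convert this using 2 <;> ring
  have h1 := nonneg_of_hasDerivAt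
    (f := fun x => Real.log (Real.cosh x) - (x ^ 2 / 2 - x ^ 4 / 12))
    (fun y => (hasDerivAt_log_cosh y).sub
      (((hasDerivAt_pow 2 y).div_const 2).sub ((hasDerivAt_pow 4 y).div_const 12)))
    (by simp) (fun y hy => by
      have := (tanh_bounds hy).2.2.1
      norm_num
      linarith) hx
  have h2 := nonneg_of_hasDerivAt
    (f := fun x => (x ^ 2 / 2 - x ^ 4 / 12) + x ^ 6 / 45 - Real.log (Real.cosh x))
    (fun y => ((((hasDerivAt_pow 2 y).div_const 2).sub ((hasDerivAt_pow 4 y).div_const 12)).add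
      ((hasDerivAt_pow 6 y).div_const 45)).sub (hasDerivAt_log_cosh y))
    (by simp) (fun y hy => by
      have := (tanh_bounds hy).2.2.2
      norm_num
      linarith) hx
  rw [abs_le]
  constructor <;> linarith [pow_nonneg hx 6]

/-! ### Moments of the standard normal distribution -/

lemma integrable_pow_gaussianReal (p : ℕ) : Integrable (fun x => x ^ p) (gaussianReal 0 1) := by
  have := memLp_id_gaussianReal (μ := 0) (v := 1) p
  rcases Nat.eq_zero_or_pos p with rfl | hp
  · simp
  · exact (this.integrable_norm_pow hp.ne').mono (by fun_prop) (ae_of_all _ fun x => by simp)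

lemma integral_sq_gaussianReal : ∫ x, x ^ 2 ∂(gaussianReal 0 1) = 1 := by
  have h := variance_fun_id_gaussianReal (μ := 0) (v := 1)
  rw [variance_eq_integral (by fun_prop), integral_id_gaussianReal] at h
  simpa using h

/-- The fourth derivative at zero of the moment generating function `exp (t ^ 2 / 2)`. -/
lemma integral_pow_four_gaussianReal : ∫ x, x ^ 4 ∂(gaussianReal 0 1) = 3 := by
  have h := iteratedDeriv_mgf_zero (X := fun x : ℝ => x) (μ := gaussianReal 0 1)
    (by rw [integrableExpSet_fun_id_gaussianReal]; simp) 4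
  rw [mgf_fun_id_gaussianReal] at h
  have e : ∀ t : ℝ, HasDerivAt (fun t : ℝ => Real.exp (0 * t + (1 : ℝ≥0) * t ^ 2 / 2))
      (t * Real.exp (0 * t + (1 : ℝ≥0) * t ^ 2 / 2)) t := fun t => by
    have h1 : HasDerivAt (fun t : ℝ => 0 * t + (1 : ℝ≥0) * t ^ 2 / 2) t t := by
      refine (((hasDerivAt_id t).const_mul 0).add
        (((hasDerivAt_pow 2 t).const_mul _).div_const 2)).congr_deriv ?_
      norm_num
    refine h1.exp.congr_deriv ?_
    ring
  set E := fun t : ℝ => Real.exp (0 * t + (1 : ℝ≥0) * t ^ 2 / 2) with hE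
  replace e : ∀ t, HasDerivAt E (t * E t) t := e
  have d1 : deriv E = fun t => t * E t := funext fun t => (e t).deriv
  have d2 : deriv (fun t => t * E t) = fun t => (1 + t ^ 2) * E t := funext fun t => by
    refine (HasDerivAt.congr_deriv (f := fun t => t * E t) ((hasDerivAt_id' t).mul (e t)) ?_).deriv
    ring
  have d3 : deriv (fun t => (1 + t ^ 2) * E t) = fun t => (3 * t + t ^ 3) * E t := funext fun t => by
    refine (HasDerivAt.congr_deriv (f := fun t => (1 + t ^ 2) * E t)
      (((hasDerivAt_pow 2 t).const_add 1).mul (e t)) ?_).deriv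
    norm_num; ring
  have d4 : deriv (fun t => (3 * t + t ^ 3) * E t) = fun t => (3 + 6 * t ^ 2 + t ^ 4) * E t :=
    funext fun t => by
      refine (HasDerivAt.congr_deriv (f := fun t => (3 * t + t ^ 3) * E t)
        ((((hasDerivAt_id' t).const_mul 3).add (hasDerivAt_pow 3 t)).mul (e t)) ?_).deriv
      norm_num; ring
  rw [iteratedDeriv_succ, iteratedDeriv_succ, iteratedDeriv_succ, iteratedDeriv_one, d1, d2, d3,
    d4] at h
  simp only [Pi.pow_apply] at h
  rw [← h]
  simp [hE]

lemma variance_sq_gaussianReal : Var[fun x => x ^ 2; gaussianReal 0 1] = 2 := by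
  rw [variance_eq_sub (by
    have := integrable_pow_gaussianReal 4
    refine (memLp_two_iff_integrable_sq (by fun_prop)).2 (this.congr (ae_of_all _ fun x => ?_))
    simp only; ring)]
  have : (fun x : ℝ => x ^ 2) ^ 2 = fun x => x ^ 4 := by ext x; simp; ring
  rw [this, integral_sq_gaussianReal, integral_pow_four_gaussianReal]; norm_num

/-! ### The Gaussian tail -/

lemma gaussianTail_eq (x : ℝ) : gaussianTail x = (gaussianReal 0 1).real (Set.Ioi x) := by
  rw [measureReal_def, gaussianReal_apply_eq_integral 0 one_ne_zero, ENNReal.toReal_ofReal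
    (integral_nonneg fun _ => gaussianPDFReal_nonneg _ _ _), gaussianTail, ← integral_const_mul]
  simp [gaussianPDFReal]

lemma gaussianReal_neg_set (s : Set ℝ) (hs : MeasurableSet s) :
    (gaussianReal 0 1).real (-s) = (gaussianReal 0 1).real s := by
  have h := gaussianReal_map_neg (μ := 0) (v := 1)
  rw [neg_zero] at h
  conv_rhs => rw [← h, map_measureReal_apply (by fun_prop) hs]
  rfl

lemma gaussianTail_zero : gaussianTail 0 = 1 / 2 := by
  have h1 := gaussianReal_neg_set (Set.Ioi 0) measurableSet_Ioi
  have h2 := probReal_compl_eq_one_sub (μ := gaussianReal 0 1) (s := Set.Ioi 0) measurableSet_Ioi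
  have := nullSingletonClass_gaussianReal (μ := 0) (v := 1) one_ne_zero
  have h3 : (gaussianReal 0 1).real (Set.Ioi 0)ᶜ = (gaussianReal 0 1).real (-Set.Ioi 0) := by
    rw [Set.compl_Ioi, Set.neg_Ioi, neg_zero]
    exact measureReal_congr Iio_ae_eq_Iic.symm
  rw [gaussianTail_eq]
  linarith

lemma continuous_gaussianTail : Continuous gaussianTail := by
  have hi : Integrable fun u : ℝ => Real.exp (-u ^ 2 / 2) := by
    have := integrable_exp_neg_mul_sq (b := 1 / 2) (by norm_num)
    refine this.congr (ae_of_all _ fun u => ?_)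
    simp only; congr 1; ring
  have h : ∀ x, gaussianTail x = 1 / √(2 * Real.pi) *
      ((∫ u in Set.Ioi (0 : ℝ), Real.exp (-u ^ 2 / 2)) - ∫ u in (0 : ℝ)..x, Real.exp (-u ^ 2 / 2)) := by
    intro x
    rw [gaussianTail, ← intervalIntegral.integral_Ioi_sub_Ioi' hi.integrableOn hi.integrableOn]
    simp
  rw [funext h]
  exact continuous_const.mul (continuous_const.sub
    (intervalIntegral.continuous_primitive (fun _ _ => hi.intervalIntegrable) 0))

lemma tendsto_gaussianTail : Tendsto gaussianTail atTop (𝓝 0) := by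
  have h := tendsto_measure_iInter_atTop (μ := gaussianReal 0 1) (s := fun x : ℝ => Set.Ioi x)
    (fun x => measurableSet_Ioi.nullMeasurableSet) (fun x y h => Set.Ioi_subset_Ioi h)
    ⟨0, measure_ne_top _ _⟩
  have h2 : ⋂ x : ℝ, Set.Ioi x = ∅ := by
    ext y; simp only [Set.mem_iInter, Set.mem_Ioi, Set.mem_empty_iff_false, iff_false, not_forall]
    exact ⟨y, lt_irrefl y⟩
  rw [h2, measure_empty] at h
  rw [funext gaussianTail_eq]
  exact (ENNReal.tendsto_toReal ENNReal.zero_ne_top).comp h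

/-- `Function.invFun` inverts at every attained value, and `p` is attained by the intermediate value
theorem between `Q 0 = 1 / 2` and the limit `0`. -/
lemma gaussianTail_gaussianTailInv {p : ℝ} (hp : 0 < p) (hp' : p < 1 / 2) :
    gaussianTail (gaussianTailInv p) = p := by
  refine Function.invFun_eq ?_
  obtain ⟨b, hb⟩ := (tendsto_gaussianTail.eventually_lt_const hp).exists
  have := mem_range_of_exists_le_of_exists_ge continuous_gaussianTail ⟨b, hb.le⟩
    ⟨0, gaussianTail_zero ▸ hp'.le⟩
  exact this

lemma gaussianTailInv_pos {p : ℝ} (hp : 0 < p) (hp' : p < 1 / 2) : 0 < gaussianTailInv p := by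
  by_contra h
  have h1 : gaussianTail 0 ≤ gaussianTail (gaussianTailInv p) := by
    rw [gaussianTail_eq, gaussianTail_eq]
    exact measureReal_mono (Set.Ioi_subset_Ioi (not_lt.1 h)) (measure_ne_top _ _)
  rw [gaussianTail_zero, gaussianTail_gaussianTailInv hp hp'] at h1
  linarith

lemma gaussianReal_real_eq (d : ℝ) {s : Set ℝ} (hs : MeasurableSet s) :
    (gaussianReal d 1).real s = ∫ g in s, Real.exp (d * g - d ^ 2 / 2) ∂(gaussianReal 0 1) := by
  have hi := integrable_likelihood_factor (v := 1) d 0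
  simp only [NNReal.coe_one, div_one] at hi
  rw [measureReal_def, gaussianReal_eq_withDensity one_ne_zero, withDensity_apply _ hs]
  simp only [NNReal.coe_one, div_one]
  rw [← ofReal_integral_eq_lintegral_ofReal hi.integrableOn
      (ae_of_all _ fun z => (Real.exp_pos _).le), ENNReal.toReal_ofReal]
  exact integral_nonneg fun z => (Real.exp_pos _).le

/-- The minimum switches at `g = d / 2`. Above it there is a tail of the standard law; below it the
exponential tilts to mean `d`, and reflection gives the same tail. -/
lemma integral_min_one_exp_gaussianReal {d : ℝ} (hd : 0 < d) :
    ∫ g, min 1 (Real.exp (d * g - d ^ 2 / 2)) ∂(gaussianReal 0 1) = 2 * gaussianTail (d / 2) := by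
  have hi := integrable_likelihood_factor (v := 1) d 0
  simp only [NNReal.coe_one, div_one] at hi
  have h1 : ∀ g, min 1 (Real.exp (d * g - d ^ 2 / 2)) = (Set.Ioi (d / 2)).indicator (fun _ => 1) g
      + (Set.Iic (d / 2)).indicator (fun g => Real.exp (d * g - d ^ 2 / 2)) g := by
    intro g
    rcases lt_or_ge (d / 2) g with h | h
    · rw [Set.indicator_of_mem (Set.mem_Ioi.2 h), Set.indicator_of_notMem (by simpa using h),
        min_eq_left (Real.one_le_exp (by nlinarith)), add_zero]
    · rw [Set.indicator_of_notMem (by simpa using h), Set.indicator_of_mem (Set.mem_Iic.2 h),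
        min_eq_right (Real.exp_le_one_iff.2 (by nlinarith)), zero_add]
  have h2 : (gaussianReal d 1).real (Set.Iic (d / 2)) = gaussianTail (d / 2) := by
    have h3 := gaussianReal_map_add_const (μ := 0) (v := 1) d
    rw [zero_add] at h3
    have := nullSingletonClass_gaussianReal (μ := 0) (v := 1) one_ne_zero
    rw [← h3, map_measureReal_apply (by fun_prop) measurableSet_Iic, gaussianTail_eq,
      ← gaussianReal_neg_set _ measurableSet_Ioi, Set.neg_Ioi, measureReal_congr Iio_ae_eq_Iic]
    congr 1
    ext x
    simp only [Set.mem_preimage, Set.mem_Iic]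
    constructor <;> intro h <;> linarith
  simp_rw [h1]
  rw [integral_add ((integrable_indicator_iff measurableSet_Ioi).2 (by simp))
    ((integrable_indicator_iff measurableSet_Iic).2 hi.integrableOn),
    integral_indicator measurableSet_Ioi, integral_indicator measurableSet_Iic,
    ← gaussianReal_real_eq d measurableSet_Iic, h2, gaussianTail_eq]
  simp
  ring

/-! ### The limit law of the likelihood ratio -/

/-- The mean over independent signs factorizes, and the two signs of one coordinate average to a
hyperbolic cosine. -/
lemma uniformLikelihood_eq_exp {n : ℕ} {v : ℝ≥0} (hv : v ≠ 0) (a : ℝ) (y : Fin n → ℝ) :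
    uniformLikelihood v a (fun i => √v * y i)
      = Real.exp (∑ i, (Real.log (Real.cosh (a / √v * y i)) - (a / √v) ^ 2 / 2)) := by
  have hv' : (0 : ℝ) < v := by exact_mod_cast pos_iff_ne_zero.2 hv
  have hs : √(v : ℝ) ^ 2 = v := Real.sq_sqrt hv'.le
  have hs' : 0 < √(v : ℝ) := Real.sqrt_pos.2 hv'
  rw [uniformLikelihood]
  simp_rw [likelihood_eq_prod, symbols]
  rw [expect_prod_signs fun i u => Real.exp ((a * ((u : ℤ) : ℝ) * (√v * y i)
    - (a * ((u : ℤ) : ℝ)) ^ 2 / 2) / v), Real.exp_sum]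
  refine Finset.prod_congr rfl fun i _ => ?_
  rw [expect_signs, Real.exp_sub, Real.exp_log (Real.cosh_pos _), Real.cosh_eq]
  have e1 : (a * (((1 : ℤˣ) : ℤ) : ℝ) * (√v * y i) - (a * (((1 : ℤˣ) : ℤ) : ℝ)) ^ 2 / 2) / v
      = a / √v * y i - (a / √v) ^ 2 / 2 := by
    rw [div_pow, hs]
    simp only [Units.val_one, Int.cast_one, mul_one]
    field_simp
    linear_combination 2 * a * y i * hs
  have e2 : (a * (((-1 : ℤˣ) : ℤ) : ℝ) * (√v * y i) - (a * (((-1 : ℤˣ) : ℤ) : ℝ)) ^ 2 / 2) / v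
      = -(a / √v * y i) - (a / √v) ^ 2 / 2 := by
    rw [div_pow, hs]
    simp only [Units.val_neg, Units.val_one, Int.cast_neg, Int.cast_one]
    field_simp
    linear_combination -(2 * a * y i * hs)
  rw [e1, e2, Real.exp_sub, Real.exp_sub]
  ring

/-- The law of a sequence of independent standard normal variables. -/
noncomputable def normalSeq : Measure (ℕ → ℝ) := Measure.infinitePi fun _ => gaussianReal 0 1

instance : IsProbabilityMeasure normalSeq := by unfold normalSeq; infer_instance

lemma normalSeq_map_eval (i : ℕ) : normalSeq.map (fun ω => ω i) = gaussianReal 0 1 :=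
  Measure.infinitePi_map_eval (fun _ : ℕ => gaussianReal 0 1) i

lemma iIndepFun_normalSeq : iIndepFun (fun (i : ℕ) (ω : ℕ → ℝ) => ω i) normalSeq :=
  iIndepFun_infinitePi (X := fun _ x => x) (fun _ => measurable_id)

/-- All dimensions are realized as prefixes of one sequence, so that almost sure limits and the
central limit theorem apply on a common space. -/
lemma normalSeq_map {n : ℕ} (v : ℝ≥0) :
    normalSeq.map (fun ω (i : Fin n) => √v * ω i) = gaussianVec v (0 : Fin n → ℝ) := by
  have h1 : iIndepFun (fun (i : Fin n) (ω : ℕ → ℝ) => √(v : ℝ) * ω i) normalSeq :=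
    (iIndepFun_normalSeq.precomp Fin.val_injective).comp (fun _ x => √(v : ℝ) * x) (by fun_prop)
  have hm : ∀ i : Fin n, AEMeasurable (fun ω : ℕ → ℝ => √(v : ℝ) * ω i) normalSeq := fun i =>
    ((measurable_pi_apply (i : ℕ)).const_mul _).aemeasurable
  rw [(iIndepFun_iff_map_fun_eq_pi_map hm).1 h1, gaussianVec]
  congr 1
  ext1 i
  have : (fun ω : ℕ → ℝ => √(v : ℝ) * ω i) = (fun x => √(v : ℝ) * x) ∘ fun ω : ℕ → ℝ => ω i := rfl
  rw [this, ← Measure.map_map (by fun_prop) (by fun_prop), normalSeq_map_eval,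
    gaussianReal_map_const_mul]
  congr 1
  · simp
  · ext; simp

lemma integral_normalSeq_eval {f : ℝ → ℝ} (hf : Measurable f) (i : ℕ) :
    ∫ ω, f (ω i) ∂normalSeq = ∫ x, f x ∂(gaussianReal 0 1) := by
  rw [← normalSeq_map_eval i, integral_map (measurable_pi_apply i).aemeasurable
    hf.aestronglyMeasurable]

lemma identDistrib_normalSeq {f : ℝ → ℝ} (hf : Measurable f) (i : ℕ) :
    IdentDistrib (fun ω : ℕ → ℝ => f (ω i)) (fun ω => f (ω 0)) normalSeq normalSeq := by
  have h : IdentDistrib (fun ω : ℕ → ℝ => ω i) (fun ω => ω 0) normalSeq normalSeq :=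
    ⟨(measurable_pi_apply i).aemeasurable, (measurable_pi_apply 0).aemeasurable, by
      rw [normalSeq_map_eval, normalSeq_map_eval]⟩
  exact h.comp hf

lemma ae_tendsto_average_pow (p : ℕ) :
    ∀ᵐ ω : ℕ → ℝ ∂normalSeq, Tendsto (fun n : ℕ => (∑ i ∈ Finset.range n, ω i ^ p) / (n : ℝ)) atTop
      (𝓝 (∫ x : ℝ, x ^ p ∂(gaussianReal 0 1))) := by
  have h := strong_law_ae_real (μ := normalSeq) (fun i ω => ω i ^ p) ?_ ?_
    (identDistrib_normalSeq (f := fun x => x ^ p) (by fun_prop))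
  · rwa [integral_normalSeq_eval (f := fun x => x ^ p) (by fun_prop)] at h
  · have := integrable_pow_gaussianReal p
    rw [← normalSeq_map_eval 0] at this
    exact this.comp_measurable (measurable_pi_apply 0)
  · intro i j hij
    exact (iIndepFun_normalSeq.indepFun hij).comp (φ := fun x => x ^ p) (ψ := fun x => x ^ p)
      (by fun_prop) (by fun_prop)

lemma tendstoInDistribution_sum_sq :
    TendstoInDistribution
      (fun (n : ℕ) (ω : ℕ → ℝ) => (√n)⁻¹ * (∑ i ∈ Finset.range n, ω i ^ 2 - n)) atTop
      (fun x : ℝ => √2 * x) (fun _ => normalSeq) (gaussianReal 0 1) := by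
  have hvar : Var[fun ω : ℕ → ℝ => ω 0 ^ 2; normalSeq] = 2 := by
    have := variance_map (μ := normalSeq) (Y := fun ω : ℕ → ℝ => ω 0) (X := fun x : ℝ => x ^ 2)
      (by fun_prop) (measurable_pi_apply 0).aemeasurable
    rw [normalSeq_map_eval, variance_sq_gaussianReal] at this
    exact this.symm
  have h := tendstoInDistribution_inv_sqrt_mul_sum_sub (P := normalSeq) (P' := gaussianReal 0 1)
    (X := fun i ω => ω i ^ 2) (Y := fun x : ℝ => √2 * x) ?_ ?_
    (iIndepFun_normalSeq.comp (fun _ x => x ^ 2) (by fun_prop))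
    (identDistrib_normalSeq (f := fun x => x ^ 2) (by fun_prop))
  · have e := integral_normalSeq_eval (f := fun x => x ^ 2) (by fun_prop) 0
    rw [integral_sq_gaussianReal] at e
    simpa only [e, mul_one] using h
  · refine ⟨by fun_prop, ?_⟩
    rw [hvar, gaussianReal_map_const_mul]
    congr 1
    · simp
    · ext; simp
  · refine (memLp_two_iff_integrable_sq
      ((measurable_pi_apply 0).pow_const 2).aestronglyMeasurable).2 ?_
    have := integrable_pow_gaussianReal 4
    rw [← normalSeq_map_eval 0] at this
    refine (this.comp_measurable (measurable_pi_apply 0)).congr (ae_of_all _ fun x => ?_)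
    simp only [Function.comp_apply]; ring

/-- The remainder of the log-likelihood ratio after its quadratic term. -/
noncomputable def logRemainder (κ : ℝ) (n : ℕ) (ω : ℕ → ℝ) : ℝ :=
  ∑ i ∈ Finset.range n, (Real.log (Real.cosh (√(κ / √n) * ω i)) - √(κ / √n) ^ 2 / 2)
    - κ / 2 * ((√n)⁻¹ * (∑ i ∈ Finset.range n, ω i ^ 2 - n))

lemma measurable_logRemainder (κ : ℝ) (n : ℕ) : Measurable (logRemainder κ n) := by
  unfold logRemainder
  have : Measurable fun x : ℝ => Real.log (Real.cosh x) := by fun_prop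
  fun_prop

/-- The quadratic terms cancel exactly. The quartic terms are `-(κ ^ 2 / 12)` times the average of
`ω i ^ 4`, whose limit is `3`, and the sixth-order error is `1 / √n` times a convergent average. -/
lemma ae_tendsto_logRemainder {κ : ℝ} (hκ : 0 < κ) :
    ∀ᵐ ω ∂normalSeq, Tendsto (fun n => logRemainder κ n ω) atTop (𝓝 (-(κ ^ 2 / 4))) := by
  filter_upwards [ae_tendsto_average_pow 4, ae_tendsto_average_pow 6] with ω h4 h6
  rw [integral_pow_four_gaussianReal] at h4
  have hsq : Tendsto (fun n : ℕ => √(n : ℝ)) atTop atTop :=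
    Real.tendsto_sqrt_atTop.comp tendsto_natCast_atTop_atTop
  have hm : Tendsto (fun n : ℕ => -(κ ^ 2 / 12) * ((∑ i ∈ Finset.range n, ω i ^ 4) / n)) atTop
      (𝓝 (-(κ ^ 2 / 4))) := by
    have := h4.const_mul (-(κ ^ 2 / 12))
    convert this using 2; ring
  have hb : Tendsto (fun n : ℕ => κ ^ 3 / 45 * ((√(n : ℝ))⁻¹ *
      ((∑ i ∈ Finset.range n, ω i ^ 6) / n))) atTop (𝓝 0) := by
    have := (hsq.inv_tendsto_atTop.mul h6).const_mul (κ ^ 3 / 45)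
    simpa using this
  have hd : Tendsto (fun n : ℕ => logRemainder κ n ω
      - -(κ ^ 2 / 12) * ((∑ i ∈ Finset.range n, ω i ^ 4) / n)) atTop (𝓝 0) := by
    refine squeeze_zero_norm' ?_ hb
    filter_upwards [eventually_gt_atTop 0] with n hn
    have hn' : (0 : ℝ) < n := by exact_mod_cast hn
    have hs : 0 < √(n : ℝ) := Real.sqrt_pos.2 hn'
    have hs2 : √(n : ℝ) ^ 2 = n := Real.sq_sqrt hn'.le
    set b := √(κ / √n) with hb_def
    have hb2 : b ^ 2 = κ / √n := Real.sq_sqrt (by positivity)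
    have hb4 : b ^ 4 = κ ^ 2 / n := by
      rw [show b ^ 4 = (b ^ 2) ^ 2 by ring, hb2, div_pow, hs2]
    have hb6 : b ^ 6 = κ ^ 3 / (√n * n) := by
      rw [show b ^ 6 = b ^ 2 * b ^ 4 by ring, hb2, hb4]; field_simp
    have e : logRemainder κ n ω - -(κ ^ 2 / 12) * ((∑ i ∈ Finset.range n, ω i ^ 4) / n)
        = ∑ i ∈ Finset.range n, (Real.log (Real.cosh (b * ω i))
          - ((b * ω i) ^ 2 / 2 - (b * ω i) ^ 4 / 12)) := by
      rw [logRemainder]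
      have e1 : κ / 2 * ((√(n : ℝ))⁻¹ * (∑ i ∈ Finset.range n, ω i ^ 2 - n))
          = b ^ 2 / 2 * ∑ i ∈ Finset.range n, ω i ^ 2 - n * (b ^ 2 / 2) := by
        rw [hb2]; field_simp
      have e2 : -(κ ^ 2 / 12) * ((∑ i ∈ Finset.range n, ω i ^ 4) / n)
          = -(b ^ 4 / 12 * ∑ i ∈ Finset.range n, ω i ^ 4) := by
        rw [hb4]; field_simp
      rw [e1, e2, Finset.mul_sum, Finset.mul_sum]
      simp_rw [Finset.sum_sub_distrib, mul_pow]
      simp only [Finset.sum_const, Finset.card_range, nsmul_eq_mul, div_mul_eq_mul_div]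
      ring
    rw [e, Real.norm_eq_abs]
    refine (Finset.abs_sum_le_sum_abs _ _).trans
      ((Finset.sum_le_sum fun i _ => abs_log_cosh_sub_le _).trans (le_of_eq ?_))
    simp_rw [mul_pow, hb6, ← Finset.sum_div, ← Finset.mul_sum]
    field_simp
  simpa using hd.add hm

lemma continuous_min_one_exp : Continuous fun x : ℝ => min 1 (Real.exp x) := by fun_prop

/-- The error of the optimal test between noise and independent uniform symbols. -/
lemma tendsto_integral_min_uniformLikelihood {v : ℝ≥0} (hv : v ≠ 0) {κ : ℝ} (hκ : 0 < κ) :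
    Tendsto (fun n : ℕ => ∫ z, min 1 (uniformLikelihood v (√(κ * v / √n)) z)
      ∂(gaussianVec v (0 : Fin n → ℝ))) atTop (𝓝 (2 * gaussianTail (κ / (2 * √2)))) := by
  have hv' : (0 : ℝ) < v := by exact_mod_cast pos_iff_ne_zero.2 hv
  -- Slutsky: the quadratic part converges in distribution and the remainder in measure to a
  -- constant.
  have h1 := (tendstoInDistribution_sum_sq.continuous_comp (g := fun x => κ / 2 * x)
    (by fun_prop)).add_of_tendstoInMeasure_const
    (tendstoInMeasure_of_tendsto_ae (fun n => (measurable_logRemainder κ n).aestronglyMeasurable)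
      (ae_tendsto_logRemainder hκ)) fun n => (measurable_logRemainder κ n).aemeasurable
  let f : BoundedContinuousFunction ℝ ℝ := BoundedContinuousFunction.ofNormedAddCommGroup
    (fun x => min 1 (Real.exp x)) continuous_min_one_exp 1 fun x => by
      rw [Real.norm_of_nonneg (le_min zero_le_one (Real.exp_pos _).le)]
      exact min_le_left _ _
  have h2 := ProbabilityMeasure.tendsto_iff_forall_integral_tendsto.1 h1.tendsto f
  -- With `d = κ / √2` the limit `κ / 2 * (√2 * g) - κ ^ 2 / 4` becomes `d * g - d ^ 2 / 2`, the
  -- log-likelihood ratio of a unit normal shifted by `d`.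
  have hd : 0 < κ / √2 := by positivity
  have e : ∫ x, f x ∂((gaussianReal 0 1).map
      fun ω => ((fun x => κ / 2 * x) ∘ fun x => √2 * x) ω + -(κ ^ 2 / 4))
      = 2 * gaussianTail (κ / (2 * √2)) := by
    rw [integral_map (by fun_prop) f.continuous.aestronglyMeasurable]
    have h3 := integral_min_one_exp_gaussianReal hd
    have h4 : κ / √2 / 2 = κ / (2 * √2) := by field_simp
    rw [h4] at h3
    rw [← h3]
    refine integral_congr_ae (ae_of_all _ fun g => ?_)
    have h5 : √(2 : ℝ) * √2 = 2 := Real.mul_self_sqrt (by norm_num)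
    change min 1 (Real.exp (κ / 2 * (√2 * g) + -(κ ^ 2 / 4))) = _
    congr 2
    rw [div_pow, Real.sq_sqrt (by norm_num : (0:ℝ) ≤ 2)]
    have h6 : κ / √2 = κ / 2 * √2 := by
      rw [div_eq_iff (by positivity), mul_assoc, h5]; ring
    rw [h6]; ring
  rw [← e]
  refine h2.congr fun n => ?_
  have hm : Measurable fun (ω : ℕ → ℝ) (i : Fin n) => √(v : ℝ) * ω i :=
    measurable_pi_lambda _ fun i => (measurable_pi_apply (i : ℕ)).const_mul _
  simp only [ProbabilityMeasure.coe_mk]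
  rw [integral_map (h1.forall_aemeasurable n) f.continuous.aestronglyMeasurable,
    ← normalSeq_map v, integral_map hm.aemeasurable]
  · refine integral_congr_ae (ae_of_all _ fun ω => ?_)
    simp only
    rw [uniformLikelihood_eq_exp hv]
    have h7 : √(κ * v / √n) / √v = √(κ / √n) := by
      rw [← Real.sqrt_div' _ hv'.le]
      congr 1; field_simp
    rw [h7, Fin.sum_univ_eq_sum_range
      (fun i => Real.log (Real.cosh (√(κ / √n) * ω i)) - √(κ / √n) ^ 2 / 2)]
    change min 1 (Real.exp (κ / 2 * ((√n)⁻¹ * (∑ i ∈ Finset.range n, ω i ^ 2 - n))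
      + logRemainder κ n ω)) = _
    rw [logRemainder]
    congr 2
    ring
  · refine Measurable.aestronglyMeasurable ?_
    have : Measurable (uniformLikelihood (n := n) v (√(κ * v / √n))) := by
      unfold uniformLikelihood
      simp_rw [Fintype.expect_eq_sum_div_card]
      exact (Finset.measurable_sum _ fun g _ => measurable_likelihood v _).div_const _
    exact measurable_const.min this

/-! ### Codes from code books -/

lemma abs_integral_min_sub_le {α : Type*} [MeasurableSpace α] {μ : Measure α} [IsFiniteMeasure μ]
    {f g : α → ℝ} (hf : Integrable f μ) (hg : Integrable g μ) :
    |∫ z, min 1 (f z) ∂μ - ∫ z, min 1 (g z) ∂μ| ≤ ∫ z, |f z - g z| ∂μ := by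
  have h1 : Integrable (fun z => min 1 (f z)) μ := (integrable_const 1).inf hf
  have h2 : Integrable (fun z => min 1 (g z)) μ := (integrable_const 1).inf hg
  rw [← integral_sub h1 h2]
  refine abs_integral_le_integral_abs.trans
    (integral_mono (h1.sub h2).abs (hf.sub hg).abs fun z => ?_)
  refine (abs_min_sub_min_le_max _ _ _ _).trans ?_
  simp

/-- A code book `x` and signs `y` of the keys give a code with pulse amplitude modulation. -/
lemma exists_code_of_codebook {T T₀ β : ℝ} (hT : 0 < T₀) (hβ : β ∈ Set.Icc (0 : ℝ) 1) {n M : ℕ}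
    (hn : n * T₀ ≤ T) (hM : 0 < M) {σ : Type*} [Fintype σ] [Nonempty σ] (a θ : ℝ)
    (x : Fin M → Fin n → ℤˣ) (y : σ → Fin n → ℤˣ)
    (hy : ∀ i j, i ≠ j → ∑ s, ((y s i : ℤ) : ℝ) * ((y s j : ℤ) : ℝ) = 0) {Nb Nw : ℝ}
    (hNb : 0 < Nb) (hNw : 0 < Nw) :
    ∃ C : Code T, C.M = M ∧ C.K = Fintype.card σ ∧
      C.errorProb Nb = codebookError (Nb / 2).toNNReal a θ x ∧
      |C.minDetectionError Nw - ∫ z, min 1 (uniformLikelihood (Nw / 2).toNNReal a z)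
        ∂(gaussianVec (Nw / 2).toNNReal (0 : Fin n → ℝ))|
        ≤ ∫ z, |𝔼 j : Fin M × σ, likelihood (Nw / 2).toNNReal (symbols a (x j.1 * y j.2)) z
          - uniformLikelihood (Nw / 2).toNNReal a z| ∂(gaussianVec (Nw / 2).toNNReal 0) ∧
      (∀ f, C.esd f = n * a ^ 2 * ‖rrcSpectrum T₀ β f‖ ^ 2) ∧
      ∀ m s, ∃ g : Fin n → ℤˣ, C.codeword m s = pam T₀ β (symbols a g) := by
  classical
  let e := Fintype.equivFin σ
  have hK : 0 < Fintype.card σ := Fintype.card_pos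
  have : NeZero (Fintype.card σ) := ⟨hK.ne'⟩
  have hM' : (M : ℝ) ≠ 0 := by exact_mod_cast hM.ne'
  have hK' : (Fintype.card σ : ℝ) ≠ 0 := by exact_mod_cast hK.ne'
  let c : Fin M → Fin (Fintype.card σ) → Fin n → ℝ := fun m s => symbols a (x m * y (e.symm s))
  let D : Fin (Fintype.card σ) → (Fin n → ℝ) → Fin (M + 1) := fun s z =>
    thresholdDecoder a θ x (flipSigns (y (e.symm s)) z)
  have hD : ∀ s, Measurable (D s) := fun s =>
    (measurable_thresholdDecoder a θ x).comp (measurable_flipSigns _)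
  have hφ := isOrthonormal_pulse hT hβ (n := n)
  refine ⟨pamCode hT hβ hn hM hK c D hD, rfl, rfl, ?_, ?_, fun f => ?_, fun m s => ⟨_, rfl⟩⟩
  · have hμ := isWhiteNoise_whiteNoise hNb.le
    have hB : ∀ r : Fin (M + 1), MeasurableSet {z | thresholdDecoder a θ x z ≠ r} := fun r =>
      (measurable_thresholdDecoder a θ x) (measurableSet_singleton r).compl
    have h1 : ∀ s m, (whiteNoise Nb).real {w | (pamCode hT hβ hn hM hK c D hD).decode s
        (observe ((pamCode hT hβ hn hM hK c D hD).codeword m s) w) ≠ m.succ}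
        = (gaussianVec (Nb / 2).toNNReal (symbols a (x m))).real
          {z | thresholdDecoder a θ x z ≠ m.succ} := fun s m =>
      (map_observe_pulses hμ hφ (hasCoords_pam hT hβ (c m s)) (B := {z | D s z ≠ m.succ})
        (hD s (measurableSet_singleton _).compl)).trans
        ((measureReal_flipSigns _ _ _ (hB _)).trans (by rw [flipSigns_symbols]))
    have h2 : ∀ s, (whiteNoise Nb).real {w | (pamCode hT hβ hn hM hK c D hD).decode s
        (observe 0 w) ≠ 0}
        = (gaussianVec (Nb / 2).toNNReal 0).real {z | thresholdDecoder a θ x z ≠ 0} := fun s => by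
      have h3 : flipSigns (y (e.symm s)) 0 = 0 := by ext; simp [flipSigns]
      exact (map_observe_pulses hμ hφ (hasCoords_zero _) (B := {z | D s z ≠ 0})
        (hD s (measurableSet_singleton _).compl)).trans
        ((measureReal_flipSigns _ _ _ (hB _)).trans (by rw [h3]))
    rw [Code.errorProb, codebookError]
    simp_rw [h1, h2, Fintype.expect_eq_sum_div_card]
    change (⨆ _ : Fin (Fintype.card σ), (∑ m : Fin M, _) / (M : ℝ))
      + (∑ _ : Fin (Fintype.card σ), _) / (Fintype.card σ : ℝ) = _
    -- No key is worse than another, so the maximum over keys equals the error of the code book.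
    rw [ciSup_const, Finset.sum_const, Finset.card_univ, Fintype.card_fin, Fintype.card_fin,
      nsmul_eq_mul, mul_div_assoc, mul_div_cancel₀ _ hK']
    rfl
  · rw [Code.minDetectionError_eq _ hφ (c := c) (fun m s => hasCoords_pam hT hβ (c m s)) hNw]
    have h1 : ∀ z, (∑ m, ∑ s, likelihood (Nw / 2).toNNReal (c m s) z) /
        ((M : ℝ) * (Fintype.card σ : ℝ))
        = 𝔼 j : Fin M × σ, likelihood (Nw / 2).toNNReal (symbols a (x j.1 * y j.2)) z := by
      intro z
      rw [Fintype.expect_eq_sum_div_card, Fintype.sum_prod_type, Fintype.card_prod,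
        Fintype.card_fin, Nat.cast_mul]
      congr 1
      exact Finset.sum_congr rfl fun m _ => Equiv.sum_comp e.symm fun s =>
        likelihood (Nw / 2).toNNReal (symbols a (x m * y s)) z
    have h2 := abs_integral_min_sub_le (μ := gaussianVec (Nw / 2).toNNReal (0 : Fin n → ℝ))
      (integrable_expect fun j : Fin M × σ =>
        integrable_likelihood (Nw / 2).toNNReal (symbols a (x j.1 * y j.2)) 0)
      (integrable_uniformLikelihood (Nw / 2).toNNReal a 0)
    simp_rw [← h1] at h2 ⊢
    exact h2
  · have h1 : ∀ m, ∑ s, ‖𝓕 (fun t => (pam T₀ β (c m s) t : ℂ)) f‖ ^ 2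
        = Fintype.card σ * (n * a ^ 2 * ‖rrcSpectrum T₀ β f‖ ^ 2) := by
      intro m
      -- The average over the keys alone is white, for each message separately; the code book `x`
      -- needs no structure.
      have h2 := sum_norm_sq_fourier_pam hT hβ (a := a) (fun s => c m s) (fun i j => ?_) f
      · rwa [Fintype.card_fin] at h2
      · rw [Fintype.card_fin]
        have h3 : ∑ s, c m s i * c m s j
            = ∑ s, symbols a (x m * y s) i * symbols a (x m * y s) j :=
          Equiv.sum_comp e.symm fun s => symbols a (x m * y s) i * symbols a (x m * y s) j
        rw [h3]
        split_ifs with hij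
        · subst hij
          simp_rw [← pow_two, symbols_sq]
          simp
        · have h4 : ∀ s, symbols a (x m * y s) i * symbols a (x m * y s) j
              = a ^ 2 * ((x m i : ℤ) : ℝ) * ((x m j : ℤ) : ℝ) *
                (((y s i : ℤ) : ℝ) * ((y s j : ℤ) : ℝ)) := fun s => by
            simp only [symbols, Pi.mul_apply, Units.val_mul, Int.cast_mul]; ring
          simp_rw [h4]
          rw [← Finset.mul_sum, hy i j hij, mul_zero]
    change (∑ m, ∑ s, ‖𝓕 (fun t => (pam T₀ β (c m s) t : ℂ)) f‖ ^ 2) /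
      ((M : ℝ) * (Fintype.card σ : ℝ)) = _
    simp_rw [h1]
    rw [Finset.sum_const, Finset.card_univ, Fintype.card_fin, nsmul_eq_mul]
    field_simp

/-! ### Asymptotics of the code books -/

/-- The bound of `exists_codebook` for the energy `A` over `n` symbols. -/
lemma exists_codebook_of_energy {vb vw : ℝ≥0} (hvb : vb ≠ 0) (hvw : vw ≠ 0) {κ ε : ℝ} (hκ : 0 < κ)
    (h0 : 0 < ε) (hε : ε ≤ 1 / 3) :
    ∃ B : ℕ → ℝ, Tendsto B atTop (𝓝 0) ∧ ∀ n : ℕ, 0 < n →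
      ∃ (M K k : ℕ) (x : Fin M → Fin n → ℤˣ) (y : Fin K × (Fin k → ℤˣ) → Fin n → ℤˣ) (θ : ℝ),
      0 < M ∧ 0 < K ∧
      (1 - 3 * ε) * (κ * vw * √n / (2 * vb)) ≤ Real.log M ∧
      Real.log M ≤ (1 - 3 * ε) * (κ * vw * √n / (2 * vb)) + Real.log 2 ∧
      Real.log (K * 2 ^ k) ≤ max 0 ((1 + 3 * ε) * (κ * √n / 2)
        - (1 - 3 * ε) * (κ * vw * √n / (2 * vb))) + Real.log 2 + Real.log (2 * n) ∧
      (∀ i j, i ≠ j → ∑ s, ((y s i : ℤ) : ℝ) * ((y s j : ℤ) : ℝ) = 0) ∧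
      codebookError vb (√(κ * vw / √n)) θ x +
      ∫ z, |𝔼 j : Fin M × Fin K × (Fin k → ℤˣ),
        likelihood vw (symbols (√(κ * vw / √n)) (x j.1 * y j.2)) z
        - uniformLikelihood vw (√(κ * vw / √n)) z| ∂(gaussianVec vw 0) ≤ B n := by
  have hvb' : (0 : ℝ) < vb := by exact_mod_cast pos_iff_ne_zero.2 hvb
  have hvw' : (0 : ℝ) < vw := by exact_mod_cast pos_iff_ne_zero.2 hvw
  let E : ℝ → ℕ → ℝ := fun b n => Real.exp (-(b * √n))
  have hE : ∀ b, 0 < b → Tendsto (E b) atTop (𝓝 0) := fun b hb =>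
    Real.tendsto_exp_neg_atTop_nhds_zero.comp
      ((Real.tendsto_sqrt_atTop.comp tendsto_natCast_atTop_atTop).const_mul_atTop hb)
  refine ⟨fun n => E (ε ^ 2 * (κ * vw) / (2 * vb)) n
      + 2 * E ((ε + ε ^ 2) * (κ * vw) / (2 * vb)) n *
        (Real.exp (κ ^ 2 * vw ^ 2 / (2 * vb ^ 2)) + 1)
      + (E (ε * κ / 4) n + 2 * E (ε ^ 2 * κ / 2) n), ?_, fun n hn => ?_⟩
  · have := ((hE (ε ^ 2 * (κ * vw) / (2 * vb)) (by positivity)).add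
      (((hE ((ε + ε ^ 2) * (κ * vw) / (2 * vb)) (by positivity)).const_mul 2).mul_const
        (Real.exp (κ ^ 2 * vw ^ 2 / (2 * vb ^ 2)) + 1))).add
      ((hE (ε * κ / 4) (by positivity)).add ((hE (ε ^ 2 * κ / 2) (by positivity)).const_mul 2))
    simpa using this
  have hn' : (0 : ℝ) < n := by exact_mod_cast hn
  have hs : 0 < √(n : ℝ) := Real.sqrt_pos.2 hn'
  have hs2 : √(n : ℝ) ^ 2 = n := Real.sq_sqrt hn'.le
  set a := √(κ * vw / √n) with ha
  have ha2 : a ^ 2 = κ * vw / √n := Real.sq_sqrt (by positivity)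
  have hA : n * a ^ 2 = κ * vw * √n := by
    rw [ha2, ← hs2, Real.sqrt_sq hs.le]; field_simp
  set X := (1 - 3 * ε) * (κ * vw * √n / (2 * vb)) with hX
  have hX0 : 0 ≤ X := mul_nonneg (by linarith) (by positivity)
  -- The random part of the key supplies what `M` lacks for resolvability, where the threshold is `n
  -- * a ^ 2 / (2 * vw) = κ * √n / 2`.
  set Y := max 0 ((1 + 3 * ε) * (κ * √n / 2) - X) with hY
  have hY0 : 0 ≤ Y := le_max_left _ _
  have hceil : ∀ {t : ℝ}, 0 ≤ t → ((⌈Real.exp t⌉₊ : ℕ) : ℝ) ≤ 2 * Real.exp t := fun {t} ht => by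
    have h1 := (Nat.ceil_lt_add_one (Real.exp_pos t).le).le
    have h2 := Real.one_le_exp ht
    linarith
  set M := ⌈Real.exp X⌉₊ with hM_def
  set K := ⌈Real.exp Y⌉₊ with hK_def
  have hM : 0 < M := Nat.ceil_pos.2 (Real.exp_pos _)
  have hK : 0 < K := Nat.ceil_pos.2 (Real.exp_pos _)
  have hM' : (0 : ℝ) < M := by exact_mod_cast hM
  have hK' : (0 : ℝ) < K := by exact_mod_cast hK
  have hMX : Real.exp X ≤ M := Nat.le_ceil _
  have hKY : Real.exp Y ≤ K := Nat.le_ceil _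
  -- Enough bits for `n` distinct subsets, yet `2 ^ k ≤ 2 * n`, so the Walsh keys cost only `log (2
  -- * n)`.
  set k := Nat.clog 2 n with hk
  obtain ⟨I, hI⟩ : ∃ I : Fin n → Finset (Fin k), Function.Injective I := by
    have : Fintype.card (Fin n) ≤ Fintype.card (Finset (Fin k)) := by
      rw [Fintype.card_fin, Fintype.card_finset, Fintype.card_fin]
      exact Nat.le_pow_clog one_lt_two n
    obtain ⟨f⟩ := Function.Embedding.nonempty_of_card_le this
    exact ⟨f, f.injective⟩
  have hk2 : (2 : ℝ) ^ k ≤ 2 * n := by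
    have : 2 ^ k ≤ 2 * n := by
      rcases Nat.lt_or_ge 1 n with h | h
      · have h1 := Nat.pow_pred_clog_lt_self one_lt_two h
        have h2 : 0 < k := Nat.clog_pos one_lt_two h
        rw [← hk] at h1
        rw [← Nat.succ_pred_eq_of_pos h2, pow_succ]
        omega
      · have : n = 1 := by omega
        simp [hk, this]
    exact_mod_cast this
  have hlogle : ∀ {t : ℝ} {N : ℕ}, 0 < N → (N : ℝ) ≤ 2 * Real.exp t →
      Real.log N ≤ t + Real.log 2 := fun {t N} hN h => by
    rw [← Real.log_exp t, ← Real.log_mul (Real.exp_pos _).ne' two_ne_zero, mul_comm]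
    exact Real.log_le_log (by exact_mod_cast hN) h
  -- Of the margin `3 * ε`, the truncation level takes `2 * ε`; the remaining factor `exp (ε * κ *
  -- √n / 2)` pays for `d ^ 2` with `d = exp (-(ε * κ / 4 * √n))`.
  have hMK : Real.exp ((1 + 2 * ε) * (n * a ^ 2) / (2 * vw))
      ≤ Real.exp (-(ε * κ / 4 * √n)) ^ 2 * (M * K) := by
    have h1 : Real.exp ((1 + 3 * ε) * (κ * √n / 2)) ≤ M * K := by
      refine le_trans ?_ (mul_le_mul hMX hKY (Real.exp_pos _).le hM'.le)
      rw [← Real.exp_add, Real.exp_le_exp]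
      have := le_max_right 0 ((1 + 3 * ε) * (κ * √n / 2) - X)
      linarith
    refine le_trans ?_ (mul_le_mul_of_nonneg_left h1 (by positivity))
    rw [← Real.exp_nat_mul, ← Real.exp_add, Real.exp_le_exp, hA]
    refine le_of_eq ?_
    push_cast
    field_simp
    ring
  obtain ⟨x, y, hy, hxy⟩ := exists_codebook hM hK hI (a := a) hvb hvw h0.le (by linarith)
    (Real.exp_pos _) hMK
  refine ⟨M, K, k, x, y, _, hM, hK, ?_, hlogle hM (hceil hX0), ?_, hy, hxy.trans ?_⟩
  · rw [← Real.log_exp X]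
    exact Real.log_le_log (Real.exp_pos _) hMX
  · rw [Real.log_mul hK'.ne' (by positivity)]
    exact add_le_add (hlogle hK (hceil hY0)) (Real.log_le_log (by positivity) hk2)
  · rw [hA]
    have e1 : Real.exp (-(ε ^ 2 * (κ * vw * √n) / (2 * vb))) = E (ε ^ 2 * (κ * vw) / (2 * vb)) n := by
      simp only [E]; congr 1; ring
    have e2 : Real.exp (-(ε ^ 2 * (κ * vw * √n) / (2 * vw))) = E (ε ^ 2 * κ / 2) n := by
      simp only [E]; congr 1; field_simp
    have e3 : (κ * vw * √n) ^ 2 / (2 * n * vb ^ 2) = κ ^ 2 * vw ^ 2 / (2 * vb ^ 2) := by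
      rw [mul_pow, hs2]; field_simp
    -- The rate factor `1 - 3 * ε` lies below the exponent factor `(1 - ε) ^ 2` by `ε + ε ^ 2`; the
    -- factor `2` comes from rounding `M` up.
    have e4 : M * Real.exp (-((1 - ε) ^ 2 * (κ * vw * √n) / (2 * vb)))
        ≤ 2 * E ((ε + ε ^ 2) * (κ * vw) / (2 * vb)) n := by
      refine (mul_le_mul_of_nonneg_right (hceil hX0) (Real.exp_pos _).le).trans (le_of_eq ?_)
      rw [mul_assoc, ← Real.exp_add]
      simp only [E, hX]
      congr 2
      field_simp
      ring
    rw [e1, e2, e3]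
    refine add_le_add (add_le_add le_rfl ?_) le_rfl
    rw [← mul_assoc]
    exact mul_le_mul_of_nonneg_right e4 (by positivity)

/-! ### Families of codes -/

/-- The code with a single codeword, which is zero. -/
def trivialCode (T : ℝ) : Code T where
  M := 1
  K := 1
  M_pos := one_pos
  K_pos := one_pos
  codeword _ _ := 0
  memLp_codeword _ _ := MemLp.zero
  support_codeword _ _ _ _ := rfl
  decode _ _ := 0
  measurable_decode _ := measurable_const

instance (T : ℝ) : Nonempty (Code T) := ⟨trivialCode T⟩

/-- A diagonal choice from properties that can be attained eventually. -/
lemma exists_forall_eventually {X : ℝ → Type*} [∀ T, Nonempty (X T)] (P : ℕ → ∀ T, X T → Prop)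
    (hP : ∀ k l T x, k ≤ l → P l T x → P k T x) (h : ∀ k, ∀ᶠ T in atTop, ∃ x, P k T x) :
    ∃ x : ∀ T, X T, ∀ k, ∀ᶠ T in atTop, P k T (x T) := by
  classical
  -- The best precision available at `T`, capped by `⌊T⌋₊` so that a greatest one exists; the cap
  -- tends to infinity.
  let N : ℝ → ℕ := fun T => Nat.findGreatest (fun k => ∃ x, P k T x) ⌊T⌋₊
  let x : ∀ T, X T := fun T =>
    if hx : ∃ x, P (N T) T x then hx.choose else Classical.arbitrary (X T)
  refine ⟨x, fun k => ?_⟩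
  filter_upwards [h k, eventually_ge_atTop (k : ℝ)] with T hT hk
  have hk' : k ≤ ⌊T⌋₊ := Nat.le_floor hk
  have hx : ∃ x, P (N T) T x :=
    Nat.findGreatest_spec (P := fun k => ∃ x, P k T x) hk' hT
  have hle : k ≤ N T := Nat.le_findGreatest hk' hT
  have : x T = hx.choose := dif_pos hx
  rw [this]
  exact hP k _ T _ hle hx.choose_spec

/-- The code attains the rates `r`, `rK` and the detection error `L` up to `ε`, and has the format
that is required by the mask `S` with bandwidth `W`. -/
structure Code.IsGood {T : ℝ} (C : Code T) (S : SpectralMask) (W Nw Nb r rK L ε : ℝ) : Prop where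
  message_lower : (r - ε) * √T ≤ Real.log C.M
  message_upper : Real.log C.M ≤ (r + 1) * √T
  key_upper : Real.log C.K ≤ (rK + ε) * √T
  reliable : C.errorProb Nb ≤ ε
  covert : |C.minDetectionError Nw - L| ≤ ε
  fits : S.Fits W C
  bpsk : C.IsBPSKwithRRC

lemma Code.IsGood.mono {T : ℝ} {C : Code T} {S : SpectralMask} {W Nw Nb r rK L ε ε' : ℝ}
    (h : C.IsGood S W Nw Nb r rK L ε) (hε : ε ≤ ε') : C.IsGood S W Nw Nb r rK L ε' where
  message_lower := (mul_le_mul_of_nonneg_right (by linarith) (Real.sqrt_nonneg T)).trans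
    h.message_lower
  message_upper := h.message_upper
  key_upper := h.key_upper.trans (mul_le_mul_of_nonneg_right (by linarith) (Real.sqrt_nonneg T))
  reliable := h.reliable.trans hε
  covert := h.covert.trans hε
  fits := h.fits
  bpsk := h.bpsk

lemma Code.errorProb_nonneg {T : ℝ} (C : Code T) (Nb : ℝ) : 0 ≤ C.errorProb Nb := by
  unfold errorProb
  refine add_nonneg (Real.iSup_nonneg fun s => ?_) ?_ <;> positivity

/-- A family of codes which are eventually good, for every precision, achieves the rates. -/
lemma achieves_of_isGood {S : SpectralMask} {W Nw Nb δ r rK : ℝ} (hW : 0 < W)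
    {C : ∀ T : ℝ, Code T}
    (h : ∀ ε, 0 < ε → ∀ᶠ T in atTop, (C T).IsGood S W Nw Nb r rK (1 - δ) ε) :
    Achieves S W Nw Nb δ r rK C ∧ (∀ᶠ T : ℝ in atTop, (C T).IsBPSKwithRRC) ∧
      (fun T : ℝ => Real.log (C T).M) =O[atTop] (fun T : ℝ => √(W * T)) := by
  refine ⟨⟨?_, ?_, ?_, ⟨1 - δ, le_rfl, ?_⟩, (h 1 one_pos).mono fun T hT => hT.fits⟩,
    (h 1 one_pos).mono fun T hT => hT.bpsk, ?_⟩
  · refine le_of_forall_lt_imp_le_of_dense fun c hc => ?_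
    obtain ⟨b, hcb, hbr⟩ := EReal.lt_iff_exists_real_btwn.1 hc
    refine hcb.le.trans (le_liminf_of_le (by isBoundedDefault) ?_)
    filter_upwards [h (r - b) (sub_pos.2 (EReal.coe_lt_coe_iff.1 hbr)), eventually_gt_atTop 0]
      with T hT hT0
    have h1 := hT.message_lower
    rw [sub_sub_cancel] at h1
    exact EReal.coe_le_coe_iff.2 ((le_div_iff₀ (Real.sqrt_pos.2 hT0)).2 h1)
  · refine le_of_forall_gt_imp_ge_of_dense fun c hc => ?_
    obtain ⟨b, hrb, hbc⟩ := EReal.lt_iff_exists_real_btwn.1 hc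
    refine le_trans (limsup_le_of_le (by isBoundedDefault) ?_) hbc.le
    filter_upwards [h (b - rK) (sub_pos.2 (EReal.coe_lt_coe_iff.1 hrb)), eventually_gt_atTop 0]
      with T hT hT0
    have h1 := hT.key_upper
    rw [add_sub_cancel] at h1
    exact EReal.coe_le_coe_iff.2 ((div_le_iff₀ (Real.sqrt_pos.2 hT0)).2 h1)
  · rw [Metric.tendsto_nhds]
    intro ε hε
    filter_upwards [h (ε / 2) (by linarith)] with T hT
    rw [Real.dist_eq, sub_zero, abs_of_nonneg (Code.errorProb_nonneg _ _)]
    linarith [hT.reliable]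
  · rw [Metric.tendsto_nhds]
    intro ε hε
    filter_upwards [h (ε / 2) (by linarith)] with T hT
    rw [Real.dist_eq]
    linarith [hT.covert]
  · refine Asymptotics.IsBigO.of_bound ((r + 1) / √W) ?_
    filter_upwards [h 1 one_pos] with T hT
    have hM : (1 : ℝ) ≤ (C T).M := by exact_mod_cast (C T).M_pos
    rw [Real.norm_of_nonneg (Real.log_nonneg hM), Real.norm_of_nonneg (Real.sqrt_nonneg _),
      Real.sqrt_mul hW.le, ← mul_assoc, div_mul_cancel₀ _ (Real.sqrt_pos.2 hW).ne']
    exact hT.message_upper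

lemma tendsto_sqrt_floor_div_sqrt {T₀ : ℝ} (hT₀ : 0 < T₀) :
    Tendsto (fun T : ℝ => √(⌊T / T₀⌋₊ : ℝ) / √T) atTop (𝓝 (1 / √T₀)) := by
  have h1 : Tendsto (fun T : ℝ => ((⌊T / T₀⌋₊ : ℕ) : ℝ) / (T / T₀) * (1 / T₀)) atTop
      (𝓝 (1 * (1 / T₀))) :=
    ((tendsto_nat_floor_div_atTop (R := ℝ)).comp (tendsto_id.atTop_div_const hT₀)).mul_const _
  rw [one_mul] at h1
  have h2 := (Real.continuous_sqrt.tendsto _).comp h1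
  rw [Real.sqrt_div zero_le_one, Real.sqrt_one] at h2
  refine h2.congr' ?_
  filter_upwards [eventually_gt_atTop 0] with T hT
  rw [Function.comp_apply, ← Real.sqrt_div (Nat.cast_nonneg _)]
  congr 1
  field_simp

/-- The key overhead of the Walsh patterns vanishes on the scale `√T`. -/
lemma tendsto_log_floor_div_sqrt {T₀ : ℝ} (hT₀ : 0 < T₀) :
    Tendsto (fun T : ℝ => Real.log (2 * (⌊T / T₀⌋₊ : ℝ)) / √T) atTop (𝓝 0) := by
  have h1 : Tendsto (fun T : ℝ => Real.log T / √T) atTop (𝓝 0) := by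
    have := (isLittleO_log_rpow_atTop (r := 1 / 2) (by norm_num)).tendsto_div_nhds_zero
    simpa only [← Real.sqrt_eq_rpow] using this
  have h2 : Tendsto (fun T : ℝ => Real.log (2 / T₀) / √T + Real.log T / √T) atTop (𝓝 0) := by
    have := (tendsto_const_nhds (x := Real.log (2 / T₀))).div_atTop Real.tendsto_sqrt_atTop
    simpa using this.add h1
  refine squeeze_zero' ?_ ?_ h2
  · filter_upwards [eventually_ge_atTop T₀] with T hT
    have : 1 ≤ ⌊T / T₀⌋₊ := Nat.le_floor (by rw [Nat.cast_one, le_div_iff₀ hT₀]; linarith)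
    have h3 : (1 : ℝ) ≤ (⌊T / T₀⌋₊ : ℝ) := by exact_mod_cast this
    exact div_nonneg (Real.log_nonneg (by linarith)) (Real.sqrt_nonneg _)
  · filter_upwards [eventually_ge_atTop T₀] with T hT
    have hT0 : 0 < T := hT₀.trans_le hT
    have : 1 ≤ ⌊T / T₀⌋₊ := Nat.le_floor (by rw [Nat.cast_one, le_div_iff₀ hT₀]; linarith)
    have h3 : (1 : ℝ) ≤ (⌊T / T₀⌋₊ : ℝ) := by exact_mod_cast this
    rw [← add_div, ← Real.log_mul (by positivity) hT0.ne']
    refine div_le_div_of_nonneg_right (Real.log_le_log (by linarith) ?_) (Real.sqrt_nonneg _)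
    have := Nat.floor_le (div_nonneg hT0.le hT₀.le)
    calc 2 * (⌊T / T₀⌋₊ : ℝ) ≤ 2 * (T / T₀) := by linarith
      _ = 2 / T₀ * T := by ring

/-- The pulse of duration `T₀` attains the rates and the error `2 Q(q)`, up to `ε`. -/
lemma eventually_exists_isGood {S : SpectralMask} {W Nw Nb T₀ β q e r rK ε : ℝ} (hNw : 0 < Nw)
    (hNb : 0 < Nb) (hβ : β ∈ Set.Icc (0 : ℝ) 1) (hf : S.PulseFeasible W β T₀) (hq : 0 < q)
    (he : 0 < e) (he' : e ≤ 1 / 3) (hε : 0 < ε)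
    (h1 : r - ε < (1 - 3 * e) * (Nw / Nb) * (√2 * q / √T₀))
    (h2 : (1 - 3 * e) * (Nw / Nb) * (√2 * q / √T₀) < r + 1)
    (h3 : max 0 ((1 + 3 * e) - (1 - 3 * e) * (Nw / Nb)) * (√2 * q / √T₀) < rK + ε) :
    ∀ᶠ T : ℝ in atTop, ∃ C : Code T, C.IsGood S W Nw Nb r rK (2 * gaussianTail q) ε := by
  have hT₀ : 0 < T₀ := hf.1
  have hsT₀ : 0 < √T₀ := Real.sqrt_pos.2 hT₀
  have h22 : √(2 : ℝ) * √2 = 2 := Real.mul_self_sqrt (by norm_num)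
  have hs2 : 0 < √(2 : ℝ) := by positivity
  set vb := (Nb / 2).toNNReal with hvb_def
  set vw := (Nw / 2).toNNReal with hvw_def
  have hvb : vb ≠ 0 := (Real.toNNReal_pos.2 (by linarith)).ne'
  have hvw : vw ≠ 0 := (Real.toNNReal_pos.2 (by linarith)).ne'
  have hvbr : (vb : ℝ) = Nb / 2 := Real.coe_toNNReal _ (by linarith)
  have hvwr : (vw : ℝ) = Nw / 2 := Real.coe_toNNReal _ (by linarith)
  -- Chosen so that the limiting detection error `2 Q(κ / (2√2))` is `2 Q(q)`.
  set κ := 2 * √2 * q with hκ_def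
  have hκ : 0 < κ := by positivity
  obtain ⟨B, hB, hcode⟩ := exists_codebook_of_energy hvb hvw hκ he he'
  have hclt := tendsto_integral_min_uniformLikelihood hvw hκ
  rw [show κ / (2 * √2) = q by rw [hκ_def]; field_simp] at hclt
  have hfl : Tendsto (fun T : ℝ => ⌊T / T₀⌋₊) atTop atTop :=
    tendsto_nat_floor_atTop.comp (tendsto_id.atTop_div_const hT₀)
  have hs := tendsto_sqrt_floor_div_sqrt hT₀
  have hl2 : Tendsto (fun T : ℝ => Real.log 2 / √T) atTop (𝓝 0) :=
    tendsto_const_nhds.div_atTop Real.tendsto_sqrt_atTop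
  have hx : ∀ n : ℕ, (1 - 3 * e) * (κ * vw * √n / (2 * vb))
      = (1 - 3 * e) * (Nw / Nb) * (√2 * q) * √n := fun n => by
    rw [hvbr, hvwr, hκ_def]; field_simp
  have hy : ∀ n : ℕ, max 0 ((1 + 3 * e) * (κ * √n / 2) - (1 - 3 * e) * (κ * vw * √n / (2 * vb)))
      = max 0 ((1 + 3 * e) - (1 - 3 * e) * (Nw / Nb)) * (√2 * q) * √n := fun n => by
    rw [hx, mul_assoc (max _ _), max_mul_of_nonneg _ _ (by positivity), zero_mul]
    congr 1
    rw [hκ_def]; ring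
  have t1 : Tendsto (fun T : ℝ => (1 - 3 * e) * (Nw / Nb) * (√2 * q) * (√(⌊T / T₀⌋₊ : ℝ) / √T))
      atTop (𝓝 ((1 - 3 * e) * (Nw / Nb) * (√2 * q / √T₀))) := by
    convert hs.const_mul ((1 - 3 * e) * (Nw / Nb) * (√2 * q)) using 2
    ring
  have t2 := t1.add hl2
  rw [add_zero] at t2
  have t3 : Tendsto (fun T : ℝ => max 0 ((1 + 3 * e) - (1 - 3 * e) * (Nw / Nb)) * (√2 * q)
      * (√(⌊T / T₀⌋₊ : ℝ) / √T) + Real.log 2 / √T + Real.log (2 * (⌊T / T₀⌋₊ : ℝ)) / √T) atTop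
      (𝓝 (max 0 ((1 + 3 * e) - (1 - 3 * e) * (Nw / Nb)) * (√2 * q / √T₀))) := by
    convert ((hs.const_mul (max 0 ((1 + 3 * e) - (1 - 3 * e) * (Nw / Nb)) * (√2 * q))).add
      hl2).add (tendsto_log_floor_div_sqrt hT₀) using 2
    ring
  have t4 : ∀ᶠ n : ℕ in atTop, |∫ z, min 1 (uniformLikelihood vw (√(κ * vw / √n)) z)
      ∂(gaussianVec vw (0 : Fin n → ℝ)) - 2 * gaussianTail q| < ε / 2 := by
    have := Metric.tendsto_nhds.1 hclt (ε / 2) (by linarith)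
    simpa only [Real.dist_eq] using this
  filter_upwards [t1.eventually_const_lt h1, t2.eventually_lt_const h2, t3.eventually_lt_const h3,
    hfl.eventually t4, hfl.eventually (hB.eventually_lt_const (half_pos hε)),
    hfl.eventually_gt_atTop 0, eventually_gt_atTop 0] with T e1 e2 e3 e4 e5 hn hT
  have hsT : 0 < √T := Real.sqrt_pos.2 hT
  obtain ⟨M, K, k, x, y, θ, hM, hK, l1, l2, l3, hyy, hxy⟩ := hcode _ hn
  have hn' : (0 : ℝ) < (⌊T / T₀⌋₊ : ℝ) := by exact_mod_cast hn
  have : Nonempty (Fin K) := ⟨⟨0, hK⟩⟩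
  have hle : (⌊T / T₀⌋₊ : ℝ) * T₀ ≤ T :=
    (le_div_iff₀ hT₀).1 (Nat.floor_le (div_nonneg hT.le hT₀.le))
  set a := √(κ * vw / √(⌊T / T₀⌋₊ : ℝ)) with ha_def
  have ha : 0 < a := by
    refine Real.sqrt_pos.2 (div_pos (mul_pos hκ ?_) (Real.sqrt_pos.2 hn'))
    rw [hvwr]; linarith
  obtain ⟨C, hCM, hCK, hCe, hCd, hCf, hCb⟩ :=
    exists_code_of_codebook hT₀ hβ hle hM a θ x y hyy hNb hNw
  have hI : 0 ≤ ∫ z, |𝔼 j : Fin M × Fin K × (Fin k → ℤˣ), likelihood vw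
      (symbols a (x j.1 * y j.2)) z - uniformLikelihood vw a z|
      ∂(gaussianVec vw (0 : Fin ⌊T / T₀⌋₊ → ℝ)) := integral_nonneg fun z => abs_nonneg _
  refine ⟨C, ⟨?_, ?_, ?_, ?_, ?_, ?_, ?_⟩⟩
  · rw [hCM]
    refine le_trans ?_ l1
    rw [hx, ← le_div_iff₀ hsT, mul_div_assoc]
    exact e1.le
  · rw [hCM]
    refine l2.trans ?_
    rw [hx, ← div_le_iff₀ hsT, add_div, mul_div_assoc]
    exact e2.le
  · rw [hCK]
    have hcard : ((Fintype.card (Fin K × (Fin k → ℤˣ)) : ℕ) : ℝ) = K * 2 ^ k := by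
      simp
    rw [hcard]
    refine l3.trans ?_
    rw [hy, ← div_le_iff₀ hsT, add_div, add_div, mul_div_assoc]
    exact e3.le
  · rw [hCe]
    linarith
  · have h4 := codebookError_nonneg vb a θ x
    refine (abs_sub_le _ _ _).trans (le_trans (add_le_add hCd e4.le) ?_)
    linarith
  · exact S.fits_of_esd_eq hβ hf (mul_pos hn' (pow_pos ha 2)) C hCf
  · refine ⟨a, T₀, β, ha, hT₀, hβ, fun m s => ?_⟩
    obtain ⟨g, hg⟩ := hCb m s
    refine ⟨symbols a g, fun i => ?_, fun t => by rw [hg]; rfl⟩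
    rcases Int.units_eq_one_or (g i) with h | h
    · left; simp [symbols, h]
    · right; simp [symbols, h]

end CovertAWGN

/-! ### Optimizing the pulse and removing the margins -/

theorem theorem1 (S : CovertAWGN.SpectralMask)
    (hα : ∀ i, 0 < S.α i) (hη : ∀ i, S.η i < 1) (hS : ∃ i, 0 < S.U i ∨ 0 < S.η i)
    (W W₀ Nw Nb δ : ℝ) (hW : 0 < W) (hW₀ : 0 < W₀) (hNw : 0 < Nw) (hNb : 0 < Nb)
    (hδ : δ ∈ Set.Ioo (0 : ℝ) 1) :
    ∃ C : ∀ T : ℝ, CovertAWGN.Code T,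
      CovertAWGN.Achieves S W Nw Nb δ
        (Nw / Nb * √(2 * W / S.minC W₀) * CovertAWGN.gaussianTailInv ((1 - δ) / 2))
        (max (1 - Nw / Nb) 0 * √(2 * W / S.minC W₀) * CovertAWGN.gaussianTailInv ((1 - δ) / 2))
        C ∧
      (∀ᶠ T : ℝ in Filter.atTop, (C T).IsBPSKwithRRC) ∧
      (fun T : ℝ => Real.log (C T).M) =O[Filter.atTop] (fun T : ℝ => √(W * T)) := by
  obtain ⟨hδ0, hδ1⟩ := hδ
  have hp : 0 < (1 - δ) / 2 := by linarith
  have hp' : (1 - δ) / 2 < 1 / 2 := by linarith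
  have hq := CovertAWGN.gaussianTailInv_pos hp hp'
  have hQ := CovertAWGN.gaussianTail_gaussianTailInv hp hp'
  set q := CovertAWGN.gaussianTailInv ((1 - δ) / 2)
  have hc := S.minC_pos hα hη hS hW₀
  set c := S.minC W₀ with hc_def
  set ρ := Nw / Nb with hρ_def
  have hρ : 0 < ρ := div_pos hNw hNb
  set r := ρ * √(2 * W / c) * q with hr_def
  set rK := max (1 - ρ) 0 * √(2 * W / c) * q with hrK_def
  have key : ∀ ε, 0 < ε → ∀ᶠ T : ℝ in Filter.atTop, ∃ C : CovertAWGN.Code T,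
      C.IsGood S W Nw Nb r rK (1 - δ) ε := by
    intro ε hε
    -- One parameter `e` serves as margin of the code rates and as slack of the pulse, since the
    -- infimum `c` need not be attained. The message rate is bounded below through `c + e`, the key
    -- rate above through `c`.
    have l1 : Filter.Tendsto (fun e : ℝ => (1 - 3 * e) * ρ * (√(2 * W / (c + e)) * q))
        (𝓝[>] 0) (𝓝 r) := by
      have : ContinuousAt (fun e : ℝ => (1 - 3 * e) * ρ * (√(2 * W / (c + e)) * q)) 0 := by
        have : c + 0 ≠ 0 := by simpa using hc.ne'
        fun_prop (disch := assumption)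
      have h := this.tendsto
      simp only [mul_zero, sub_zero, one_mul, add_zero] at h
      rw [← mul_assoc] at h
      exact h.mono_left nhdsWithin_le_nhds
    have l2 : Filter.Tendsto
        (fun e : ℝ => max 0 ((1 + 3 * e) - (1 - 3 * e) * ρ) * (√(2 * W / c) * q))
        (𝓝[>] 0) (𝓝 rK) := by
      have : Continuous fun e : ℝ =>
          max 0 ((1 + 3 * e) - (1 - 3 * e) * ρ) * (√(2 * W / c) * q) := by fun_prop
      have h := this.tendsto 0
      simp only [mul_zero, sub_zero, one_mul, add_zero] at h
      rw [← mul_assoc, max_comm] at h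
      exact h.mono_left nhdsWithin_le_nhds
    obtain ⟨e, ⟨⟨⟨h1, h2⟩, he⟩, he'⟩⟩ := ((((l1.eventually_const_lt (sub_lt_self r hε)).and
      (l2.eventually_lt_const (lt_add_of_pos_right rK hε))).and self_mem_nhdsWithin).and
      (Filter.Eventually.filter_mono nhdsWithin_le_nhds
        (Iic_mem_nhds (show (0 : ℝ) < 1 / 3 by norm_num)))).exists
    replace he : 0 < e := he
    replace he' : e ≤ 1 / 3 := he'
    obtain ⟨β, hβ, T₀, hf, hT1, hT2⟩ := S.exists_nearly_optimal_pulse hα hη hS hW hW₀ he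
    have hT₀ := hf.1
    have hs : √2 * q / √T₀ = √(2 * W / (W * T₀)) * q := by
      rw [mul_comm 2 W, mul_div_mul_left _ _ hW.ne', Real.sqrt_div zero_le_two]; ring
    have hlo : √(2 * W / (c + e)) * q ≤ √2 * q / √T₀ := by
      rw [hs]; gcongr
    have hhi : √2 * q / √T₀ ≤ √(2 * W / c) * q := by
      rw [hs]; gcongr
    have hL : 1 - δ = 2 * CovertAWGN.gaussianTail q := by rw [hQ]; ring
    have he3 : 0 ≤ 1 - 3 * e := by linarith
    rw [hL]
    refine CovertAWGN.eventually_exists_isGood hNw hNb hβ hf hq he he' hε ?_ ?_ ?_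
    · exact h1.trans_le (mul_le_mul_of_nonneg_left hlo (by positivity))
    · have : (1 - 3 * e) * ρ * (√2 * q / √T₀) ≤ 1 * ρ * (√(2 * W / c) * q) := by
        gcongr; linarith
      rw [hr_def]
      linarith
    · exact (mul_le_mul_of_nonneg_left hhi (le_max_left _ _)).trans_lt h2
  -- The pulse and the codes found so far depend on the precision; the diagonal choice with
  -- precision `1 / (k + 1)` gives a single family.
  obtain ⟨C, hC⟩ := CovertAWGN.exists_forall_eventually
    (fun k T (C : CovertAWGN.Code T) => C.IsGood S W Nw Nb r rK (1 - δ) (1 / (k + 1)))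
    (fun k l T C hkl h => h.mono (one_div_le_one_div_of_le (by positivity)
      (by exact_mod_cast Nat.succ_le_succ hkl))) fun k => key _ (by positivity)
  refine ⟨C, CovertAWGN.achieves_of_isGood hW fun ε hε => ?_⟩
  obtain ⟨k, hk⟩ := exists_nat_one_div_lt hε
  exact (hC k).mono fun T hT => hT.mono hk.le
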